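/- A \emph{cLD election} is a finite directed graph $G=(N,E)$, where an edge $(i,j)\in E$ means that voter $i$ approves voter $j$ as representative, together with a voting cost $v(i)\in\mathbb{N}$ and a delegating cost $d(i)\in\mathbb{N}$ for each $i\in N$. Let $\Delta$ be the maximum out-degree of $G$. A \emph{solution} is a pair $(C,D)$, where $C\subseteq N$ is the set of casting voters and $D\subseteq E$ consists of exactly one outgoing edge for each voter in $N\setminus C$. It satisfies the \emph{reachability constraint} if every $i\in N\setminus C$ has a directed path, using only edges in $D$, to a voter in $C$. It is \emph{cost-minimizing} if it satisfies the reachability constraint and its cost $\sum_{i\in C}v(i)+\sum_{i\in N\setminus C}d(i)$ is minimum among all solutions that do so. The \emph{voting power} of $j\in C$ is $1$ plus the number of voters in $N\setminus C$ that have a directed path to $j$ in $D$. A voter $x$ is the \emph{sole super-voter} under $(C,D)$ if $x\in C$ and the voting power of $x$ is strictly larger than that of every other voter in $C$. The problem \textsc{Control by Deleting Voters} is the following. Input: a cLD election $(G(N,E),v,d)$, integers $\beta\geq 1$ and $k\geq 1$, and a designated voter $x\in N$ (numbers are given in binary; the question does not depend on the budget $\beta$). Question: is there a set $S\subseteq N$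 with $|S|\le k$ such that, in the election obtained by deleting the voters of $S$ and all edges incident to them, $x$ is the sole super-voter under every cost-minimizing solution? \textbf{Theorem.} Restricted to inputs with $\Delta\le 1$, \textsc{Control by Deleting Voters} is solvable in polynomial time. -/

import Mathlib

namespace LiquidDemocracy

/-! ## Elections with voting and delegating costs -/

/-- A cLD election: a finite directed graph of voters (an edge `(i, j)` says that `i` approves `j`
as her immediate representative), with a voting cost and a delegating cost for every voter.
The values of the cost functions outside `voters` play no role. -/
structure Election (V : Type*) where
  voters : Finset V
  edges : Finset (V × V)
  edges_mem : ∀ e ∈ edges, e.1 ∈ voters ∧ e.2 ∈ voters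
  votingCost : V → ℕ
  delegatingCost : V → ℕ

namespace Election

variable {V : Type*} [DecidableEq V]

/-- The number of voters that `i` approves. -/
def outDegree (G : Election V) (i : V) : ℕ :=
  (G.edges.filter (fun e => e.1 = i)).card

/-- The maximum out-degree `Δ` of the delegation graph. -/
def maxOutDegree (G : Election V) : ℕ :=
  G.voters.sup G.outDegree

/-- The election that remains after the voters in `S` are deleted, with all edges at them. -/
def delete (G : Election V) (S : Finset V) : Election V where
  voters := G.voters \ S
  edges := G.edges.filter (fun e => e.1 ∉ S ∧ e.2 ∉ S)
  edges_mem := by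
    intro e he
    obtain ⟨he, h₁, h₂⟩ := Finset.mem_filter.1 he
    exact ⟨Finset.mem_sdiff.2 ⟨(G.edges_mem e he).1, h₁⟩,
      Finset.mem_sdiff.2 ⟨(G.edges_mem e he).2, h₂⟩⟩
  votingCost := G.votingCost
  delegatingCost := G.delegatingCost

/-- `(C, D)` is a solution: `C` is a set of voters (the casting voters) and `D` consists of exactly
one outgoing edge for each voter that is not in `C`. -/
structure IsSolution (G : Election V) (C : Finset V) (D : Finset (V × V)) : Prop where
  casting_subset : C ⊆ G.voters
  delegation_subset : D ⊆ G.edges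
  source_not_casting : ∀ e ∈ D, e.1 ∉ C
  existsUnique_edge : ∀ i ∈ G.voters \ C, ∃! j, (i, j) ∈ D

/-- There is a directed path (possibly of length zero) from `i` to `j` using only edges in `D`. -/
def HasPath (D : Finset (V × V)) (i j : V) : Prop :=
  Relation.ReflTransGen (fun a b => (a, b) ∈ D) i j

/-- The reachability constraint: every delegating voter has a path in `D` to a casting voter. -/
def Reachability (G : Election V) (C : Finset V) (D : Finset (V × V)) : Prop :=
  ∀ i ∈ G.voters \ C, ∃ j ∈ C, HasPath D i j

/-- The total cost of a solution with set of casting voters `C`. -/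
def cost (G : Election V) (C : Finset V) : ℕ :=
  ∑ i ∈ C, G.votingCost i + ∑ i ∈ G.voters \ C, G.delegatingCost i

/-- `(C, D)` is a solution that meets the reachability constraint, at the least cost at which this
is possible. -/
def CostMinimizing (G : Election V) (C : Finset V) (D : Finset (V × V)) : Prop :=
  G.IsSolution C D ∧ G.Reachability C D ∧
    ∀ C' D', G.IsSolution C' D' → G.Reachability C' D' → G.cost C ≤ G.cost C'

open Classical in
/-- The set `R_j` of delegating voters that are represented by `j`. -/
noncomputable def represented (G : Election V) (C : Finset V) (D : Finset (V × V)) (j : V) :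
    Finset V :=
  (G.voters \ C).filter (fun i => HasPath D i j)

/-- The voting power `|R_j| + 1` of a casting voter `j`. -/
noncomputable def power (G : Election V) (C : Finset V) (D : Finset (V × V)) (j : V) : ℕ :=
  (G.represented C D j).card + 1

/-- Under the solution `(C, D)`, `x` is a casting voter, and her voting power is strictly higher
than that of every other casting voter. -/
def IsSoleSuperVoter (G : Election V) (C : Finset V) (D : Finset (V × V)) (x : V) : Prop :=
  x ∈ C ∧ ∀ y ∈ C, y ≠ x → G.power C D y < G.power C D x

/-- At most `k` voters can be deleted so that `x` is the sole super-voter of the resulting election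
under every cost-minimizing solution that satisfies the reachability constraint. -/
def ControlByDeletingVoters (G : Election V) (k : ℕ) (x : V) : Prop :=
  ∃ S ⊆ G.voters, S.card ≤ k ∧
    ∀ C D, (G.delete S).CostMinimizing C D → (G.delete S).IsSoleSuperVoter C D x

end Election

/-! ## The decision problem and its encoding -/

/-- An input of Control by Deleting Voters; the voters are named `0, …, n - 1`. -/
structure CDVInstance where
  n : ℕ
  G : Election ℕ
  voters_eq : G.voters = Finset.range n
  /-- The budget. It belongs to the input but the question does not depend on it. -/
  β : ℕ
  β_pos : 0 < β
  k : ℕ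
  k_pos : 0 < k
  x : ℕ
  x_mem : x ∈ G.voters

/-- The question of Control by Deleting Voters. -/
def CDVInstance.IsYes (I : CDVInstance) : Prop :=
  I.G.ControlByDeletingVoters I.k I.x

/-- An instance written down as a list of numbers: the parameters, the voting costs, the delegating
costs, and the adjacency matrix row by row. -/
def CDVInstance.encode (I : CDVInstance) : List ℕ :=
  [I.n, I.x, I.k, I.β] ++ (List.range I.n).map I.G.votingCost ++
    (List.range I.n).map I.G.delegatingCost ++
    (List.range I.n).flatMap fun i =>
      (List.range I.n).map fun j => if (i, j) ∈ I.G.edges then 1 else 0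

/-- The instances with `Δ ≤ 1`. -/
def CDVInstanceDegreeLeOne : Type := {I : CDVInstance // I.G.maxOutDegree ≤ 1}

/-- The length of a list of numbers written in binary, with a separator after each number. -/
def bitLength (L : List ℕ) : ℕ :=
  (L.map fun w => Nat.size w + 1).sum

/-! ## Programs for a random access machine, with their running time

Memory cells hold natural numbers; there are named registers and named arrays. The arithmetic
operations are addition and truncated subtraction only (no multiplication), so a run of `t` steps
lengthens the binary representation of the numbers in memory by `O(t)` bits, and polynomial time is
the same as on a Turing machine. -/

/-- The contents of the memory: registers and arrays. -/
structure Memory where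
  reg : ℕ → ℕ
  arr : ℕ → ℕ → ℕ

/-- Arithmetic expressions. `read a e` is the entry of array `a` at index `e`. -/
inductive Term where
  | const (c : ℕ)
  | reg (r : ℕ)
  | read (a : ℕ) (e : Term)
  | add (e₁ e₂ : Term)
  | sub (e₁ e₂ : Term)
  | lt (e₁ e₂ : Term)
  | eq (e₁ e₂ : Term)

/-- The value of an expression; the comparisons have value `1` (true) or `0` (false). -/
def Term.eval (m : Memory) : Term → ℕ
  | const c => c
  | reg r => m.reg r
  | read a e => m.arr a (e.eval m)
  | add e₁ e₂ => e₁.eval m + e₂.eval m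
  | sub e₁ e₂ => e₁.eval m - e₂.eval m
  | lt e₁ e₂ => if e₁.eval m < e₂.eval m then 1 else 0
  | eq e₁ e₂ => if e₁.eval m = e₂.eval m then 1 else 0

/-- The number of steps for evaluating an expression: one for every operation and operand. -/
def Term.steps : Term → ℕ
  | const _ => 1
  | reg _ => 1
  | read _ e => e.steps + 1
  | add e₁ e₂ => e₁.steps + e₂.steps + 1
  | sub e₁ e₂ => e₁.steps + e₂.steps + 1
  | lt e₁ e₂ => e₁.steps + e₂.steps + 1
  | eq e₁ e₂ => e₁.steps + e₂.steps + 1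

/-- Programs. `assign r e` puts the value of `e` into register `r`, `store a i e` puts it into
array `a` at index `i`, `cond e p q` is "if `e ≠ 0` then `p` else `q`", and `loop e p` is "while
`e ≠ 0` do `p`". -/
inductive Program where
  | nop
  | assign (r : ℕ) (e : Term)
  | store (a : ℕ) (i e : Term)
  | seq (p q : Program)
  | cond (e : Term) (p q : Program)
  | loop (e : Term) (p : Program)

/-- `Runs p m m' t`: started on memory `m`, the program `p` halts after `t` steps with
memory `m'`. -/
inductive Runs : Program → Memory → Memory → ℕ → Prop where
  | nop (m : Memory) : Runs .nop m m 1
  | assign (r : ℕ) (e : Term) (m : Memory) :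
      Runs (.assign r e) m ⟨Function.update m.reg r (e.eval m), m.arr⟩ (e.steps + 1)
  | store (a : ℕ) (i e : Term) (m : Memory) :
      Runs (.store a i e) m
        ⟨m.reg, Function.update m.arr a (Function.update (m.arr a) (i.eval m) (e.eval m))⟩
        (i.steps + e.steps + 1)
  | seq {p q : Program} {m₁ m₂ m₃ : Memory} {t₁ t₂ : ℕ} :
      Runs p m₁ m₂ t₁ → Runs q m₂ m₃ t₂ → Runs (.seq p q) m₁ m₃ (t₁ + t₂)
  | cond_true {e : Term} {p q : Program} {m₁ m₂ : Memory} {t : ℕ} :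
      e.eval m₁ ≠ 0 → Runs p m₁ m₂ t → Runs (.cond e p q) m₁ m₂ (e.steps + 1 + t)
  | cond_false {e : Term} {p q : Program} {m₁ m₂ : Memory} {t : ℕ} :
      e.eval m₁ = 0 → Runs q m₁ m₂ t → Runs (.cond e p q) m₁ m₂ (e.steps + 1 + t)
  | loop_false {e : Term} {p : Program} {m : Memory} :
      e.eval m = 0 → Runs (.loop e p) m m (e.steps + 1)
  | loop_true {e : Term} {p : Program} {m₁ m₂ m₃ : Memory} {t₁ t₂ : ℕ} :
      e.eval m₁ ≠ 0 → Runs p m₁ m₂ t₁ → Runs (.loop e p) m₂ m₃ t₂ →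
        Runs (.loop e p) m₁ m₃ (e.steps + 1 + t₁ + t₂)

/-- The initial memory: the input is in array `0` and its length in register `0`; everything else
is zero. -/
def Memory.init (L : List ℕ) : Memory where
  reg r := if r = 0 then L.length else 0
  arr a i := if a = 0 then L.getD i 0 else 0

/-- The decision problem `yes` on the inputs `α`, encoded by `enc`, is solvable in polynomial time:
one program halts on every input after a number of steps that is bounded by a polynomial in the
binary length of the input, with the answer (`1` for yes, `0` for no) in register `0`. -/
def SolvableInPolynomialTime {α : Type*} (enc : α → List ℕ) (yes : α → Prop) : Prop :=
  ∃ (p : Program) (B : Polynomial ℕ), ∀ a : α, ∃ (m : Memory) (t : ℕ),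
    Runs p (Memory.init (enc a)) m t ∧ t ≤ B.eval (bitLength (enc a)) ∧
      (yes a → m.reg 0 = 1) ∧ (¬ yes a → m.reg 0 = 0)

end LiquidDemocracy

namespace LiquidDemocracy
namespace Election

open Relation

set_option linter.unusedSectionVars false

variable {V : Type*} [DecidableEq V]

/-! ## Solutions when every voter approves at most one voter -/

/-! With at most one approval per voter, a solution is determined by its casting set `C`: `D` must
consist of the approval edges that leave voters outside `C`. So only optimal casting sets matter
(`forall_costMinimizing_iff`), and exchange arguments tell who casts in them.

Suppose that `x` casts in all optimal sets. Voters that lead to `x` through voters who strictly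
prefer delegating (the loyal ones) then always support `x`. In the worst case nobody else does:
indifferent voters can be made to cast for free, except that those upstream of a rival `y` can all
be made to delegate to `y`. Hence `x` always wins exactly if no remaining rival has more potential
supporters, itself included, than `x` has loyal voters. Since the comparison is with the loyal
voters of the original graph, deleting loyal voters is useless. For `x` to cast always, `x` must be
`Forced` or the voter `b` that `x` approves must be deleted (`forced_or_exists_mem`); conversely
this suffices if otherwise only voters of the rest are deleted (`Optimal.mem_of_forced`). This gives
`controlByDeletingVoters_iff`: two instances, `B = ∅` and `B = {b}`, of one graph problem.

That problem asks for the fewest vertices of a functional graph whose deletion leaves at most `q`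
vertices leading to any vertex. On a forest, cutting from the leaves whenever a subtree exceeds `q`
is optimal. On a component with a cycle, the greedy cuts off the cycle come first. If what then
hangs on the cycle has at most `q` vertices, nothing more is needed. Otherwise some deletion lies in
what hangs there, and may be moved down to a cycle vertex `r`; deleting `r` opens the cycle, the
greedy rule applies again, and all `r` are tried. The lower bound `Splits.splitCost_le` finds an
element of any solution in each of the disjoint trees of the greedily deleted vertices.

The algorithm is written in a small language in which every loop runs `n + 1` times. Its compiler is
verified once (`Expr.correct`, `Stmt.correct`), with a time bound that is a polynomial in `n + 1`,
and `n + 1` is at most the length of the input. -/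

/-- Every voter approves at most one voter. -/
def Functional (G : Election V) : Prop :=
  ∀ i j j', (i, j) ∈ G.edges → (i, j') ∈ G.edges → j = j'

/-- `i` approves `j`. -/
def Approves (G : Election V) (i j : V) : Prop := (i, j) ∈ G.edges

/-- `i` approves `j`, and `i` is not a casting voter. -/
def DelegatesTo (G : Election V) (C : Finset V) (i j : V) : Prop := i ∉ C ∧ (i, j) ∈ G.edges

/-- Every voter can reach a casting voter in the graph. -/
def Feasible (G : Election V) (C : Finset V) : Prop :=
  C ⊆ G.voters ∧ ∀ i ∈ G.voters, ∃ j ∈ C, ReflTransGen G.Approves i j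

/-- `C` is feasible at the least possible cost. -/
def Optimal (G : Election V) (C : Finset V) : Prop :=
  G.Feasible C ∧ ∀ C', G.Feasible C' → G.cost C ≤ G.cost C'

open Classical in
/-- The delegating voters whose path of approvals meets `C` first in `j`. -/
noncomputable def supporters (G : Election V) (C : Finset V) (j : V) : Finset V :=
  (G.voters \ C).filter fun i => ReflTransGen (G.DelegatesTo C) i j

theorem mem_supporters {G : Election V} {C : Finset V} {i j : V} :
    i ∈ G.supporters C j ↔
      (i ∈ G.voters ∧ i ∉ C) ∧ ReflTransGen (G.DelegatesTo C) i j := by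
  simp [supporters]

theorem functional_of_maxOutDegree_le_one {G : Election V} (h : G.maxOutDegree ≤ 1) :
    G.Functional := by
  intro i j j' h₁ h₂
  have hi : G.outDegree i ≤ 1 := (Finset.le_sup (G.edges_mem _ h₁).1).trans h
  have := Finset.card_le_one.1 hi (i, j) (by simp [h₁]) (i, j') (by simp [h₂])
  exact (Prod.ext_iff.1 this).2

theorem Functional.delete {G : Election V} (h : G.Functional) (S : Finset V) :
    (G.delete S).Functional := by
  intro i j j' h₁ h₂
  exact h i j j' (Finset.mem_filter.1 h₁).1 (Finset.mem_filter.1 h₂).1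

theorem mem_edges_delete {G : Election V} {S : Finset V} {i j : V} :
    (i, j) ∈ (G.delete S).edges ↔ (i, j) ∈ G.edges ∧ i ∉ S ∧ j ∉ S := by
  simp [Election.delete]

theorem mem_voters_delete {G : Election V} {S : Finset V} {i : V} :
    i ∈ (G.delete S).voters ↔ i ∈ G.voters ∧ i ∉ S := by
  simp [Election.delete]

theorem Functional.approves_rightUnique {G : Election V} (h : G.Functional) :
    Relator.RightUnique G.Approves := fun i j j' h₁ h₂ => h i j j' h₁ h₂

theorem Functional.delegatesTo_rightUnique {G : Election V} (h : G.Functional) (C : Finset V) :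
    Relator.RightUnique (G.DelegatesTo C) := fun i j j' h₁ h₂ => h i j j' h₁.2 h₂.2

/-- The outgoing edge that a delegating voter must have can only be the unique approval, so `D`
carries no information beyond `C`. -/
theorem IsSolution.mem_iff {G : Election V} (hG : G.Functional) {C : Finset V}
    {D : Finset (V × V)} (h : G.IsSolution C D) {i j : V} :
    (i, j) ∈ D ↔ G.DelegatesTo C i j := by
  constructor
  · intro hD
    exact ⟨h.source_not_casting _ hD, h.delegation_subset hD⟩
  · rintro ⟨hC, hE⟩
    obtain ⟨j', hj', -⟩ := h.existsUnique_edge i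
      (Finset.mem_sdiff.2 ⟨(G.edges_mem _ hE).1, hC⟩)
    rwa [hG i j j' hE (h.delegation_subset hj')]

theorem IsSolution.hasPath_iff {G : Election V} (hG : G.Functional) {C : Finset V}
    {D : Finset (V × V)} (h : G.IsSolution C D) {i j : V} :
    HasPath D i j ↔ ReflTransGen (G.DelegatesTo C) i j := by
  unfold HasPath
  rw [show (fun a b => (a, b) ∈ D) = G.DelegatesTo C from
    funext fun a => funext fun b => propext (h.mem_iff hG)]

theorem IsSolution.feasible {G : Election V} {C : Finset V}
    {D : Finset (V × V)} (h : G.IsSolution C D) (hr : G.Reachability C D) : G.Feasible C := by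
  refine ⟨h.casting_subset, fun i hi => ?_⟩
  by_cases hC : i ∈ C
  · exact ⟨i, hC, .refl⟩
  · obtain ⟨j, hj, hp⟩ := hr i (Finset.mem_sdiff.2 ⟨hi, hC⟩)
    exact ⟨j, hj, ReflTransGen.mono (fun a b hab => h.delegation_subset hab) _ _ hp⟩

/-- A path of approvals may run through several casting voters; cut off at the first of them, all
its sources delegate. This is why `Feasible` can speak of paths in the whole graph and is monotone
in `C`. -/
theorem Feasible.exists_delegatesTo {G : Election V} {C : Finset V} {i j : V} (hj : j ∈ C)
    (h : ReflTransGen G.Approves i j) : ∃ j' ∈ C, ReflTransGen (G.DelegatesTo C) i j' := by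
  induction h using ReflTransGen.head_induction_on with
  | refl => exact ⟨j, hj, .refl⟩
  | @head a c hac _ ih =>
    by_cases ha : a ∈ C
    · exact ⟨a, ha, .refl⟩
    · obtain ⟨j', hj', hp⟩ := ih
      exact ⟨j', hj', .head ⟨ha, hac⟩ hp⟩

theorem Feasible.exists_isSolution {G : Election V} (hG : G.Functional) {C : Finset V}
    (h : G.Feasible C) : ∃ D, G.IsSolution C D ∧ G.Reachability C D := by
  refine ⟨G.edges.filter fun e => e.1 ∉ C, ⟨h.1, Finset.filter_subset _ _, ?_, ?_⟩, ?_⟩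
  · intro e he
    exact (Finset.mem_filter.1 he).2
  · intro i hi
    obtain ⟨hi, hC⟩ := Finset.mem_sdiff.1 hi
    obtain ⟨j, hj, hp⟩ := h.2 i hi
    rcases hp.cases_head with rfl | ⟨c, hc, -⟩
    · exact absurd hj hC
    · exact ⟨c, Finset.mem_filter.2 ⟨hc, hC⟩, fun y hy => hG i y c (Finset.mem_filter.1 hy).1 hc⟩
  · intro i hi
    obtain ⟨j, hj, hp⟩ := h.2 i (Finset.mem_sdiff.1 hi).1
    obtain ⟨j', hj', hp'⟩ := Feasible.exists_delegatesTo hj hp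
    refine ⟨j', hj', ReflTransGen.mono (fun a b hab => ?_) _ _ hp'⟩
    exact Finset.mem_filter.2 ⟨hab.2, hab.1⟩

/-- Eliminates `D`: from here on only casting sets are compared. The `+ 1` in the voting power
cancels. -/
theorem forall_costMinimizing_iff {G : Election V} (hG : G.Functional) (x : V) :
    (∀ C D, G.CostMinimizing C D → G.IsSoleSuperVoter C D x) ↔
      ∀ C, G.Optimal C → x ∈ C ∧
        ∀ y ∈ C, y ≠ x → (G.supporters C y).card < (G.supporters C x).card := by
  have key : ∀ C D, G.IsSolution C D → (G.IsSoleSuperVoter C D x ↔ x ∈ C ∧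
        ∀ y ∈ C, y ≠ x → (G.supporters C y).card < (G.supporters C x).card) := by
    intro C D h
    have : ∀ y, G.represented C D y = G.supporters C y := by
      intro y
      ext i
      simp only [represented, supporters, Finset.mem_filter, h.hasPath_iff hG]
    simp [IsSoleSuperVoter, power, this]
  constructor
  · intro h C hC
    obtain ⟨D, hD, hr⟩ := hC.1.exists_isSolution hG
    exact (key C D hD).1 (h C D ⟨hD, hr, fun C' D' h₁ h₂ => hC.2 C' (h₁.feasible h₂)⟩)
  · rintro h C D ⟨h₁, h₂, h₃⟩
    refine (key C D h₁).2 (h C ⟨h₁.feasible h₂, fun C' hC' => ?_⟩)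
    obtain ⟨D', hD', hr⟩ := hC'.exists_isSolution hG
    exact h₃ C' D' hD' hr

theorem exists_optimal (G : Election V) : ∃ C, G.Optimal C := by
  classical
  have hne : (G.voters.powerset.filter G.Feasible).Nonempty :=
    ⟨G.voters, by simpa using ⟨subset_rfl, fun i hi => ⟨i, hi, .refl⟩⟩⟩
  obtain ⟨C, hC, hmin⟩ := Finset.exists_min_image _ G.cost hne
  refine ⟨C, (Finset.mem_filter.1 hC).2, fun C' hC' => hmin C' ?_⟩
  exact Finset.mem_filter.2 ⟨Finset.mem_powerset.2 hC'.1, hC'⟩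

/-! ## Costs -/

theorem cost_eq_sum {G : Election V} {C : Finset V} (hC : C ⊆ G.voters) :
    G.cost C = ∑ i ∈ G.voters, if i ∈ C then G.votingCost i else G.delegatingCost i := by
  unfold cost
  rw [Finset.sum_ite, Finset.filter_mem_eq_inter, Finset.inter_eq_right.2 hC,
    Finset.filter_notMem_eq_sdiff]

theorem cost_insert {G : Election V} {C : Finset V} {i : V}
    (hi : i ∈ G.voters) (hiC : i ∉ C) :
    G.cost (insert i C) + G.delegatingCost i = G.cost C + G.votingCost i := by
  unfold cost
  have h : G.voters \ C = insert i (G.voters \ insert i C) := by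
    ext a; by_cases a = i <;> simp_all
  rw [Finset.sum_insert hiC, h, Finset.sum_insert (by simp)]
  omega

theorem cost_erase {G : Election V} {C : Finset V} (hC : C ⊆ G.voters) {i : V} (hiC : i ∈ C) :
    G.cost (C.erase i) + G.votingCost i = G.cost C + G.delegatingCost i := by
  have := cost_insert (G := G) (C := C.erase i) (hC hiC)
    (Finset.notMem_erase _ _)
  rw [Finset.insert_erase hiC] at this
  omega

theorem cost_le_cost {G : Election V} {C C' : Finset V} (hC : C ⊆ G.voters) (hC' : C' ⊆ G.voters)
    (h₁ : ∀ i ∈ C', i ∉ C → G.votingCost i ≤ G.delegatingCost i)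
    (h₂ : ∀ i ∈ C, i ∉ C' → G.delegatingCost i ≤ G.votingCost i) : G.cost C' ≤ G.cost C := by
  rw [cost_eq_sum hC, cost_eq_sum hC']
  refine Finset.sum_le_sum fun i _ => ?_
  by_cases h : i ∈ C <;> by_cases h' : i ∈ C' <;> simp [h, h']
  · exact h₂ i h h'
  · exact h₁ i h' h

theorem Feasible.mono {G : Election V} {C C' : Finset V} (h : G.Feasible C) (hs : C ⊆ C')
    (hC' : C' ⊆ G.voters) : G.Feasible C' :=
  ⟨hC', fun i hi => let ⟨j, hj, hp⟩ := h.2 i hi; ⟨j, hs hj, hp⟩⟩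

/-- Whoever relied on a removed voter continues from there to `y`. All exchange arguments below rest
on this. -/
theorem Feasible.insert_sdiff {G : Election V} {C U : Finset V} {y : V} (h : G.Feasible C)
    (hy : y ∈ G.voters) (hU : ∀ u ∈ U, u ∈ C → ReflTransGen G.Approves u y) :
    G.Feasible (insert y (C \ U)) := by
  refine ⟨Finset.insert_subset hy (Finset.sdiff_subset.trans h.1), fun i hi => ?_⟩
  obtain ⟨j, hj, hp⟩ := h.2 i hi
  by_cases hjU : j ∈ U
  · exact ⟨y, by simp, hp.trans (hU j hjU hj)⟩
  · exact ⟨j, by simp [hj, hjU], hp⟩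

theorem Optimal.mem_of_votingCost_lt {G : Election V} {C : Finset V} (h : G.Optimal C) {i : V}
    (hi : i ∈ G.voters) (hlt : G.votingCost i < G.delegatingCost i) : i ∈ C := by
  by_contra hC
  have h₁ := h.2 _ (h.1.mono (Finset.subset_insert i C) (Finset.insert_subset hi h.1.1))
  have h₂ := cost_insert hi hC
  omega

/-- Otherwise `i` could delegate at a strictly lower cost, since `j` still serves everyone who
reached `i`. -/
theorem Optimal.votingCost_le {G : Election V} {C : Finset V} (h : G.Optimal C) {i j : V}
    (hi : i ∈ C) (hj : j ∈ C) (hij : i ≠ j) (hp : ReflTransGen G.Approves i j) :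
    G.votingCost i ≤ G.delegatingCost i := by
  have hf : G.Feasible (C.erase i) := by
    have := h.1.insert_sdiff (U := {i}) (h.1.1 hj) (by simpa using fun _ => hp)
    rwa [Finset.insert_eq_self.2 (by simp [hj, hij.symm]), Finset.sdiff_singleton_eq_erase] at this
  have h₁ := h.2 _ hf
  have h₂ := cost_erase h.1.1 hi
  omega

/-- The disjunctions separate two cases. If `j` already casts, only the saving at `i` counts; if
not, the differences of voting and delegating cost are compared, written as sums to avoid truncated
subtraction. -/
theorem Feasible.exchange {G : Election V} {C : Finset V} (h : G.Feasible C) {i j : V}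
    (hi : i ∈ C) (hj : j ∈ G.voters) (hij : i ≠ j) (hp : ReflTransGen G.Approves i j)
    (hd : G.delegatingCost i ≤ G.votingCost i ∨ j ∉ C)
    (hc : G.votingCost j + G.delegatingCost i ≤ G.votingCost i + G.delegatingCost j ∨ j ∈ C) :
    G.Feasible (insert j (C.erase i)) ∧ G.cost (insert j (C.erase i)) ≤ G.cost C := by
  constructor
  · have := h.insert_sdiff (U := {i}) hj (by simpa using fun _ => hp)
    rwa [Finset.sdiff_singleton_eq_erase] at this
  · have h₂ := cost_erase h.1 hi
    by_cases hjC : j ∈ C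
    · rw [Finset.insert_eq_self.2 (Finset.mem_erase.2 ⟨hij.symm, hjC⟩)]
      have := hd.resolve_right (not_not.2 hjC)
      omega
    · have h₃ := cost_insert hj
        (fun hm : j ∈ C.erase i => hjC (Finset.mem_of_mem_erase hm))
      have := hc.resolve_right hjC
      omega

end Election
end LiquidDemocracy

namespace LiquidDemocracy
namespace Election

open Relation

set_option linter.unusedSectionVars false

variable {V : Type*} [DecidableEq V]

/-! ## Control by deleting voters as a component size problem -/

/-- `a ≠ x` approves `c`, strictly prefers delegating, and is not in `B`. -/
def LoyalStep (G : Election V) (x : V) (B : Finset V) (a c : V) : Prop :=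
  a ≠ x ∧ a ∉ B ∧ G.delegatingCost a < G.votingCost a ∧ (a, c) ∈ G.edges

open Classical in
/-- The voters other than `x` that surely delegate to `x` if `x` casts and `B` is deleted. -/
noncomputable def loyal (G : Election V) (x : V) (B : Finset V) : Finset V :=
  G.voters.filter fun a => a ≠ x ∧ ReflTransGen (G.LoyalStep x B) a x

/-- The voters that are neither `x`, nor in `B`, nor loyal to `x`. -/
noncomputable def rest (G : Election V) (x : V) (B : Finset V) : Finset V :=
  G.voters.filter fun a => a ≠ x ∧ a ∉ B ∧ a ∉ G.loyal x B

/-- `a` and `c` are not loyal to `x`, and `a` may delegate to `c`. -/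
def RestStep (G : Election V) (x : V) (B : Finset V) (a c : V) : Prop :=
  a ∈ G.rest x B ∧ c ∈ G.rest x B ∧ (a, c) ∈ G.edges ∧ G.delegatingCost a ≤ G.votingCost a

/-- A step of `RestStep` outside `T`. -/
def RestStepAvoiding (G : Election V) (x : V) (B T : Finset V) (a c : V) : Prop :=
  a ∉ T ∧ c ∉ T ∧ G.RestStep x B a c

open Classical in
/-- The voters that may delegate to `w` when `B` and `T` are deleted. -/
noncomputable def upstream (G : Election V) (x : V) (B T : Finset V) (w : V) : Finset V :=
  (G.rest x B).filter fun u => ReflTransGen (G.RestStepAvoiding x B T) u w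

/-- Deleting `T` leaves no voter with more potential supporters than `x` has loyal voters. -/
def Dominated (G : Election V) (x : V) (B T : Finset V) : Prop :=
  T ⊆ G.rest x B ∧ ∀ w ∈ G.rest x B, w ∉ T → (G.upstream x B T w).card ≤ (G.loyal x B).card

/-- The voter `x` casts in every optimal solution. -/
def Forced (G : Election V) (x : V) : Prop :=
  (∀ j, (x, j) ∉ G.edges) ∨ G.votingCost x < G.delegatingCost x ∨
    (TransGen G.Approves x x ∧ ∀ j, j ≠ x → ReflTransGen G.Approves x j →
      G.votingCost x + G.delegatingCost j < G.votingCost j + G.delegatingCost x)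

theorem mem_rest {G : Election V} {x : V} {B : Finset V} {a : V} :
    a ∈ G.rest x B ↔ a ∈ G.voters ∧ a ≠ x ∧ a ∉ B ∧ a ∉ G.loyal x B := by
  simp [rest]

theorem mem_loyal {G : Election V} {x : V} {B : Finset V} {a : V} :
    a ∈ G.loyal x B ↔ a ∈ G.voters ∧ a ≠ x ∧ ReflTransGen (G.LoyalStep x B) a x := by
  simp [loyal]

theorem mem_upstream {G : Election V} {x : V} {B T : Finset V} {u w : V} :
    u ∈ G.upstream x B T w ↔
      u ∈ G.rest x B ∧ ReflTransGen (G.RestStepAvoiding x B T) u w := by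
  simp [upstream]

theorem LoyalStep.mem_loyal {G : Election V} {x : V} {B : Finset V} {a c : V}
    (h : G.LoyalStep x B a c) (hc : c = x ∨ c ∈ G.loyal x B) : a ∈ G.loyal x B := by
  refine Election.mem_loyal.2 ⟨(G.edges_mem _ h.2.2.2).1, h.1, .head h ?_⟩
  rcases hc with rfl | hc
  · exact .refl
  · exact (Election.mem_loyal.1 hc).2.2

theorem exists_loyalStep {G : Election V} {x : V} {B : Finset V} {a : V}
    (h : a ∈ G.loyal x B) :
    ∃ c, G.LoyalStep x B a c ∧ (c = x ∨ c ∈ G.loyal x B) := by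
  obtain ⟨-, hne, hp⟩ := mem_loyal.1 h
  rcases hp.cases_head with rfl | ⟨c, hc, hp⟩
  · exact absurd rfl hne
  · refine ⟨c, hc, ?_⟩
    by_cases hcx : c = x
    · exact .inl hcx
    · exact .inr (mem_loyal.2 ⟨(G.edges_mem _ hc.2.2.2).2, hcx, hp⟩)

theorem notMem_of_mem_loyal {G : Election V} {x : V} {B : Finset V} {a : V}
    (h : a ∈ G.loyal x B) : a ∉ B := by
  obtain ⟨c, hc, -⟩ := exists_loyalStep h
  exact hc.2.1

/-- All voters on a loyal path are loyal themselves, so the path survives every deletion that spares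
`x` and the loyal voters. -/
theorem reflTransGen_approves_delete {G : Election V} {x : V} {B S : Finset V}
    (hx : x ∉ S) (hS : ∀ a ∈ G.loyal x B, a ∉ S) {a : V} (h : a = x ∨ a ∈ G.loyal x B) :
    ReflTransGen (G.delete S).Approves a x := by
  rcases h with rfl | h
  · exact .refl
  have hp := (mem_loyal.1 h).2.2
  clear h
  induction hp using ReflTransGen.head_induction_on with
  | refl => exact .refl
  | @head a c hac hcx ih =>
    have hc : c = x ∨ c ∈ G.loyal x B := by
      by_cases hcx' : c = x
      · exact .inl hcx'
      · exact .inr (mem_loyal.2 ⟨(G.edges_mem _ hac.2.2.2).2, hcx', hcx⟩)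
    refine .head (mem_edges_delete.2 ⟨hac.2.2.2, hS a (hac.mem_loyal hc), ?_⟩) ih
    rcases hc with rfl | hc
    · exact hx
    · exact hS c hc

/-- On the cycle of a forced voter that prefers delegating, all other voters are loyal. -/
theorem mem_loyal_of_forced {G : Election V} (hG : G.Functional) {x : V}
    (hcyc : TransGen G.Approves x x)
    (hmin : ∀ j, j ≠ x → ReflTransGen G.Approves x j →
      G.votingCost x + G.delegatingCost j < G.votingCost j + G.delegatingCost x)
    (hx : G.delegatingCost x ≤ G.votingCost x) {j : V} (hj : ReflTransGen G.Approves x j) :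
    j = x ∨ j ∈ G.loyal x ∅ := by
  -- Successors are unique and `x` lies on a cycle, so everything reachable from `x` lies on that
  -- cycle.
  have hback : ReflTransGen G.Approves j x := by
    induction hj with
    | refl => exact .refl
    | @tail a c hxa hac ih =>
      rcases ih.cases_head with rfl | ⟨c', hc', hp⟩
      · obtain ⟨c', hc', hp⟩ := TransGen.head'_iff.1 hcyc
        rwa [hG _ _ _ hac hc']
      · rwa [hG _ _ _ hac hc']
  induction hback using ReflTransGen.head_induction_on with
  | refl => exact .inl rfl
  | @head a c hac _ ih =>
    by_cases hax : a = x
    · exact .inl hax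
    -- The difference of voting and delegating cost at `a` exceeds the one at `x`, which is
    -- nonnegative by `hx`; so `a` strictly prefers delegating.
    · have := hmin a hax hj
      refine .inr (LoyalStep.mem_loyal ⟨hax, by simp, by omega, hac⟩ (ih (hj.tail hac)))

/-- If `x` has no edge left, because there was none or its target is in `B`, then `x` reaches only
itself. If casting is strictly cheaper for `x`, adding `x` to `C` saves cost. On a cycle the other
voters are loyal, hence not deleted, and one of them casting in place of `x` could be exchanged for
`x` at a strict profit. -/
theorem Optimal.mem_of_forced {G : Election V} (hG : G.Functional) {x : V} {B T C : Finset V}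
    (hx : x ∈ G.voters) (hB : (∃ b ∈ B, (x, b) ∈ G.edges) ∨ B = ∅ ∧ G.Forced x) (hxB : x ∉ B)
    (hT : T ⊆ G.rest x B) (hC : (G.delete (T ∪ B)).Optimal C) : x ∈ C := by
  have hxS : x ∉ T ∪ B := by
    simp only [Finset.mem_union, not_or]
    exact ⟨fun h => (mem_rest.1 (hT h)).2.1 rfl, hxB⟩
  have hxH : x ∈ (G.delete (T ∪ B)).voters := mem_voters_delete.2 ⟨hx, hxS⟩
  obtain ⟨z, hzC, hxz⟩ := hC.1.2 x hxH
  by_contra hxC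
  obtain ⟨c, hc, -⟩ : ∃ c, (G.delete (T ∪ B)).Approves x c ∧
      ReflTransGen (G.delete (T ∪ B)).Approves c z := by
    rcases hxz.cases_head with rfl | h
    · exact absurd hzC hxC
    · exact h
  have hcE := mem_edges_delete.1 hc
  rcases hB with ⟨b, hb, hxb⟩ | ⟨rfl, h | h | ⟨hcyc, hmin⟩⟩
  · rw [hG _ _ _ hcE.1 hxb] at hcE
    exact hcE.2.2 (Finset.mem_union_right _ hb)
  · exact h c hcE.1
  · exact hxC (hC.mem_of_votingCost_lt hxH h)
  by_cases hvd : G.votingCost x < G.delegatingCost x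
  · exact hxC (hC.mem_of_votingCost_lt hxH hvd)
  have hxz' : ReflTransGen G.Approves x z :=
    ReflTransGen.mono (fun a b hab => (mem_edges_delete.1 hab).1) _ _ hxz
  have hzx : z ≠ x := fun h => hxC (h ▸ hzC)
  have hback : ReflTransGen (G.delete (T ∪ ∅)).Approves z x := by
    refine reflTransGen_approves_delete (B := ∅) hxS (fun a ha haS => ?_)
      (mem_loyal_of_forced hG hcyc hmin (not_lt.1 hvd) hxz')
    simp only [Finset.union_empty] at haS
    exact (mem_rest.1 (hT haS)).2.2.2 ha
  have hlt := hmin z hzx hxz'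
  have hf := (hC.1.exchange hzC hxH hzx hback (.inr hxC)
    (.inl (by simp only [Election.delete]; omega))).1
  have h₁ := hC.2 _ hf
  have h₂ := cost_erase hC.1.1 hzC
  have h₃ := cost_insert (G := G.delete (T ∪ ∅)) hxH
    (fun hm : x ∈ C.erase z => hxC (Finset.mem_of_mem_erase hm))
  simp only [Election.delete] at h₁ h₂ h₃
  omega

theorem Optimal.notMem_of_mem_loyal {G : Election V} {x : V} {S B C : Finset V}
    (hxS : x ∉ S) (hS : ∀ a ∈ G.loyal x B, a ∉ S) (hC : (G.delete S).Optimal C) (hx : x ∈ C)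
    {a : V} (ha : a ∈ G.loyal x B) : a ∉ C := by
  intro haC
  obtain ⟨c, hc, -⟩ := exists_loyalStep ha
  have := hC.votingCost_le haC hx hc.1 (reflTransGen_approves_delete hxS hS (.inr ha))
  simp only [Election.delete] at this
  exact absurd hc.2.2.1 (not_lt.2 this)

/-- Loyal voters support `x`. The supporters of a rival `y` are all upstream of `y`: in an optimal
set nobody who strictly prefers casting delegates. As `y` is upstream of itself without being its
own supporter, the weak inequality of `Dominated` becomes strict. -/
theorem Dominated.isSoleSuperVoter {G : Election V} (hG : G.Functional) {x : V}
    {B T C : Finset V} (hx : x ∈ G.voters)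
    (hB : (∃ b ∈ B, (x, b) ∈ G.edges) ∨ B = ∅ ∧ G.Forced x) (hxB : x ∉ B)
    (hT : G.Dominated x B T)
    (hC : (G.delete (T ∪ B)).Optimal C) :
    x ∈ C ∧ ∀ y ∈ C, y ≠ x →
      ((G.delete (T ∪ B)).supporters C y).card < ((G.delete (T ∪ B)).supporters C x).card := by
  have hxC := hC.mem_of_forced hG hx hB hxB hT.1
  refine ⟨hxC, fun y hyC hyx => ?_⟩
  have hxS : x ∉ T ∪ B := by
    simp only [Finset.mem_union, not_or]
    exact ⟨fun h => (mem_rest.1 (hT.1 h)).2.1 rfl, hxB⟩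
  have hS : ∀ a ∈ G.loyal x B, a ∉ T ∪ B := by
    intro a ha
    simp only [Finset.mem_union, not_or]
    exact ⟨fun h => (mem_rest.1 (hT.1 h)).2.2.2 ha, notMem_of_mem_loyal ha⟩
  have hlC : ∀ a ∈ G.loyal x B, a ∉ C := fun a => hC.notMem_of_mem_loyal hxS hS hxC
  have hyH := mem_voters_delete.1 (hC.1.1 hyC)
  have hyS : y ∉ T ∧ y ∉ B := by simpa using hyH.2
  have hyR : y ∈ G.rest x B :=
    mem_rest.2 ⟨hyH.1, hyx, hyS.2, fun h => hlC y h hyC⟩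
  have hloyal : G.loyal x B ⊆ (G.delete (T ∪ B)).supporters C x := by
    intro a ha
    refine mem_supporters.2 ⟨
      ⟨mem_voters_delete.2 ⟨(mem_loyal.1 ha).1, hS a ha⟩, hlC a ha⟩, ?_⟩
    have hp := (mem_loyal.1 ha).2.2
    clear ha
    induction hp using ReflTransGen.head_induction_on with
    | refl => exact .refl
    | @head a c hac hcx ih =>
      have hc : c = x ∨ c ∈ G.loyal x B := by
        by_cases hcx' : c = x
        · exact .inl hcx'
        · exact .inr (mem_loyal.2 ⟨(G.edges_mem _ hac.2.2.2).2, hcx', hcx⟩)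
      have ha := hac.mem_loyal hc
      refine .head ⟨hlC a ha, mem_edges_delete.2 ⟨hac.2.2.2, hS a ha, ?_⟩⟩ ih
      rcases hc with rfl | hc
      · exact hxS
      · exact hS c hc
  have hsup : insert y ((G.delete (T ∪ B)).supporters C y) ⊆ G.upstream x B T y := by
    have key : ∀ a, ReflTransGen ((G.delete (T ∪ B)).DelegatesTo C) a y →
        a ∈ G.rest x B ∧ ReflTransGen (G.RestStepAvoiding x B T) a y := by
      intro a hp
      induction hp using ReflTransGen.head_induction_on with
      | refl => exact ⟨hyR, .refl⟩
      | @head a c hac hcy ih =>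
        have hE := mem_edges_delete.1 hac.2
        have haS : a ∉ T ∧ a ∉ B := by simpa using hE.2.1
        have hcT : c ∉ T ∧ c ∉ B := by simpa using hE.2.2
        have haV := (G.edges_mem _ hE.1).1
        have haR : a ∈ G.rest x B := by
          refine mem_rest.2 ⟨haV, fun h => hac.1 (h ▸ hxC), haS.2, fun hl => ?_⟩
          -- The only approval of a loyal voter goes to `x` or to a loyal voter, never into the
          -- rest.
          obtain ⟨c', hc', hc''⟩ := exists_loyalStep hl
          obtain rfl := hG _ _ _ hE.1 hc'.2.2.2
          rcases hc'' with rfl | hc''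
          · exact (mem_rest.1 ih.1).2.1 rfl
          · exact (mem_rest.1 ih.1).2.2.2 hc''
        refine ⟨haR, .head ⟨haS.1, hcT.1, haR, ih.1, hE.1, ?_⟩ ih.2⟩
        by_contra hlt
        exact hac.1 (hC.mem_of_votingCost_lt (mem_voters_delete.2 ⟨haV, hE.2.1⟩) (not_le.1 hlt))
    intro a ha
    rcases Finset.mem_insert.1 ha with rfl | ha
    · exact mem_upstream.2 ⟨hyR, .refl⟩
    · exact mem_upstream.2 (key a (mem_supporters.1 ha).2)
  have h₁ := Finset.card_le_card hloyal
  have h₂ := Finset.card_le_card hsup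
  rw [Finset.card_insert_of_notMem (by simp [supporters, hyC])] at h₂
  have h₃ := hT.2 y hyR hyS.1
  omega

end Election
end LiquidDemocracy

/-! ### The converse: an optimal casting set that is worst for `x` -/

namespace LiquidDemocracy
namespace Election

open Relation

set_option linter.unusedSectionVars false

variable {V : Type*} [DecidableEq V]

theorem RestStepAvoiding.rightUnique {G : Election V} (hG : G.Functional) (x : V)
    (B T : Finset V) : Relator.RightUnique (G.RestStepAvoiding x B T) :=
  fun i j j' h₁ h₂ => hG i j j' h₁.2.2.2.2.1 h₂.2.2.2.2.1

theorem upstream_subset_upstream {G : Election V} {x : V} {B T : Finset V} {u w : V}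
    (h : ReflTransGen (G.RestStepAvoiding x B T) u w) :
    G.upstream x B T u ⊆ G.upstream x B T w := fun _ ha =>
  mem_upstream.2 ⟨(mem_upstream.1 ha).1, (mem_upstream.1 ha).2.trans h⟩

/-- Unique successors keep a walk that starts on a cycle on that cycle. -/
theorem reflTransGen_symm_of_transGen {α : Type*} {r : α → α → Prop}
    (hr : Relator.RightUnique r) {a c : α} (h : TransGen r a a) (hac : ReflTransGen r a c) :
    ReflTransGen r c a := by
  induction hac with
  | refl => exact .refl
  | @tail c d _ hcd ih =>
    rcases ih.cases_head with rfl | ⟨e, he, hp⟩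
    · obtain ⟨e, he, hp⟩ := TransGen.head'_iff.1 h
      rwa [hr hcd he]
    · rwa [hr hcd he]

/-- Below every voter there is one without successor, or one of least cost on a cycle. -/
theorem exists_end {G : Election V} (hG : G.Functional) {x : V} {B T : Finset V} {w : V}
    (hw : w ∈ G.rest x B) :
    ∃ y ∈ G.rest x B, ReflTransGen (G.RestStepAvoiding x B T) w y ∧
      ((∀ c, ¬ G.RestStepAvoiding x B T y c) ∨
        TransGen (G.RestStepAvoiding x B T) y y ∧
          ∀ z, ReflTransGen (G.RestStepAvoiding x B T) y z →
            G.votingCost y + G.delegatingCost z ≤ G.votingCost z + G.delegatingCost y) := by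
  classical
  set r := G.RestStepAvoiding x B T with hr
  have hru := RestStepAvoiding.rightUnique hG x B T
  have hrest : ∀ a c, a ∈ G.rest x B → ReflTransGen r a c → c ∈ G.rest x B := by
    intro a c ha h
    induction h with
    | refl => exact ha
    | tail _ h _ => exact h.2.2.2.1
  -- The sets `upstream` grow along a walk. If a largest one belongs to a voter that has a
  -- successor, the successor has the same set, and so both lie on a cycle.
  obtain ⟨y, hy, hmax⟩ := Finset.exists_max_image
    ((G.rest x B).filter fun y => ReflTransGen r w y) (fun y => (G.upstream x B T y).card)
    ⟨w, Finset.mem_filter.2 ⟨hw, .refl⟩⟩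
  obtain ⟨hyR, hwy⟩ := Finset.mem_filter.1 hy
  by_cases hno : ∀ c, ¬ r y c
  · exact ⟨y, hyR, hwy, .inl hno⟩
  push Not at hno
  obtain ⟨c, hyc⟩ := hno
  have hcR := hyc.2.2.2.1
  have heq : G.upstream x B T y = G.upstream x B T c :=
    Finset.eq_of_subset_of_card_le (upstream_subset_upstream (.single hyc))
      (hmax c (Finset.mem_filter.2 ⟨hcR, hwy.tail hyc⟩))
  have hcy : ReflTransGen r c y :=
    (mem_upstream.1 (heq ▸ mem_upstream.2 ⟨hcR, .refl⟩)).2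
  have hcyc : TransGen r y y := TransGen.head'_iff.2 ⟨c, hyc, hcy⟩
  -- The differences of costs may be negative, hence the integers.
  obtain ⟨z, hz, hmin⟩ := Finset.exists_min_image
    ((G.rest x B).filter fun z => ReflTransGen r y z)
    (fun z => (G.votingCost z : ℤ) - G.delegatingCost z)
    ⟨y, Finset.mem_filter.2 ⟨hyR, .refl⟩⟩
  obtain ⟨hzR, hyz⟩ := Finset.mem_filter.1 hz
  have hzy := reflTransGen_symm_of_transGen hru hcyc hyz
  refine ⟨z, hzR, hwy.trans hyz, .inr ⟨?_, fun u hu => ?_⟩⟩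
  · exact TransGen.trans_left (TransGen.trans_right hzy hcyc) hyz
  · have := hmin u (Finset.mem_filter.2 ⟨hrest y u hyR (hyz.trans hu), hyz.trans hu⟩)
    omega

/-- If `x` is the sole super-voter in all optimal solutions, then a voter who may cast has at most
as many potential supporters as `x` has loyal voters. -/
theorem card_upstream_le {G : Election V} (hG : G.Functional) {x : V} {S B T : Finset V}
    (hBS : B ⊆ S) (hT : T = S ∩ G.rest x B)
    (hS : ∀ C, (G.delete S).Optimal C → x ∈ C ∧ ∀ y ∈ C, y ≠ x →
      ((G.delete S).supporters C y).card < ((G.delete S).supporters C x).card)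
    {y : V} (hyR : y ∈ G.rest x B) (hyT : y ∉ T)
    (hy : (∀ c, ¬ G.RestStepAvoiding x B T y c) ∨
        TransGen (G.RestStepAvoiding x B T) y y ∧
          ∀ z, ReflTransGen (G.RestStepAvoiding x B T) y z →
            G.votingCost y + G.delegatingCost z ≤ G.votingCost z + G.delegatingCost y) :
    (G.upstream x B T y).card ≤ (G.loyal x B).card := by
  classical
  have hRT : ∀ a ∈ G.rest x B, a ∉ T → a ∉ S := by
    rintro a ha haT haS
    exact haT (hT ▸ Finset.mem_inter.2 ⟨haS, ha⟩)
  have hTS : T ⊆ S := hT ▸ Finset.inter_subset_left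
  have hyS := hRT y hyR hyT
  have hyV := (mem_rest.1 hyR).1
  have hyx := (mem_rest.1 hyR).2.1
  set H := G.delete S with hH
  have hyH : y ∈ H.voters := mem_voters_delete.2 ⟨hyV, hyS⟩
  set r := G.RestStepAvoiding x B T with hr
  set U := (G.upstream x B T y).erase y with hU
  -- every step inside the rest is a step of the remaining election
  have hstep : ∀ a c, r a c → a ∉ S ∧ H.Approves a c := by
    intro a c hac
    have haS := hRT a hac.2.2.1 hac.1
    refine ⟨haS, mem_edges_delete.2 ⟨hac.2.2.2.2.1, haS, hRT c hac.2.2.2.1 hac.2.1⟩⟩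
  have happ : ∀ a, ReflTransGen r a y → ReflTransGen H.Approves a y := by
    intro a h
    induction h using ReflTransGen.head_induction_on with
    | refl => exact .refl
    | @head a c hac hcy ih => exact .head (hstep a c hac).2 ih
  have hUH : ∀ u ∈ U, u ∈ H.voters ∧ G.delegatingCost u ≤ G.votingCost u ∧ u ≠ y ∧
      ReflTransGen r u y := by
    intro u hu
    obtain ⟨hne, hu⟩ := Finset.mem_erase.1 hu
    obtain ⟨huR, hp⟩ := mem_upstream.1 hu
    rcases hp.cases_head with rfl | ⟨c, hc, hcy⟩
    · exact absurd rfl hne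
    · exact ⟨mem_voters_delete.2 ⟨(mem_rest.1 huR).1, (hstep u c hc).1⟩, hc.2.2.2.2.2, hne, hp⟩
  -- an optimal set that contains `y` or allows to add `y` without additional cost
  obtain ⟨C, hC, hyC⟩ : ∃ C, H.Optimal C ∧
      (y ∈ C ∨ G.votingCost y ≤ G.delegatingCost y) := by
    obtain ⟨C, hC⟩ := H.exists_optimal
    by_cases hyC : y ∈ C
    · exact ⟨C, hC, .inl hyC⟩
    by_cases hvd : G.votingCost y ≤ G.delegatingCost y
    · exact ⟨C, hC, .inr hvd⟩
    obtain ⟨z, hzC, hyz⟩ := hC.1.2 y hyH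
    -- Now `y` delegates and strictly prefers to. Without a step in the rest this is impossible: the
    -- next voter would be `x` or loyal, making `y` loyal, or would give such a step. On a cycle,
    -- the casting voter `z` that `y` reaches lies on the same cycle and can be replaced by `y`,
    -- which is cheapest there.
    rcases hy with hno | ⟨hcyc, hmin⟩
    · exfalso
      rcases hyz.cases_head with rfl | ⟨c, hc, -⟩
      · exact hyC hzC
      have hcE := mem_edges_delete.1 hc
      refine hno c ⟨hyT, fun h => hcE.2.2 (hTS h), hyR, ?_, hcE.1, (not_le.1 hvd).le⟩
      refine mem_rest.2 ⟨(G.edges_mem _ hcE.1).2, fun h => ?_, fun h => hcE.2.2 (hBS h), fun h => ?_⟩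
      · exact (mem_rest.1 hyR).2.2.2 (LoyalStep.mem_loyal
          ⟨hyx, (mem_rest.1 hyR).2.2.1, not_le.1 hvd, hcE.1⟩ (.inl h))
      · exact (mem_rest.1 hyR).2.2.2 (LoyalStep.mem_loyal
          ⟨hyx, (mem_rest.1 hyR).2.2.1, not_le.1 hvd, hcE.1⟩ (.inr h))
    · have hyz' : ReflTransGen r y z ∧ ReflTransGen r z y := by
        clear hzC
        induction hyz with
        | refl => exact ⟨.refl, .refl⟩
        | @tail a c _ hac ih =>
          have hac' : r a c ∧ ReflTransGen r c y := by
            rcases ih.2.cases_head with rfl | ⟨e, he, hp⟩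
            · obtain ⟨e, he, hp⟩ := TransGen.head'_iff.1 hcyc
              rw [hG _ _ _ (mem_edges_delete.1 hac).1 he.2.2.2.2.1]
              exact ⟨he, hp⟩
            · rw [hG _ _ _ (mem_edges_delete.1 hac).1 he.2.2.2.2.1]
              exact ⟨he, hp⟩
          exact ⟨ih.1.tail hac'.1, hac'.2⟩
      have hzy : z ≠ y := fun h => hyC (h ▸ hzC)
      have hex := hC.1.exchange hzC hyH hzy (happ z hyz'.2) (.inr hyC) (.inl (hmin z hyz'.1))
      exact ⟨_, ⟨hex.1, fun C' hC' => hex.2.trans (hC.2 C' hC')⟩, .inl (by simp)⟩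
  -- The worst set for `x`: `y` casts, everyone else upstream of `y` delegates, and all other
  -- indifferent voters cast, so that only strict delegators are left to support `x`. None of these
  -- changes raises the cost.
  set C' := insert y ((C ∪ H.voters.filter fun i => H.votingCost i = H.delegatingCost i) \ U)
    with hC'
  have hsub : C ∪ H.voters.filter (fun i => H.votingCost i = H.delegatingCost i) ⊆ H.voters :=
    Finset.union_subset hC.1.1 (Finset.filter_subset _ _)
  have hfe : H.Feasible C' :=
    (hC.1.mono Finset.subset_union_left hsub).insert_sdiff hyH
      fun u hu _ => happ u (hUH u hu).2.2.2
  have hopt : H.Optimal C' := by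
    refine ⟨hfe, fun C'' hC'' => le_trans ?_ (hC.2 C'' hC'')⟩
    refine cost_le_cost hC.1.1 hfe.1 (fun i hi hiC => ?_) (fun i hi hiC => ?_)
    · rcases Finset.mem_insert.1 hi with rfl | hi
      · exact hyC.resolve_left hiC
      · have := (Finset.mem_union.1 (Finset.mem_sdiff.1 hi).1).resolve_left hiC
        exact (Finset.mem_filter.1 this).2.le
    · by_cases hiU : i ∈ U
      · exact (hUH i hiU).2.1
      · exact absurd (Finset.mem_insert_of_mem
          (Finset.mem_sdiff.2 ⟨Finset.mem_union_left _ hi, hiU⟩)) hiC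
  have hyC' : y ∈ C' := Finset.mem_insert_self _ _
  obtain ⟨hxC', hlt⟩ := hS C' hopt
  have hlt := hlt y hyC' hyx
  have hUC' : ∀ u ∈ U, u ∉ C' := by
    intro u hu h
    rcases Finset.mem_insert.1 h with rfl | h
    · exact (hUH u hu).2.2.1 rfl
    · exact (Finset.mem_sdiff.1 h).2 hu
  have hdel : ∀ a, ReflTransGen r a y → ReflTransGen (H.DelegatesTo C') a y := by
    intro a h
    induction h using ReflTransGen.head_induction_on with
    | refl => exact .refl
    | @head a c hac hcy ih =>
      by_cases hay : a = y
      · rw [hay]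
      · exact .head ⟨hUC' a (Finset.mem_erase.2 ⟨hay, mem_upstream.2 ⟨hac.2.2.1, .head hac hcy⟩⟩),
          (hstep a c hac).2⟩ ih
  have h₁ : U.card ≤ (H.supporters C' y).card := by
    refine Finset.card_le_card fun u hu => ?_
    exact mem_supporters.2 ⟨⟨(hUH u hu).1, hUC' u hu⟩, hdel u (hUH u hu).2.2.2⟩
  have h₂ : (H.supporters C' x).card ≤ (G.loyal x B).card := by
    refine Finset.card_le_card fun i hi => ?_
    obtain ⟨⟨hiV, hiC⟩, hp⟩ := mem_supporters.1 hi
    refine mem_loyal.2 ⟨(mem_voters_delete.1 hiV).1, fun h => hiC (h ▸ hxC'), ?_⟩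
    clear hi hiV hiC
    induction hp using ReflTransGen.head_induction_on with
    | refl => exact .refl
    | @head a c hac hcx ih =>
      refine .head ?_ ih
      have hE := mem_edges_delete.1 hac.2
      have haH : a ∈ H.voters := (H.edges_mem _ hac.2).1
      refine ⟨fun h => hac.1 (h ▸ hxC'), fun h => hE.2.1 (hBS h), ?_, hE.1⟩
      by_contra hvd
      rcases (not_lt.1 hvd).lt_or_eq with hlt | heq
      · exact hac.1 (hopt.mem_of_votingCost_lt haH hlt)
      · have haU : a ∈ U := by
          by_contra haU
          exact hac.1 (Finset.mem_insert_of_mem (Finset.mem_sdiff.2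
            ⟨Finset.mem_union_right _ (Finset.mem_filter.2 ⟨haH, heq⟩), haU⟩))
        -- The unique delegation path from `a` would meet both `y` and `x`, but both cast, so it
        -- cannot continue from either to the other.
        have hay := hdel a (hUH a haU).2.2.2
        rcases ReflTransGen.total_of_right_unique
          ((hG.delete S).delegatesTo_rightUnique C') hay (.head hac hcx) with h | h
        · rcases h.cases_head with h | ⟨c', hc', -⟩
          · exact hyx h
          · exact hc'.1 hyC'
        · rcases h.cases_head with h | ⟨c', hc', -⟩
          · exact hyx h.symm
          · exact hc'.1 hxC'
  have h₃ : U.card + 1 = (G.upstream x B T y).card :=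
    Finset.card_erase_add_one (mem_upstream.2 ⟨hyR, .refl⟩)
  omega

/-- If `x` casts in all optimal solutions after the deletion of `S`, then `x` is forced to cast, or
the voter that `x` approves is deleted. -/
theorem forced_or_exists_mem {G : Election V} (hG : G.Functional) {x : V} {S : Finset V}
    (hS : ∀ C, (G.delete S).Optimal C → x ∈ C) :
    G.Forced x ∨ ∃ b, b ≠ x ∧ (x, b) ∈ G.edges ∧ b ∈ S := by
  by_contra hcon
  push Not at hcon
  obtain ⟨hnf, hb⟩ := hcon
  unfold Forced at hnf
  push Not at hnf
  obtain ⟨⟨b, hxb⟩, hdv, hcyc⟩ := hnf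
  obtain ⟨C, hC⟩ := (G.delete S).exists_optimal
  have hxC := hS C hC
  -- With a self-loop, `x` alone forms the cycle, and the last clause of `Forced` holds vacuously.
  have hbx : b ≠ x := by
    rintro rfl
    obtain ⟨j, hj, hbj, -⟩ := hcyc (.single hxb)
    have : ∀ j, ReflTransGen G.Approves b j → j = b := by
      intro j h
      induction h with
      | refl => rfl
      | tail _ h ih => exact hG _ _ _ (ih ▸ h) hxb
    exact hj (this j hbj)
  have hxS := (mem_voters_delete.1 (hC.1.1 hxC)).2
  have hbS := hb b hbx hxb
  have hxbH : (G.delete S).Approves x b := mem_edges_delete.2 ⟨hxb, hxS, hbS⟩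
  have hbH := ((G.delete S).edges_mem _ hxbH).2
  obtain ⟨z, hzC, hbz⟩ := hC.1.2 b hbH
  -- The voter `j` can take over from `x` at no extra cost. Either it is a casting voter reached
  -- through `b`, or that voter is `x`; then the cycle of `x` has survived and the failure of
  -- `Forced` supplies `j` on it.
  obtain ⟨j, hjx, hxj, hj⟩ : ∃ j, j ≠ x ∧ ReflTransGen (G.delete S).Approves x j ∧
      (G.votingCost j + G.delegatingCost x ≤ G.votingCost x + G.delegatingCost j ∨ j ∈ C) := by
    by_cases hzx : z = x
    · subst hzx
      have hcycH : TransGen (G.delete S).Approves z z := TransGen.head'_iff.2 ⟨b, hxbH, hbz⟩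
      obtain ⟨j, hjx, hxj, hle⟩ := hcyc
        (TransGen.mono (fun a b hab => (mem_edges_delete.1 hab).1) _ _ hcycH)
      refine ⟨j, hjx, ?_, .inl hle⟩
      clear hjx hle
      induction hxj with
      | refl => exact .refl
      | @tail a c _ hac ih =>
        rcases (reflTransGen_symm_of_transGen (hG.delete S).approves_rightUnique hcycH ih).cases_head
          with rfl | ⟨e, he, -⟩
        · exact hG _ _ _ hxb hac ▸ ih.tail hxbH
        · exact hG _ _ _ (mem_edges_delete.1 he).1 hac ▸ ih.tail he
    · exact ⟨z, hzx, .head hxbH hbz, .inr hzC⟩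
  have hjH : j ∈ (G.delete S).voters := by
    rcases (ReflTransGen.cases_tail hxj) with h | ⟨c, -, h⟩
    · exact absurd h hjx
    · exact ((G.delete S).edges_mem _ h).2
  have hex := hC.1.exchange hxC hjH hjx.symm hxj (.inl hdv) hj
  have := hS _ ⟨hex.1, fun C' hC' => hex.2.trans (hC.2 C' hC')⟩
  simp [hjx.symm] at this

/-- Control by deleting voters amounts to making all components outside the voters loyal to `x`
small, perhaps after the deletion of the voter that `x` approves. -/
theorem controlByDeletingVoters_iff {G : Election V} (hG : G.Functional) {x : V}
    (hx : x ∈ G.voters) (k : ℕ) :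
    G.ControlByDeletingVoters k x ↔
      (G.Forced x ∧ ∃ T, G.Dominated x ∅ T ∧ T.card ≤ k) ∨
        ∃ b, b ≠ x ∧ (x, b) ∈ G.edges ∧ ∃ T, G.Dominated x {b} T ∧ T.card + 1 ≤ k := by
  constructor
  · rintro ⟨S, hSV, hSk, hS⟩
    rw [forall_costMinimizing_iff (hG.delete S)] at hS
    -- Only the deletions inside the rest are kept. This is enough because `card_upstream_le` bounds
    -- by the loyal voters of `G`, not of the election after the deletion.
    have key : ∀ B ⊆ S, G.Dominated x B (S ∩ G.rest x B) := by
      intro B hBS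
      refine ⟨Finset.inter_subset_right, fun w hw hwT => ?_⟩
      obtain ⟨y, hyR, hwy, hy⟩ := exists_end hG (T := S ∩ G.rest x B) hw
      have hyT : y ∉ S ∩ G.rest x B := by
        rcases ReflTransGen.cases_tail hwy with rfl | ⟨c, -, hcy⟩
        · exact hwT
        · exact hcy.2.1
      exact (Finset.card_le_card (upstream_subset_upstream hwy)).trans
        (card_upstream_le hG hBS rfl hS hyR hyT hy)
    rcases forced_or_exists_mem hG (fun C hC => (hS C hC).1) with hf | ⟨b, hbx, hxb, hbS⟩
    · exact .inl ⟨hf, _, key ∅ (by simp), (Finset.card_le_card Finset.inter_subset_left).trans hSk⟩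
    · refine .inr ⟨b, hbx, hxb, _, key {b} (by simpa using hbS), ?_⟩
      -- The voter `b` is outside the rest, so its deletion is paid for separately.
      have : S ∩ G.rest x {b} ⊆ S.erase b := by
        intro a ha
        obtain ⟨haS, haR⟩ := Finset.mem_inter.1 ha
        exact Finset.mem_erase.2 ⟨fun h => (mem_rest.1 haR).2.2.1 (by simp [h]), haS⟩
      have h₁ := Finset.card_le_card this
      have h₂ := Finset.card_erase_add_one hbS
      omega
  · have key : ∀ B T, B ⊆ G.voters → (∃ b ∈ B, (x, b) ∈ G.edges) ∨ B = ∅ ∧ G.Forced x → x ∉ B →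
        G.Dominated x B T → T.card + B.card ≤ k → G.ControlByDeletingVoters k x := by
      intro B T hBV hB hxB hT hk
      refine ⟨T ∪ B, Finset.union_subset
        (hT.1.trans fun a ha => (mem_rest.1 ha).1) hBV, (Finset.card_union_le _ _).trans hk, ?_⟩
      rw [forall_costMinimizing_iff (hG.delete _)]
      exact fun C hC => hT.isSoleSuperVoter hG hx hB hxB hC
    rintro (⟨hf, T, hT, hk⟩ | ⟨b, hbx, hxb, T, hT, hk⟩)
    · exact key ∅ T (by simp) (.inr ⟨rfl, hf⟩) (by simp) hT (by simpa using hk)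
    · exact key {b} T (by simpa using (G.edges_mem _ hxb).2) (.inl ⟨b, by simp, hxb⟩)
        (by simpa using hbx.symm) hT (by simpa using hk)

end Election
end LiquidDemocracy

namespace LiquidDemocracy

open Relation

/-! ## Splitting a functional graph into small components

A functional graph on the vertices `0, …, n - 1` is given by a function `g` with values in
`0, …, n`, where `g a = n` says that `a` has no successor. -/

namespace FunctionalGraph

/-- `b` is the successor of `a`. -/
def Step (n : ℕ) (g : ℕ → ℕ) (a b : ℕ) : Prop := a < n ∧ b < n ∧ g a = b

/-- `b` is the successor of `a`, and `a` is not in `X`. -/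
def StepFrom (n : ℕ) (g : ℕ → ℕ) (X : ℕ → Prop) (a b : ℕ) : Prop := ¬ X a ∧ Step n g a b

/-- `v` lies on a cycle. -/
def OnCycle (n : ℕ) (g : ℕ → ℕ) (v : ℕ) : Prop := TransGen (Step n g) v v

open Classical in
/-- `t` rounds of computing the sizes of the subtrees that remain when the edges out of `X` and the
edges out of vertices with a subtree of more than `q` vertices are deleted. -/
noncomputable def weight (n q : ℕ) (g : ℕ → ℕ) (X : ℕ → Prop) : ℕ → ℕ → ℕ
  | 0, _ => 0
  | t + 1, v => 1 + ∑ c ∈ Finset.range (n + 1),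
      if g c = v ∧ ¬ X c ∧ weight n q g X t c ≤ q then weight n q g X t c else 0

/-- The cut edges when `r` is deleted from its cycle, and all other cycles are cut completely. -/
def CutAt (n : ℕ) (g : ℕ → ℕ) (r i : ℕ) : Prop :=
  i = r ∨ OnCycle n g i ∧ ¬ ReflTransGen (Step n g) r i

open Classical in
/-- `v` lies on a cycle whose component is too large after the deletions off the cycle. -/
def BadCycle (n q : ℕ) (g : ℕ → ℕ) (v : ℕ) : Prop :=
  OnCycle n g v ∧ q < ∑ u ∈ Finset.range (n + 1),
    if ReflTransGen (Step n g) v u then weight n q g (OnCycle n g) (n + 1) u else 0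

open Classical in
/-- The number of deletions on the cycle of `r` when `r` is deleted first. -/
noncomputable def cutCost (n q : ℕ) (g : ℕ → ℕ) (r : ℕ) : ℕ :=
  ∑ v ∈ Finset.range (n + 1), if ReflTransGen (Step n g) r v ∧
    (v = r ∨ q < weight n q g (CutAt n g r) (n + 1) v) then 1 else 0

/-- `r` is the best vertex to delete first on a bad cycle. -/
def BestCut (n q : ℕ) (g : ℕ → ℕ) (r : ℕ) : Prop :=
  BadCycle n q g r ∧ ∀ r', ReflTransGen (Step n g) r r' →
    cutCost n q g r < cutCost n q g r' ∨ cutCost n q g r = cutCost n q g r' ∧ r ≤ r'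

open Classical in
/-- The least number of vertices in `R` whose deletion leaves components of at most `q` vertices. -/
noncomputable def splitCost (n q : ℕ) (g : ℕ → ℕ) (R : Finset ℕ) : ℕ :=
  (∑ v ∈ Finset.range (n + 1), if v ∈ R ∧ ¬ OnCycle n g v ∧
    q < weight n q g (OnCycle n g) (n + 1) v then 1 else 0) +
  ∑ r ∈ Finset.range (n + 1), if BestCut n q g r then cutCost n q g r else 0

open Classical in
/-- After the deletion of `T`, at most `q` vertices lead to any given vertex. -/
def Splits (n q : ℕ) (g : ℕ → ℕ) (R T : Finset ℕ) : Prop :=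
  T ⊆ R ∧ ∀ w ∈ R, w ∉ T →
    (R.filter fun u => ReflTransGen (fun a b => a ∉ T ∧ b ∉ T ∧ Step n g a b) u w).card ≤ q

variable {n q : ℕ} {g : ℕ → ℕ} {R : Finset ℕ} {X Y : ℕ → Prop}

theorem step_rightUnique : Relator.RightUnique (Step n g) := fun _ _ _ h₁ h₂ =>
  h₁.2.2.symm.trans h₂.2.2

theorem stepFrom_rightUnique : Relator.RightUnique (StepFrom n g X) := fun _ _ _ h₁ h₂ =>
  step_rightUnique h₁.2 h₂.2

theorem OnCycle.lt {v : ℕ} (h : OnCycle n g v) : v < n := by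
  obtain ⟨c, hc, -⟩ := TransGen.head'_iff.1 h
  exact hc.1

theorem lt_of_reflTransGen {u v : ℕ} (hu : u < n) (h : ReflTransGen (Step n g) u v) : v < n := by
  rcases ReflTransGen.cases_tail h with rfl | ⟨c, -, hc⟩
  · exact hu
  · exact hc.2.1

theorem OnCycle.symm {u v : ℕ} (h : OnCycle n g u) (hp : ReflTransGen (Step n g) u v) :
    ReflTransGen (Step n g) v u :=
  Election.reflTransGen_symm_of_transGen step_rightUnique h hp

theorem OnCycle.of_reflTransGen {u v : ℕ} (h : OnCycle n g u)
    (hp : ReflTransGen (Step n g) u v) : OnCycle n g v :=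
  TransGen.trans_left (TransGen.trans_right (h.symm hp) h) hp

theorem OnCycle.reflTransGen_iff {u v w : ℕ} (h : OnCycle n g u)
    (hp : ReflTransGen (Step n g) u v) :
    ReflTransGen (Step n g) v w ↔ ReflTransGen (Step n g) u w :=
  ⟨fun h' => hp.trans h', fun h' => (h.symm hp).trans h'⟩

theorem BadCycle.of_reflTransGen {u v : ℕ} (h : BadCycle n q g u)
    (hp : ReflTransGen (Step n g) u v) : BadCycle n q g v := by
  classical
  refine ⟨h.1.of_reflTransGen hp, h.2.trans_eq ?_⟩
  exact Finset.sum_congr rfl fun w _ => if_congr (h.1.reflTransGen_iff hp).symm rfl rfl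

/-- A cycle that avoids `X` contains everything that can be reached from it. -/
theorem not_of_transGen_stepFrom {u v : ℕ} (h : TransGen (StepFrom n g X) v v)
    (hp : ReflTransGen (Step n g) v u) : ¬ X u := by
  have key : ReflTransGen (StepFrom n g X) v u := by
    induction hp with
    | refl => exact .refl
    | @tail a b _ hab ih =>
      have hback := Election.reflTransGen_symm_of_transGen stepFrom_rightUnique h ih
      rcases hback.cases_head with rfl | ⟨c, hc, -⟩
      · obtain ⟨c, hc, -⟩ := TransGen.head'_iff.1 h
        exact ih.tail (step_rightUnique hab hc.2 ▸ hc)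
      · exact ih.tail (step_rightUnique hab hc.2 ▸ hc)
  have hback := Election.reflTransGen_symm_of_transGen stepFrom_rightUnique h key
  rcases hback.cases_head with rfl | ⟨c, hc, -⟩
  · obtain ⟨c, hc, -⟩ := TransGen.head'_iff.1 h
    exact hc.1
  · exact hc.1

/-- `X` meets every cycle. -/
def Cuts (n : ℕ) (g : ℕ → ℕ) (X : ℕ → Prop) : Prop := ∀ v, ¬ TransGen (StepFrom n g X) v v

theorem cuts_onCycle : Cuts n g (OnCycle n g) := fun _ h =>
  not_of_transGen_stepFrom h .refl (TransGen.mono (fun _ _ hab => hab.2) _ _ h)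

open Classical in
/-- The vertices strictly above `v`. -/
noncomputable def above (n : ℕ) (g : ℕ → ℕ) (X : ℕ → Prop) (v : ℕ) : Finset ℕ :=
  (Finset.range n).filter fun u => TransGen (StepFrom n g X) u v

theorem mem_above {u v : ℕ} : u ∈ above n g X v ↔ u < n ∧ TransGen (StepFrom n g X) u v := by
  simp [above]

/-- The measure for inductions up the trees: `c` is above `v`, but not above itself, as `X` cuts all
cycles. -/
theorem card_above_lt (hX : Cuts n g X) {c v : ℕ} (h : StepFrom n g X c v) :
    (above n g X c).card < (above n g X v).card := by
  refine Finset.card_lt_card ⟨fun u hu => ?_, fun hsub => ?_⟩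
  · rw [mem_above] at hu ⊢
    exact ⟨hu.1, hu.2.tail h⟩
  · exact hX c (mem_above.1 (hsub (mem_above.2 ⟨h.2.1, .single h⟩))).2

/-- The value at `v` depends only on the vertices above it, so it is final once there were more
rounds than such vertices. Hence `n + 1` rounds always suffice. -/
theorem weight_succ_eq (hg : g n = n) (hX : Cuts n g X) :
    ∀ t v, v < n → (above n g X v).card < t → weight n q g X (t + 1) v = weight n q g X t v
  | 0, _, _, h => absurd h (Nat.not_lt_zero _)
  | t + 1, v, hv, h => by
    rw [weight, weight]
    congr 1
    refine Finset.sum_congr rfl fun c hc => ?_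
    by_cases hcv : g c = v ∧ ¬ X c
    · have hcn : c < n := by
        rcases Nat.lt_succ_iff_lt_or_eq.1 (Finset.mem_range.1 hc) with h | rfl
        · exact h
        · omega
      have := card_above_lt hX (c := c) (v := v) ⟨hcv.2, hcn, hv, hcv.1⟩
      rw [weight_succ_eq hg hX t c hcn (by omega)]
    · rw [if_neg (fun h => hcv ⟨h.1, h.2.1⟩), if_neg (fun h => hcv ⟨h.1, h.2.1⟩)]

open Classical in
/-- The vertices in `R` that lead to `v` by edges not out of `F`. -/
noncomputable def tree (n : ℕ) (g : ℕ → ℕ) (R : Finset ℕ) (F : ℕ → Prop) (v : ℕ) : Finset ℕ :=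
  R.filter fun u => ReflTransGen (StepFrom n g F) u v

theorem mem_tree {F : ℕ → Prop} {u v : ℕ} :
    u ∈ tree n g R F v ↔ u ∈ R ∧ ReflTransGen (StepFrom n g F) u v := by simp [tree]

/-- The edges that are cut when the vertices with large subtrees are deleted as well. -/
def Blocked (n q : ℕ) (g : ℕ → ℕ) (X : ℕ → Prop) (v : ℕ) : Prop :=
  X v ∨ q < weight n q g X (n + 1) v

theorem card_above_le (v : ℕ) : (above n g X v).card ≤ n := by
  classical
  exact (Finset.card_filter_le _ _).trans_eq (Finset.card_range n)

/-- `R` is a set of vertices that contains all edges. -/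
structure Carries (n : ℕ) (g : ℕ → ℕ) (R : Finset ℕ) : Prop where
  lt : ∀ v ∈ R, v < n
  sentinel : g n = n
  mem : ∀ a b, Step n g a b → a ∈ R ∧ b ∈ R

/-- Without the blocked edges the graph is a forest. The tree of `v` is `v` together with the
disjoint trees of its unblocked predecessors, which is the recursion of `weight`. -/
theorem card_tree (hR : Carries n g R) (hX : Cuts n g X) :
    ∀ v ∈ R, (tree n g R (Blocked n q g X) v).card = weight n q g X (n + 1) v := by
  classical
  intro v
  induction hm : (above n g X v).card using Nat.strong_induction_on generalizing v with
  | _ m ih =>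
  intro hv
  set F := Blocked n q g X with hF
  have hvn := hR.lt v hv
  have hFX : ∀ a, X a → F a := fun a ha => .inl ha
  have hFc : Cuts n g F := fun v h => hX v
    (TransGen.mono (fun _ _ hab => ⟨fun h => hab.1 (hFX _ h), hab.2⟩) _ _ h)
  set K := (Finset.range (n + 1)).filter fun c => g c = v ∧ ¬ X c ∧ weight n q g X (n + 1) c ≤ q
    with hK
  have hKs : ∀ c ∈ K, StepFrom n g F c v := by
    intro c hc
    obtain ⟨hcn, hcv, hcX, hcq⟩ := Finset.mem_filter.1 hc
    have hcn : c < n := by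
      rcases Nat.lt_succ_iff_lt_or_eq.1 (Finset.mem_range.1 hcn) with h | rfl
      · exact h
      · have := hR.sentinel
        omega
    exact ⟨fun h => h.elim hcX (fun h => by omega), hcn, hvn, hcv⟩
  have htree : tree n g R F v = insert v (K.biUnion fun c => tree n g R F c) := by
    ext u
    simp only [mem_tree, Finset.mem_insert, Finset.mem_biUnion]
    constructor
    · rintro ⟨hu, hp⟩
      rcases ReflTransGen.cases_tail hp with rfl | ⟨c, huc, hcv⟩
      · exact .inl rfl
      · refine .inr ⟨c, ?_, hu, huc⟩
        have h₁ : ¬ X c := fun h => hcv.1 (.inl h)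
        have h₂ : weight n q g X (n + 1) c ≤ q := not_lt.1 fun h => hcv.1 (.inr h)
        have := hcv.2.1
        simp only [hK, Finset.mem_filter, Finset.mem_range]
        exact ⟨by omega, hcv.2.2.2, h₁, h₂⟩
    · rintro (rfl | ⟨c, hc, hu, hp⟩)
      · exact ⟨hv, .refl⟩
      · exact ⟨hu, hp.tail (hKs c hc)⟩
  have hnot : v ∉ K.biUnion fun c => tree n g R F c := by
    simp only [Finset.mem_biUnion, mem_tree, not_exists, not_and]
    exact fun c hc _ hp => hFc v (TransGen.tail' hp (hKs c hc))
  -- Trees of two predecessors that share a vertex would put one predecessor on the walk from the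
  -- other. That walk starts by stepping to `v`, and so closes a cycle.
  have hdis : (K : Set ℕ).PairwiseDisjoint fun c => tree n g R F c := by
    intro c hc c' hc' hne
    refine Finset.disjoint_left.2 fun u hu hu' => ?_
    have key : ∀ c ∈ K, ∀ c' ∈ K, c ≠ c' → ¬ ReflTransGen (StepFrom n g F) c c' := by
      intro c hc c' hc' hne hp
      rcases hp.cases_head with h | ⟨d, hd, hp⟩
      · exact hne h
      · rw [stepFrom_rightUnique hd (hKs c hc)] at hp
        exact hFc v (TransGen.tail' hp (hKs c' hc'))
    rcases ReflTransGen.total_of_right_unique stepFrom_rightUnique (mem_tree.1 hu).2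
      (mem_tree.1 hu').2 with h | h
    · exact key c hc c' hc' hne h
    · exact key c' hc' c hc hne.symm h
  -- `weight_succ_eq` adds a round at `v`, so that one unfolding leaves the final weights of the
  -- predecessors.
  rw [htree, Finset.card_insert_of_notMem hnot, Finset.card_biUnion hdis,
    ← weight_succ_eq hR.sentinel hX (n + 1) v hvn (by have := card_above_le (g := g) (X := X) (n := n) v; omega), weight,
    ← Finset.sum_filter, add_comm]
  congr 1
  refine Finset.sum_congr rfl fun c hc => ?_
  have hs := hKs c hc
  have hs' : StepFrom n g X c v := ⟨fun h => hs.1 (hFX _ h), hs.2⟩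
  exact ih _ (hm ▸ card_above_lt hX hs') c rfl (hR.mem c v hs.2).1

/-- A weight sees the cut set only at the vertices that lead to `v`; `P` is a set closed under
predecessors. This allows the cut sets `OnCycle`, `CutAt` and `CutFrom` to be compared region by
region. -/
theorem weight_congr (hg : g n = n) {P : ℕ → Prop} (hP : ∀ c v, Step n g c v → P v → P c)
    (hXY : ∀ v, v < n → P v → (X v ↔ Y v)) :
    ∀ t v, v < n → P v → weight n q g X t v = weight n q g Y t v
  | 0, _, _, _ => rfl
  | t + 1, v, hv, hPv => by
    classical
    rw [weight, weight]
    congr 1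
    refine Finset.sum_congr rfl fun c hc => ?_
    by_cases hcv : g c = v
    · have hcn : c < n := by
        rcases Nat.lt_succ_iff_lt_or_eq.1 (Finset.mem_range.1 hc) with h | rfl
        · exact h
        · omega
      have hPc := hP c v ⟨hcn, hv, hcv⟩ hPv
      rw [weight_congr hg hP hXY t c hcn hPc]
      exact if_congr (by rw [hXY c hcn hPc]) rfl rfl
    · rw [if_neg (fun h => hcv h.1), if_neg (fun h => hcv h.1)]

/-! ### One deleted vertex on each bad cycle -/

/-- `Q` contains exactly one vertex of each bad cycle. -/
structure Transversal (n q : ℕ) (g : ℕ → ℕ) (Q : Finset ℕ) : Prop where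
  bad : ∀ r ∈ Q, BadCycle n q g r
  exists_mem : ∀ v, BadCycle n q g v → ∃ r ∈ Q, ReflTransGen (Step n g) v r
  unique : ∀ r ∈ Q, ∀ r' ∈ Q, ReflTransGen (Step n g) r r' → r = r'

/-- The edges out of `Q` and those of the cycles that are not bad. -/
def CutFrom (n q : ℕ) (g : ℕ → ℕ) (Q : Finset ℕ) (i : ℕ) : Prop :=
  i ∈ Q ∨ OnCycle n g i ∧ ¬ BadCycle n q g i

open Classical in
/-- The vertices off the cycles with large subtrees. -/
noncomputable def largeOffCycle (n q : ℕ) (g : ℕ → ℕ) (R : Finset ℕ) : Finset ℕ :=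
  R.filter fun v => ¬ OnCycle n g v ∧ q < weight n q g (OnCycle n g) (n + 1) v

open Classical in
/-- The vertices that are deleted from the cycle of `r` when `r` is deleted first. -/
noncomputable def largeOnCycle (n q : ℕ) (g : ℕ → ℕ) (r : ℕ) : Finset ℕ :=
  (Finset.range (n + 1)).filter fun v => ReflTransGen (Step n g) r v ∧
    (v = r ∨ q < weight n q g (CutAt n g r) (n + 1) v)

theorem mem_largeOffCycle {v : ℕ} : v ∈ largeOffCycle n q g R ↔
    v ∈ R ∧ ¬ OnCycle n g v ∧ q < weight n q g (OnCycle n g) (n + 1) v := by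
  simp [largeOffCycle]

theorem mem_largeOnCycle {r v : ℕ} : v ∈ largeOnCycle n q g r ↔
    v < n + 1 ∧ ReflTransGen (Step n g) r v ∧
      (v = r ∨ q < weight n q g (CutAt n g r) (n + 1) v) := by
  simp [largeOnCycle]

/-- The vertices that are deleted when those in `Q` are deleted first. -/
noncomputable def greedy (n q : ℕ) (g : ℕ → ℕ) (R Q : Finset ℕ) : Finset ℕ :=
  largeOffCycle n q g R ∪ Q.biUnion (largeOnCycle n q g)

theorem card_largeOnCycle (r : ℕ) : (largeOnCycle n q g r).card = cutCost n q g r := by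
  simp [largeOnCycle, cutCost]

theorem not_onCycle_of_step {c v : ℕ} (h : Step n g c v) (hv : ¬ OnCycle n g v) :
    ¬ OnCycle n g c := fun hc => hv (hc.of_reflTransGen (.single h))

theorem Transversal.cuts {Q : Finset ℕ} (hQ : Transversal n q g Q) :
    Cuts n g (CutFrom n q g Q) := by
  intro v h
  have hc : OnCycle n g v := TransGen.mono (fun _ _ hab => hab.2) _ _ h
  by_cases hb : BadCycle n q g v
  · obtain ⟨r, hr, hp⟩ := hQ.exists_mem v hb
    exact not_of_transGen_stepFrom h hp (.inl hr)
  · exact not_of_transGen_stepFrom h .refl (.inr ⟨hc, hb⟩)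

/-- Everything that leads to a vertex off the cycles is itself off the cycles, where both cut sets
are empty. -/
theorem Transversal.weight_of_not_onCycle {Q : Finset ℕ} (hQ : Transversal n q g Q)
    (hg : g n = n) {v : ℕ} (hvn : v < n) (hv : ¬ OnCycle n g v) (t : ℕ) :
    weight n q g (CutFrom n q g Q) t v = weight n q g (OnCycle n g) t v := by
  refine weight_congr hg (P := fun v => ¬ OnCycle n g v)
    (fun c v h hv => not_onCycle_of_step h hv) (fun i _ hi => ?_) t v hvn hv
  simp only [CutFrom, hi, false_and, or_false, iff_false]
  exact fun h => hi (hQ.bad i h).1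

theorem onCycle_or_mem_closed {r : ℕ} (c v : ℕ) (h : Step n g c v)
    (hv : ¬ OnCycle n g v ∨ ReflTransGen (Step n g) r v) :
    ¬ OnCycle n g c ∨ ReflTransGen (Step n g) r c := by
  by_cases hc : OnCycle n g c
  · have hv' := hc.of_reflTransGen (.single h)
    exact .inr ((hv.resolve_left (not_not.2 hv')).trans (hc.symm (.single h)))
  · exact .inl hc

theorem Transversal.weight_of_good {Q : Finset ℕ} (hQ : Transversal n q g Q)
    (hg : g n = n) {v : ℕ} (hv : OnCycle n g v) (hb : ¬ BadCycle n q g v) (t : ℕ) :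
    weight n q g (CutFrom n q g Q) t v = weight n q g (OnCycle n g) t v := by
  refine weight_congr hg (P := fun i => ¬ OnCycle n g i ∨ ReflTransGen (Step n g) v i)
    onCycle_or_mem_closed (fun i _ hi => ?_) t v hv.lt (.inr .refl)
  rcases hi with hi | hi
  · simp only [CutFrom, hi, false_and, or_false, iff_false]
    exact fun h => hi (hQ.bad i h).1
  · have := hv.of_reflTransGen hi
    simp only [CutFrom, this, true_and, iff_true]
    exact .inr fun h => hb (h.of_reflTransGen (hv.symm hi))

/-- No other cycle leads to the cycle of `r`, so the choices of `Q` elsewhere do not matter. Bad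
cycles can therefore be optimized one at a time. -/
theorem Transversal.weight_of_mem {Q : Finset ℕ} (hQ : Transversal n q g Q)
    (hg : g n = n) {r v : ℕ} (hr : r ∈ Q) (hv : ReflTransGen (Step n g) r v) (t : ℕ) :
    weight n q g (CutFrom n q g Q) t v = weight n q g (CutAt n g r) t v := by
  have hb := hQ.bad r hr
  refine weight_congr hg (P := fun i => ¬ OnCycle n g i ∨ ReflTransGen (Step n g) r i)
    onCycle_or_mem_closed (fun i _ hi => ?_) t v (hb.of_reflTransGen hv).1.lt (.inr hv)
  by_cases hi' : OnCycle n g i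
  · have hri := hi.resolve_left (not_not.2 hi')
    simp only [CutFrom, CutAt, hri, hb.of_reflTransGen hri, not_true, and_false, or_false]
    exact ⟨fun h => (hQ.unique r hr i h hri).symm, fun h => h ▸ hr⟩
  · simp only [CutFrom, CutAt, hi', false_and, or_false]
    exact ⟨fun h => absurd (hQ.bad i h).1 hi', fun h => absurd (h ▸ hb.1) hi'⟩

/-- Expresses all deletions through the single cut set `CutFrom`, so that both bounds can work with
one family of trees. -/
theorem Transversal.mem_greedy_iff {Q : Finset ℕ} (hQ : Transversal n q g Q)
    (hR : Carries n g R) {v : ℕ} :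
    v ∈ greedy n q g R Q ↔ (v ∈ R ∧ ¬ OnCycle n g v ∧ q < weight n q g (OnCycle n g) (n + 1) v) ∨
      BadCycle n q g v ∧ Blocked n q g (CutFrom n q g Q) v := by
  simp only [greedy, Finset.mem_union, mem_largeOffCycle, Finset.mem_biUnion, mem_largeOnCycle]
  refine or_congr Iff.rfl ⟨?_, ?_⟩
  · rintro ⟨r, hr, -, hrv, h⟩
    refine ⟨(hQ.bad r hr).of_reflTransGen hrv, ?_⟩
    rcases h with rfl | h
    · exact .inl (.inl hr)
    · exact .inr (by rwa [hQ.weight_of_mem hR.sentinel hr hrv])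
  · rintro ⟨hb, h⟩
    obtain ⟨r, hr, hvr⟩ := hQ.exists_mem v hb
    have hrv := hb.1.symm hvr
    have := hb.1.lt
    refine ⟨r, hr, by omega, hrv, ?_⟩
    rcases h with (h | h) | h
    · exact .inl (hQ.unique r hr v h hrv).symm
    · exact absurd hb h.2
    · exact .inr (by rwa [← hQ.weight_of_mem hR.sentinel hr hrv])

theorem Transversal.card_greedy {Q : Finset ℕ} (hQ : Transversal n q g Q) :
    (greedy n q g R Q).card = (largeOffCycle n q g R).card + ∑ r ∈ Q, cutCost n q g r := by
  rw [greedy, Finset.card_union_of_disjoint, Finset.card_biUnion]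
  · simp only [card_largeOnCycle]
  · intro r hr r' hr' hne
    refine Finset.disjoint_left.2 fun v hv hv' => hne ?_
    have h₁ := (mem_largeOnCycle.1 hv).2.1
    have h₂ := (mem_largeOnCycle.1 hv').2.1
    exact hQ.unique r hr r' hr' (h₁.trans ((hQ.bad r' hr').1.symm h₂))
  · refine Finset.disjoint_left.2 fun v hv hv' => ?_
    obtain ⟨r, hr, hv'⟩ := Finset.mem_biUnion.1 hv'
    exact (mem_largeOffCycle.1 hv).2.1
      ((hQ.bad r hr).1.of_reflTransGen (mem_largeOnCycle.1 hv').2.1)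

end FunctionalGraph
end LiquidDemocracy

/-! ### The greedy deletions work and are optimal -/

namespace LiquidDemocracy

open Relation

namespace FunctionalGraph

variable {n q : ℕ} {g : ℕ → ℕ} {R : Finset ℕ} {X Y : ℕ → Prop}

/-- The minimum is lexicographic: ties in cost are broken by the index, which makes the best vertex
unique on its cycle. -/
theorem BadCycle.exists_bestCut {v : ℕ} (h : BadCycle n q g v) :
    ∃ r, BestCut n q g r ∧ ReflTransGen (Step n g) v r := by
  classical
  obtain ⟨r, hr, hmin⟩ := Finset.exists_min_image
    ((Finset.range n).filter fun r => ReflTransGen (Step n g) v r)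
    (fun r => toLex (cutCost n q g r, r)) ⟨v, by simpa using ⟨h.1.lt, .refl⟩⟩
  have hvr := (Finset.mem_filter.1 hr).2
  refine ⟨r, ⟨h.of_reflTransGen hvr, fun r' hrr' => ?_⟩, hvr⟩
  have := hmin r' (Finset.mem_filter.2 ⟨Finset.mem_range.2
    (lt_of_reflTransGen h.1.lt (hvr.trans hrr')), hvr.trans hrr'⟩)
  simpa [Prod.Lex.toLex_le_toLex] using this

theorem BestCut.eq_of_reflTransGen {r r' : ℕ} (h : BestCut n q g r) (h' : BestCut n q g r')
    (hp : ReflTransGen (Step n g) r r') : r = r' := by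
  have h₁ := h.2 r' hp
  have h₂ := h'.2 r (h.1.1.symm hp)
  omega

open Classical in
/-- The best vertices to delete first. -/
noncomputable def bestCuts (n q : ℕ) (g : ℕ → ℕ) : Finset ℕ :=
  (Finset.range (n + 1)).filter (BestCut n q g)

theorem mem_bestCuts {r : ℕ} : r ∈ bestCuts n q g ↔ BestCut n q g r := by
  simp only [bestCuts, Finset.mem_filter, Finset.mem_range, and_iff_right_iff_imp]
  intro h
  have := h.1.1.lt
  omega

theorem transversal_bestCuts : Transversal n q g (bestCuts n q g) where
  bad r hr := (mem_bestCuts.1 hr).1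
  exists_mem v hv := by
    obtain ⟨r, hr, hp⟩ := hv.exists_bestCut
    exact ⟨r, mem_bestCuts.2 hr, hp⟩
  unique r hr r' hr' hp := (mem_bestCuts.1 hr).eq_of_reflTransGen (mem_bestCuts.1 hr') hp

theorem splitCost_eq (hR : Carries n g R) :
    splitCost n q g R = (largeOffCycle n q g R).card + ∑ r ∈ bestCuts n q g, cutCost n q g r := by
  classical
  unfold splitCost bestCuts
  rw [Finset.sum_filter, Finset.sum_boole, Nat.cast_id]
  congr 2
  ext v
  simp only [Finset.mem_filter, mem_largeOffCycle, Finset.mem_range, and_iff_right_iff_imp]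
  intro h
  have := hR.lt v h.1
  omega

/-- Off the good cycles, the greedy deletions leave small trees; the good cycles are small. -/
theorem Transversal.splits_greedy {Q : Finset ℕ} (hQ : Transversal n q g Q)
    (hR : Carries n g R) : Splits n q g R (greedy n q g R Q) := by
  classical
  refine ⟨fun v hv => ?_, fun w hw hwG => ?_⟩
  · rcases (hQ.mem_greedy_iff hR).1 hv with h | h
    · exact h.1
    · obtain ⟨c, hc, -⟩ := TransGen.head'_iff.1 h.1.1
      exact (hR.mem v c hc).1
  have hwn := hR.lt w hw
  set G := greedy n q g R Q with hG
  set F := Blocked n q g (CutFrom n q g Q) with hF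
  -- a blocked vertex that is not deleted is on a good cycle
  have hFG : ∀ a ∈ R, a ∉ G → F a → OnCycle n g a ∧ ¬ BadCycle n q g a := by
    intro a haR haG haF
    rw [hQ.mem_greedy_iff hR] at haG
    push Not at haG
    have hb : ¬ BadCycle n q g a := fun h => haG.2 h haF
    refine ⟨?_, hb⟩
    by_contra hc
    rcases haF with (h | h) | h
    · exact hb (hQ.bad a h)
    · exact hc h.1
    · rw [hQ.weight_of_not_onCycle hR.sentinel (hR.lt a haR) hc] at h
      exact absurd h (not_lt.2 (haG.1 haR hc))
  -- On a good cycle, whatever leads to `w` hangs in the tree of some cycle vertex, and these trees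
  -- have at most `q` vertices in total. Otherwise no walk to `w` that avoids the deletions meets a
  -- blocked vertex, so it stays inside the tree of `w`.
  by_cases hgood : OnCycle n g w ∧ ¬ BadCycle n q g w
  · obtain ⟨hc, hb⟩ := hgood
    have hle := not_lt.1 fun h => hb ⟨hc, h⟩
    refine le_trans ?_ hle
    rw [← Finset.sum_filter]
    refine le_trans (Finset.card_le_card (t := ((Finset.range (n + 1)).filter fun u =>
      ReflTransGen (Step n g) w u).biUnion fun u => tree n g R F u) ?_)
      (Finset.card_biUnion_le.trans (Finset.sum_le_sum fun u hu => ?_))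
    · intro u hu
      rw [Finset.mem_filter] at hu
      obtain ⟨hu, hp⟩ := hu
      simp only [Finset.mem_biUnion, Finset.mem_filter, mem_tree, Finset.mem_range]
      suffices h : ∃ a, ReflTransGen (Step n g) w a ∧ ReflTransGen (StepFrom n g F) u a by
        obtain ⟨a, hwa, hua⟩ := h
        have := lt_of_reflTransGen hwn hwa
        exact ⟨a, ⟨by omega, hwa⟩, hu, hua⟩
      clear hu
      induction hp using ReflTransGen.head_induction_on with
      | refl => exact ⟨w, .refl, .refl⟩
      | @head a b hab hbw ih =>
        by_cases haF : F a
        · refine ⟨a, ?_, .refl⟩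
          have hca := (hFG a (hR.mem a b hab.2.2).1 hab.1 haF).1
          exact hca.symm (.head hab.2.2
            (ReflTransGen.mono (fun _ _ h => h.2.2) _ _ hbw))
        · obtain ⟨c, hwc, hbc⟩ := ih
          exact ⟨c, hwc, .head ⟨haF, hab.2.2⟩ hbc⟩
    · have hwu := (Finset.mem_filter.1 hu).2
      have huc := hc.of_reflTransGen hwu
      obtain ⟨c, hstep, -⟩ := TransGen.head'_iff.1 huc
      rw [card_tree hR hQ.cuts u (hR.mem u c hstep).1, hQ.weight_of_good hR.sentinel huc
        (fun h => hb (h.of_reflTransGen (hc.symm hwu)))]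
  · have hwF : ¬ F w := fun h => hgood (hFG w hw hwG h)
    have hq : weight n q g (CutFrom n q g Q) (n + 1) w ≤ q := not_lt.1 fun h => hwF (.inr h)
    refine le_trans (Finset.card_le_card fun u hu => ?_)
      ((card_tree hR hQ.cuts w hw).trans_le hq)
    rw [Finset.mem_filter] at hu
    obtain ⟨hu, hp⟩ := hu
    refine mem_tree.2 ⟨hu, ?_⟩
    clear hu
    induction hp using ReflTransGen.head_induction_on with
    | refl => exact .refl
    | @head a b hab hbw ih =>
      refine .head ⟨fun haF => hgood ?_, hab.2.2⟩ ih
      obtain ⟨hca, hba⟩ := hFG a (hR.mem a b hab.2.2).1 hab.1 haF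
      have haw : ReflTransGen (Step n g) a w := .head hab.2.2
        (ReflTransGen.mono (fun _ _ h => h.2.2) _ _ hbw)
      exact ⟨hca.of_reflTransGen haw, fun h => hba (h.of_reflTransGen (hca.symm haw))⟩

/-- A tree with more than `q` vertices contains a deleted vertex. -/
theorem Splits.exists_mem_of_tree {T : Finset ℕ} (hT : Splits n q g R T) {F : ℕ → Prop}
    {v : ℕ} (hv : v ∈ R) (hlt : q < (tree n g R F v).card) :
    ∃ t ∈ T, ReflTransGen (StepFrom n g F) t v := by
  classical
  by_contra! hno
  have hvT : v ∉ T := fun h => hno v h .refl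
  refine absurd (hT.2 v hv hvT) (not_le.2 (hlt.trans_le (Finset.card_le_card fun u hu => ?_)))
  rw [mem_tree] at hu
  obtain ⟨hu, hp⟩ := hu
  refine Finset.mem_filter.2 ⟨hu, ?_⟩
  clear hu
  induction hp using ReflTransGen.head_induction_on with
  | refl => exact .refl
  | @head a b hab hbw ih =>
    exact .head ⟨fun h => hno a h (.head hab hbw), fun h => hno b h hbw, hab.2⟩ ih

/-- The part of a bad cycle's component that remains contains a deleted vertex. -/
theorem Splits.exists_mem_of_badCycle {T : Finset ℕ} (hT : Splits n q g R T)
    (hR : Carries n g R) {r : ℕ} (hr : BadCycle n q g r) :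
    ∃ t ∈ T, ∃ w, ReflTransGen (Step n g) r w ∧
      ReflTransGen (StepFrom n g (Blocked n q g (OnCycle n g))) t w := by
  classical
  -- If no tree hanging on the cycle met `T`, the cycle and these trees would remain, and more than
  -- `q` vertices would lead to `r`.
  by_contra! hno
  set F := Blocked n q g (OnCycle n g) with hF
  have hcyc : ∀ w, ReflTransGen (Step n g) r w → w ∈ R ∧ w ∉ T := by
    intro w hrw
    obtain ⟨c, hstep, -⟩ := TransGen.head'_iff.1 (hr.1.of_reflTransGen hrw)
    exact ⟨(hR.mem w c hstep).1, fun h => hno w h w hrw .refl⟩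
  have hup := hT.2 r (hcyc r .refl).1 (hcyc r .refl).2
  refine absurd hup (not_le.2 (hr.2.trans_le ?_))
  rw [← Finset.sum_filter]
  have hsum : ∀ u ∈ (Finset.range (n + 1)).filter fun u => ReflTransGen (Step n g) r u,
      weight n q g (OnCycle n g) (n + 1) u = (tree n g R F u).card := fun u hu =>
    (card_tree hR cuts_onCycle u (hcyc u (Finset.mem_filter.1 hu).2).1).symm
  rw [Finset.sum_congr rfl hsum, ← Finset.card_biUnion]
  · refine Finset.card_le_card fun u hu => ?_
    rw [Finset.mem_biUnion] at hu
    obtain ⟨w, hw, hu⟩ := hu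
    have hrw := (Finset.mem_filter.1 hw).2
    rw [mem_tree] at hu
    obtain ⟨hu, hp⟩ := hu
    refine Finset.mem_filter.2 ⟨hu, ?_⟩
    have h₁ : ReflTransGen (fun a b => a ∉ T ∧ b ∉ T ∧ Step n g a b) u w := by
      clear hu
      induction hp using ReflTransGen.head_induction_on with
      | refl => exact .refl
      | @head a b hab hbw ih =>
        exact .head ⟨fun h => hno a h w hrw (.head hab hbw), fun h => hno b h w hrw hbw, hab.2⟩ ih
    refine h₁.trans ?_
    have hwr := hr.1.symm hrw
    clear h₁ hp hu hw
    induction hwr using ReflTransGen.head_induction_on with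
    | refl => exact .refl
    | @head a b hab hbr ih =>
      have hrb := hrw.tail hab
      exact .head ⟨(hcyc a hrw).2, (hcyc b hrb).2, hab⟩ (ih hrb)
  · intro a ha b hb hne
    refine Finset.disjoint_left.2 fun u hu hu' => hne ?_
    have key : ∀ a b, ReflTransGen (Step n g) r a → ReflTransGen (StepFrom n g F) a b → a = b := by
      intro a b hra hab
      rcases hab.cases_head with h | ⟨c, hc, -⟩
      · exact h
      · exact absurd (.inl (hr.1.of_reflTransGen hra)) hc.1
    rcases ReflTransGen.total_of_right_unique stepFrom_rightUnique (mem_tree.1 hu).2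
      (mem_tree.1 hu').2 with h | h
    · exact key a b (Finset.mem_filter.1 ha).2 h
    · exact (key b a (Finset.mem_filter.1 hb).2 h).symm

/-- On each bad cycle, `T` singles out a vertex `φ r` whose hanging tree meets `T`. The greedy set
based on these vertices costs at least `splitCost`, by minimality on every cycle. It has at most as
many elements as `T`: each deleted vertex has an element of `T` in its tree, and these trees are
disjoint. -/
theorem Splits.splitCost_le {T : Finset ℕ} (hT : Splits n q g R T) (hR : Carries n g R) :
    splitCost n q g R ≤ T.card := by
  classical
  have hex : ∀ r, ∃ w, BestCut n q g r → ReflTransGen (Step n g) r w ∧ ∃ t ∈ T,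
      ReflTransGen (StepFrom n g (Blocked n q g (OnCycle n g))) t w := by
    intro r
    by_cases hr : BestCut n q g r
    · obtain ⟨t, ht, w, h₁, h₂⟩ := hT.exists_mem_of_badCycle hR hr.1
      exact ⟨w, fun _ => ⟨h₁, t, ht, h₂⟩⟩
    · exact ⟨r, fun h => absurd h hr⟩
  choose φ hφ using hex
  have hsame : ∀ r ∈ bestCuts n q g, ∀ r' ∈ bestCuts n q g,
      ReflTransGen (Step n g) (φ r) (φ r') → r = r' := by
    intro r hr r' hr' hp
    rw [mem_bestCuts] at hr hr'
    exact hr.eq_of_reflTransGen hr'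
      (((hφ r hr).1.trans hp).trans (hr'.1.1.symm (hφ r' hr').1))
  set Q := (bestCuts n q g).image φ with hQdef
  have hQ : Transversal n q g Q := by
    refine ⟨?_, ?_, ?_⟩
    · intro r hr
      obtain ⟨s, hs, rfl⟩ := Finset.mem_image.1 hr
      rw [mem_bestCuts] at hs
      exact hs.1.of_reflTransGen (hφ s hs).1
    · intro v hv
      obtain ⟨r, hr, hp⟩ := hv.exists_bestCut
      exact ⟨φ r, Finset.mem_image_of_mem _ (mem_bestCuts.2 hr), hp.trans (hφ r hr).1⟩
    · intro a ha b hb hp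
      obtain ⟨r, hr, rfl⟩ := Finset.mem_image.1 ha
      obtain ⟨r', hr', rfl⟩ := Finset.mem_image.1 hb
      rw [hsame r hr r' hr' hp]
  have hcost : splitCost n q g R ≤ (greedy n q g R Q).card := by
    rw [splitCost_eq hR, hQ.card_greedy, hQdef, Finset.sum_image]
    · refine Nat.add_le_add_left (Finset.sum_le_sum fun r hr => ?_) _
      rw [mem_bestCuts] at hr
      have := hr.2 _ (hφ r hr).1
      omega
    · exact fun r hr r' hr' h => hsame r hr r' hr' (h ▸ .refl)
  refine hcost.trans (Finset.card_le_card_of_forall_subsingleton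
    (fun v t => ReflTransGen (StepFrom n g (Blocked n q g (CutFrom n q g Q))) t v) ?_ ?_)
  · intro v hv
    have hvR := (hQ.splits_greedy hR).1 hv
    -- Cutting all cycles completely blocks at least as much, so the walks that come with `φ` remain
    -- admissible for `CutFrom`.
    have hsub : ∀ a < n, Blocked n q g (CutFrom n q g Q) a → Blocked n q g (OnCycle n g) a := by
      intro a han ha
      by_cases hc : OnCycle n g a
      · exact .inl hc
      rcases ha with (h | h) | h
      · exact .inl (hQ.bad a h).1
      · exact .inl h.1
      · rw [hQ.weight_of_not_onCycle hR.sentinel han hc] at h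
        exact .inr h
    -- A tree with more than `q` vertices cannot be spared by `T`. The only vertices deleted despite
    -- a small tree are those of `Q`, which were chosen with an element of `T` above them.
    by_cases hq : q < weight n q g (CutFrom n q g Q) (n + 1) v
    · rw [← card_tree hR hQ.cuts v hvR] at hq
      exact hT.exists_mem_of_tree hvR hq
    · have hvQ : v ∈ Q := by
        rcases (hQ.mem_greedy_iff hR).1 hv with h | ⟨hb, (h | h) | h⟩
        · rw [← hQ.weight_of_not_onCycle hR.sentinel (hR.lt v hvR) h.2.1] at h
          exact absurd h.2.2 hq
        · exact h
        · exact absurd hb h.2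
        · exact absurd h hq
      obtain ⟨r, hr, rfl⟩ := Finset.mem_image.1 hvQ
      obtain ⟨-, t, ht, hp⟩ := hφ r (mem_bestCuts.1 hr)
      exact ⟨t, ht, ReflTransGen.mono
        (fun a b hab => ⟨fun h => hab.1 (hsub a hab.2.1 h), hab.2⟩) _ _ hp⟩
  · intro t _ v hv v' hv'
    -- Deleted vertices are blocked, so no walk in a tree continues beyond one; this makes their
    -- trees disjoint.
    have key : ∀ v ∈ greedy n q g R Q, ∀ v',
        ReflTransGen (StepFrom n g (Blocked n q g (CutFrom n q g Q))) v v' → v = v' := by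
      intro v hv v' hp
      rcases hp.cases_head with h | ⟨c, hc, -⟩
      · exact h
      · exfalso
        apply hc.1
        rcases (hQ.mem_greedy_iff hR).1 hv with h | h
        · rw [← hQ.weight_of_not_onCycle hR.sentinel (hR.lt v h.1) h.2.1] at h
          exact .inr h.2.2
        · exact h.2
    rcases ReflTransGen.total_of_right_unique stepFrom_rightUnique hv.2 hv'.2 with h | h
    · exact key v hv.1 v' h
    · exact (key v' hv'.1 v h).symm

theorem exists_splits_iff (hR : Carries n g R) (m : ℕ) :
    (∃ T, Splits n q g R T ∧ T.card ≤ m) ↔ splitCost n q g R ≤ m := by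
  constructor
  · rintro ⟨T, hT, hm⟩
    exact (hT.splitCost_le hR).trans hm
  · intro h
    refine ⟨_, transversal_bestCuts.splits_greedy hR, ?_⟩
    rwa [transversal_bestCuts.card_greedy, ← splitCost_eq hR]

end FunctionalGraph
end LiquidDemocracy

namespace LiquidDemocracy

/-! ## A small language with bounded loops, compiled to programs -/

/-- The program `p` halts on `m` after at most `T` steps with a memory that satisfies `post`. -/
def Ensures (p : Program) (m : Memory) (T : ℕ) (post : Memory → Prop) : Prop :=
  ∃ m' t, Runs p m m' t ∧ t ≤ T ∧ post m'

namespace Ensures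

variable {p q : Program} {m : Memory} {T T₁ T₂ : ℕ} {post post' : Memory → Prop}

theorem mono (h : Ensures p m T post) (hT : T ≤ T₁) (hp : ∀ m', post m' → post' m') :
    Ensures p m T₁ post' :=
  let ⟨m', t, h₁, h₂, h₃⟩ := h
  ⟨m', t, h₁, h₂.trans hT, hp m' h₃⟩

theorem assign {r : ℕ} {e : Term} (h : post ⟨Function.update m.reg r (e.eval m), m.arr⟩) :
    Ensures (.assign r e) m (e.steps + 1) post :=
  ⟨_, _, .assign r e m, le_rfl, h⟩

theorem store {a : ℕ} {i e : Term} (h : post ⟨m.reg, Function.update m.arr a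
    (Function.update (m.arr a) (i.eval m) (e.eval m))⟩) :
    Ensures (.store a i e) m (i.steps + e.steps + 1) post :=
  ⟨_, _, .store a i e m, le_rfl, h⟩

theorem seq (h : Ensures p m T₁ fun m₁ => Ensures q m₁ T₂ post) :
    Ensures (.seq p q) m (T₁ + T₂) post := by
  obtain ⟨m₁, t₁, h₁, ht₁, m₂, t₂, h₂, ht₂, h⟩ := h
  exact ⟨m₂, _, .seq h₁ h₂, add_le_add ht₁ ht₂, h⟩

theorem cond {e : Term} (h₁ : e.eval m ≠ 0 → Ensures p m T₁ post)
    (h₂ : e.eval m = 0 → Ensures q m T₂ post) :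
    Ensures (.cond e p q) m (e.steps + 1 + (T₁ + T₂)) post := by
  by_cases he : e.eval m = 0
  · obtain ⟨m', t, h, ht, hp⟩ := h₂ he
    exact ⟨m', _, .cond_false he h, by omega, hp⟩
  · obtain ⟨m', t, h, ht, hp⟩ := h₁ he
    exact ⟨m', _, .cond_true he h, by omega, hp⟩

/-- A counting loop: register `c` counts up to the value of register `1`. -/
theorem count {c N : ℕ} (I : ℕ → Memory → Prop)
    (hI : ∀ j m, I j m → m.reg c = j ∧ m.reg 1 = N)
    (hp : ∀ j m, j < N → I j m → Ensures p m T (I (j + 1))) (h0 : I 0 m) :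
    Ensures (.loop (.lt (.reg c) (.reg 1)) p) m (N * (T + 4) + 4) (I N) := by
  -- Every test of the loop condition takes `4` steps, three for the comparison and one for the
  -- loop, including the final test that fails.
  suffices h : ∀ k j m, j + k = N → I j m →
      Ensures (.loop (.lt (.reg c) (.reg 1)) p) m (k * (T + 4) + 4) (I N) from
    h N 0 m (by omega) h0
  intro k
  induction k with
  | zero =>
    intro j m hj h
    obtain ⟨h₁, h₂⟩ := hI j m h
    refine ⟨m, _, .loop_false (by simp [Term.eval, h₁, h₂]; omega), by simp [Term.steps], ?_⟩
    rwa [← show j = N by omega]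
  | succ k ih =>
    intro j m hj h
    obtain ⟨h₁, h₂⟩ := hI j m h
    obtain ⟨m₁, t₁, hr₁, ht₁, hm₁⟩ := hp j m (by omega) h
    obtain ⟨m₂, t₂, hr₂, ht₂, hm₂⟩ := ih (j + 1) m₁ (by omega) hm₁
    refine ⟨m₂, _, .loop_true ?_ hr₁ hr₂, ?_, hm₂⟩
    · simp only [Term.eval, h₁, h₂, if_pos (show j < N by omega)]
      exact one_ne_zero
    · have h₃ : (k + 1) * (T + 4) = k * (T + 4) + (T + 4) := by ring
      simp only [Term.steps]
      omega

end Ensures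

/-- `f (k - 1) (… (f 0 a))`. -/
def foldUpto {α : Type*} (f : ℕ → α → α) (a : α) : ℕ → α
  | 0 => a
  | k + 1 => f k (foldUpto f a k)

/-- The memory with `v` in register `r`. -/
def Memory.set (m : Memory) (r v : ℕ) : Memory := ⟨Function.update m.reg r v, m.arr⟩

/-- The memory with `F` in array `a`. -/
def Memory.setArr (m : Memory) (a : ℕ) (F : ℕ → ℕ) : Memory := ⟨m.reg, Function.update m.arr a F⟩

/-- Expressions with bounded folds: `fold i a e₀ e` starts with the value of `e₀` in variable `a`
and replaces it by the value of `e` for the values `0, …, N - 1` of the variable `i`. -/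
inductive Expr where
  | const (c : ℕ)
  | var (k : ℕ)
  | read (a : ℕ) (e : Expr)
  | add (e₁ e₂ : Expr)
  | sub (e₁ e₂ : Expr)
  | lt (e₁ e₂ : Expr)
  | eq (e₁ e₂ : Expr)
  | ite (e e₁ e₂ : Expr)
  | fold (i a : ℕ) (e₀ e : Expr)

/-- The value of an expression. -/
def Expr.eval (N : ℕ) : Expr → Memory → ℕ
  | const c, _ => c
  | var k, m => m.reg k
  | read a e, m => m.arr a (e.eval N m)
  | add e₁ e₂, m => e₁.eval N m + e₂.eval N m
  | sub e₁ e₂, m => e₁.eval N m - e₂.eval N m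
  | lt e₁ e₂, m => if e₁.eval N m < e₂.eval N m then 1 else 0
  | eq e₁ e₂, m => if e₁.eval N m = e₂.eval N m then 1 else 0
  | ite e e₁ e₂, m => if e.eval N m ≠ 0 then e₁.eval N m else e₂.eval N m
  | fold i a e₀ e, m => foldUpto (fun j s => e.eval N ((m.set i j).set a s)) (e₀.eval N m) N

/-- Statements: `tab a i e` puts the values of `e` for the values `0, …, N - 1` of the variable `i`
into array `a`, and `loop i s` executes `s` for these values of `i`. -/
inductive Stmt where
  | asg (k : ℕ) (e : Expr)
  | tab (a i : ℕ) (e : Expr)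
  | seq (s₁ s₂ : Stmt)
  | loop (i : ℕ) (s : Stmt)

/-- The effect of a statement. -/
def Stmt.exec (N : ℕ) : Stmt → Memory → Memory
  | asg k e, m => m.set k (e.eval N m)
  | tab a i e, m => m.setArr a fun j => if j < N then e.eval N (m.set i j) else m.arr a j
  | seq s₁ s₂, m => s₂.exec N (s₁.exec N m)
  | loop i s, m => foldUpto (fun j m => s.exec N (m.set i j)) m N

/-- The part of the memory that holds variables and arrays; the rest is scratch. -/
def Memory.view (m : Memory) : Memory := ⟨fun k => m.reg (2 * k), fun a => m.arr (2 * a)⟩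

/-- The program that puts the value of an expression into register `2 b + 1`. -/
def Expr.compile : Expr → ℕ → Program
  | const c, b => .assign (2 * b + 1) (.const c)
  | var k, b => .assign (2 * b + 1) (.reg (2 * k))
  | read a e, b =>
    .seq (e.compile b) (.assign (2 * b + 1) (.read (2 * a) (.reg (2 * b + 1))))
  | add e₁ e₂, b => .seq (e₁.compile b) (.seq (e₂.compile (b + 1))
      (.assign (2 * b + 1) (.add (.reg (2 * b + 1)) (.reg (2 * b + 3)))))
  | sub e₁ e₂, b => .seq (e₁.compile b) (.seq (e₂.compile (b + 1))
      (.assign (2 * b + 1) (.sub (.reg (2 * b + 1)) (.reg (2 * b + 3)))))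
  | lt e₁ e₂, b => .seq (e₁.compile b) (.seq (e₂.compile (b + 1))
      (.assign (2 * b + 1) (.lt (.reg (2 * b + 1)) (.reg (2 * b + 3)))))
  | eq e₁ e₂, b => .seq (e₁.compile b) (.seq (e₂.compile (b + 1))
      (.assign (2 * b + 1) (.eq (.reg (2 * b + 1)) (.reg (2 * b + 3)))))
  | ite e e₁ e₂, b =>
    .seq (e.compile b) (.cond (.reg (2 * b + 1)) (e₁.compile b) (e₂.compile b))
  | fold i a e₀ e, b =>
    .seq (e₀.compile b) <|
    .seq (.assign (2 * b + 3) (.reg (2 * i))) <|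
    .seq (.assign (2 * b + 5) (.reg (2 * a))) <|
    .seq (.assign (2 * b + 7) (.const 0)) <|
    .seq (.loop (.lt (.reg (2 * b + 7)) (.reg 1)) <|
      .seq (.assign (2 * i) (.reg (2 * b + 7))) <|
      .seq (.assign (2 * a) (.reg (2 * b + 1))) <|
      .seq (e.compile (b + 4)) <|
      .seq (.assign (2 * b + 1) (.reg (2 * b + 9))) <|
      .assign (2 * b + 7) (.add (.reg (2 * b + 7)) (.const 1))) <|
    .seq (.assign (2 * a) (.reg (2 * b + 5))) <|
    .assign (2 * i) (.reg (2 * b + 3))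

/-- The program for a statement; it does not use the scratch registers below `2 b + 1`. -/
def Stmt.compile : Stmt → ℕ → Program
  | asg k e, b => .seq (e.compile b) (.assign (2 * k) (.reg (2 * b + 1)))
  | tab a i e, b =>
    .seq (.assign (2 * b + 1) (.reg (2 * i))) <|
    .seq (.assign (2 * b + 3) (.const 0)) <|
    .seq (.loop (.lt (.reg (2 * b + 3)) (.reg 1)) <|
      .seq (.assign (2 * i) (.reg (2 * b + 3))) <|
      .seq (e.compile (b + 2)) <|
      .seq (.store (2 * a + 1) (.reg (2 * b + 3)) (.reg (2 * b + 5))) <|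
      .assign (2 * b + 3) (.add (.reg (2 * b + 3)) (.const 1))) <|
    .seq (.assign (2 * i) (.reg (2 * b + 1))) <|
    .seq (.assign (2 * b + 3) (.const 0)) <|
    .loop (.lt (.reg (2 * b + 3)) (.reg 1)) <|
      .seq (.store (2 * a) (.reg (2 * b + 3)) (.read (2 * a + 1) (.reg (2 * b + 3)))) <|
      .assign (2 * b + 3) (.add (.reg (2 * b + 3)) (.const 1))
  | seq s₁ s₂, b => .seq (s₁.compile b) (s₂.compile b)
  | loop i s, b =>
    .seq (.assign (2 * b + 1) (.const 0)) <|
    .loop (.lt (.reg (2 * b + 1)) (.reg 1)) <|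
      .seq (.assign (2 * i) (.reg (2 * b + 1))) <|
      .seq (s.compile (b + 1)) <|
      .assign (2 * b + 1) (.add (.reg (2 * b + 1)) (.const 1))

open Polynomial in
/-- A bound for the running time of a compiled expression. -/
noncomputable def Expr.time : Expr → Polynomial ℕ
  | const _ => 2
  | var _ => 2
  | read _ e => e.time + 3
  | add e₁ e₂ | sub e₁ e₂ | lt e₁ e₂ | eq e₁ e₂ => e₁.time + (e₂.time + 4)
  | ite e e₁ e₂ => e.time + (2 + (e₁.time + e₂.time))
  | fold _ _ e₀ e => e₀.time + (2 + (2 + (2 + (X * (2 + (2 + (e.time + (2 + 4))) + 4) + 4 + (2 + 2)))))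

open Polynomial in
/-- A bound for the running time of a compiled statement. -/
noncomputable def Stmt.time : Stmt → Polynomial ℕ
  | asg _ e => e.time + 2
  | tab _ _ e => 2 + (2 + (X * (2 + (e.time + (3 + 4)) + 4) + 4 + (2 + (2 + (X * (4 + 4 + 4) + 4)))))
  | seq s₁ s₂ => s₁.time + s₂.time
  | loop _ s => 2 + (X * (2 + (s.time + 4) + 4) + 4)

/-- The registers that a computation with scratch registers from `2 b + 1` on preserves. -/
def Memory.SameBelow (b : ℕ) (m m' : Memory) : Prop :=
  ∀ r, r % 2 = 0 ∨ r < 2 * b + 1 → m'.reg r = m.reg r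

theorem Memory.SameBelow.view_eq {b : ℕ} {m m' : Memory} (h : m.SameBelow b m')
    (ha : m'.arr = m.arr) : m'.view = m.view := by
  unfold Memory.view
  rw [ha]
  congr 1
  exact funext fun k => h _ (.inl (by omega))

theorem foldUpto_congr {α : Type*} {f f' : ℕ → α → α} {a : α} {N : ℕ}
    (h : ∀ j < N, ∀ s, f j s = f' j s) : foldUpto f a N = foldUpto f' a N := by
  induction N with
  | zero => rfl
  | succ N ih => rw [foldUpto, foldUpto, ih fun j hj => h j (by omega), h N (by omega)]

end LiquidDemocracy

/-! ### Correctness and running time of the compiled programs -/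

namespace LiquidDemocracy

theorem Memory.SameBelow.trans {b : ℕ} {m₁ m₂ m₃ : Memory} (h₁ : m₁.SameBelow b m₂)
    (h₂ : m₂.SameBelow b m₃) : m₁.SameBelow b m₃ := fun r hr => (h₂ r hr).trans (h₁ r hr)

theorem Memory.SameBelow.mono {b b' : ℕ} {m m' : Memory} (h : m.SameBelow b' m') (hb : b ≤ b') :
    m.SameBelow b m' := fun r hr => h r (hr.imp_right fun h => by omega)

/-- The specification of a compiled expression. -/
def Expr.Correct (N : ℕ) (e : Expr) : Prop :=
  ∀ b m, 1 ≤ b → m.reg 1 = N → Ensures (e.compile b) m (e.time.eval N) fun m' =>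
    m'.arr = m.arr ∧ m.SameBelow b m' ∧ m'.reg (2 * b + 1) = e.eval N m.view

/-- The second operand only uses scratch registers from `2 * b + 3` on, so the first result survives
in `2 * b + 1`. -/
theorem Expr.correct_binary {N : ℕ} {e₁ e₂ : Expr} (h₁ : e₁.Correct N) (h₂ : e₂.Correct N)
    {op : Term → Term → Term} {f : ℕ → ℕ → ℕ} {b : ℕ} {m : Memory} (hb : 1 ≤ b)
    (hm : m.reg 1 = N)
    (hop : ∀ m r r', (op (.reg r) (.reg r')).eval m = f (m.reg r) (m.reg r'))
    (hst : ∀ r r', (op (.reg r) (.reg r')).steps = 3) :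
    Ensures (.seq (e₁.compile b) (.seq (e₂.compile (b + 1))
      (.assign (2 * b + 1) (op (.reg (2 * b + 1)) (.reg (2 * b + 3)))))) m
      (e₁.time.eval N + (e₂.time.eval N + 4)) fun m' =>
    m'.arr = m.arr ∧ m.SameBelow b m' ∧
      m'.reg (2 * b + 1) = f (e₁.eval N m.view) (e₂.eval N m.view) := by
  refine .seq ((h₁ b m hb hm).mono le_rfl ?_)
  rintro m₁ ⟨ha₁, hs₁, hr₁⟩
  refine .seq ((h₂ (b + 1) m₁ (by omega) ((hs₁ 1 (by omega)).trans hm)).mono le_rfl ?_)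
  rintro m₂ ⟨ha₂, hs₂, hr₂⟩
  refine Ensures.mono (.assign ?_) (by rw [hst]) (fun _ => id)
  refine ⟨ha₂.trans ha₁, fun r hr => ?_, ?_⟩
  · dsimp only
    rw [Function.update_of_ne (by omega)]
    exact (hs₁.trans (hs₂.mono (by omega))) r hr
  · dsimp only
    rw [Function.update_self, hop, hs₂ _ (by omega), hr₁,
      show 2 * b + 3 = 2 * (b + 1) + 1 by ring, hr₂, hs₁.view_eq ha₁]

/-- Variables live in even registers and scratch values in odd ones; `1 ≤ b` protects register `1`,
the loop bound. A fold overwrites its two bound variables and restores them, so that expressions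
have no visible side effect. -/
theorem Expr.correct (N : ℕ) : ∀ e : Expr, e.Correct N
  | .const c => by
    intro b m _ _
    refine Ensures.mono (.assign ⟨rfl, fun r hr => ?_, ?_⟩) (by simp [Term.steps, time])
      (fun _ => id)
    · exact Function.update_of_ne (by omega) _ _
    · simp [Term.eval, eval]
  | .var k => by
    intro b m _ _
    refine Ensures.mono (.assign ⟨rfl, fun r hr => ?_, ?_⟩) (by simp [Term.steps, time])
      (fun _ => id)
    · exact Function.update_of_ne (by omega) _ _
    · simp [Term.eval, eval, Memory.view]
  | .read a e => by
    intro b m hb hm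
    refine Ensures.mono (T := e.time.eval N + 3) (.seq ((correct N e b m hb hm).mono le_rfl ?_))
      ?_ (fun _ => id)
    · rintro m₁ ⟨ha₁, hs₁, hr₁⟩
      refine Ensures.mono (.assign ⟨ha₁, fun r hr => ?_, ?_⟩) (by simp [Term.steps])
        (fun _ => id)
      · dsimp only
        rw [Function.update_of_ne (by omega)]
        exact hs₁ r hr
      · simp [Term.eval, eval, Memory.view, hr₁, ha₁]
    · simp [time]
  | .add e₁ e₂ => by
    intro b m hb hm
    refine Ensures.mono (correct_binary (correct N e₁) (correct N e₂) (op := Term.add)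
      (f := fun x y => x + y) hb hm (fun _ _ _ => rfl) (fun _ _ => rfl)) (by simp [time]) ?_
    exact fun _ h => h
  | .sub e₁ e₂ => by
    intro b m hb hm
    refine Ensures.mono (correct_binary (correct N e₁) (correct N e₂) (op := Term.sub)
      (f := fun x y => x - y) hb hm (fun _ _ _ => rfl) (fun _ _ => rfl)) (by simp [time]) ?_
    exact fun _ h => h
  | .lt e₁ e₂ => by
    intro b m hb hm
    refine Ensures.mono (correct_binary (correct N e₁) (correct N e₂) (op := Term.lt)
      (f := fun x y => if x < y then 1 else 0) hb hm (fun _ _ _ => rfl) (fun _ _ => rfl))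
      (by simp [time]) ?_
    exact fun _ h => h
  | .eq e₁ e₂ => by
    intro b m hb hm
    refine Ensures.mono (correct_binary (correct N e₁) (correct N e₂) (op := Term.eq)
      (f := fun x y => if x = y then 1 else 0) hb hm (fun _ _ _ => rfl) (fun _ _ => rfl))
      (by simp [time]) ?_
    exact fun _ h => h
  | .ite e e₁ e₂ => by
    intro b m hb hm
    refine Ensures.mono (T := e.time.eval N + (2 + (e₁.time.eval N + e₂.time.eval N)))
      (.seq ((correct N e b m hb hm).mono le_rfl ?_)) ?_ (fun _ => id)
    · rintro m₁ ⟨ha₁, hs₁, hr₁⟩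
      have hm₁ := (hs₁ 1 (by omega)).trans hm
      refine .cond (fun hc => (correct N e₁ b m₁ hb hm₁).mono le_rfl ?_)
        (fun hc => (correct N e₂ b m₁ hb hm₁).mono le_rfl ?_)
      all_goals
        rintro m₂ ⟨ha₂, hs₂, hr₂⟩
        refine ⟨ha₂.trans ha₁, hs₁.trans hs₂, ?_⟩
        simp only [Term.eval, hr₁] at hc
        rw [hr₂, hs₁.view_eq ha₁]
        simp [eval, hc]
    · simp [time]
  | .fold i a e₀ e => by
    intro b m hb hm
    let f : ℕ → ℕ → ℕ := fun j s => e.eval N ((m.view.set i j).set a s)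
    -- Registers `2 * b + 3` and `2 * b + 5` keep the old values of the bound variables, `2 * b + 7`
    -- is the counter, and `2 * b + 1` the accumulator.
    let I : ℕ → Memory → Prop := fun j m' =>
      (m'.reg (2 * b + 7) = j ∧ m'.reg 1 = N) ∧ m'.arr = m.arr ∧
      (∀ r, (r % 2 = 0 ∧ r ≠ 2 * i ∧ r ≠ 2 * a) ∨ (r % 2 = 1 ∧ r < 2 * b + 1) →
        m'.reg r = m.reg r) ∧
      m'.reg (2 * b + 3) = m.reg (2 * i) ∧ m'.reg (2 * b + 5) = m.reg (2 * a) ∧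
      m'.reg (2 * b + 1) = foldUpto f (e₀.eval N m.view) j
    refine Ensures.mono (T := e₀.time.eval N + (2 + (2 + (2 + ((N * ((2 + (2 + (e.time.eval N +
      (2 + 4)))) + 4) + 4) + (2 + 2)))))) (.seq ((correct N e₀ b m hb hm).mono le_rfl ?_)) ?_
      (fun _ => id)
    · rintro m₁ ⟨ha₁, hs₁, hr₁⟩
      refine .seq (.assign <| .seq <| .assign <| .seq <| .assign <| .seq ?_)
      refine Ensures.mono (Ensures.count I (fun j m h => h.1) ?_ ?_) le_rfl ?_
      · rintro j m₂ hj ⟨⟨hc, hN⟩, ha, hr, h₃, h₅, h₁⟩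
        refine .seq (.assign <| .seq <| .assign <| .seq ?_)
        refine (correct N e (b + 4) _ (by omega) ?_).mono le_rfl ?_
        · simp only
          rw [Function.update_of_ne (by omega), Function.update_of_ne (by omega), hN]
        · rintro m₃ ⟨ha₃, hs₃, hr₃⟩
          have hview : Memory.view ⟨Function.update (Function.update m₂.reg (2 * i)
              ((Term.reg (2 * b + 7)).eval m₂)) (2 * a) ((Term.reg (2 * b + 1)).eval
              ⟨Function.update m₂.reg (2 * i) ((Term.reg (2 * b + 7)).eval m₂), m₂.arr⟩),
              m₂.arr⟩ = (m.view.set i j).set a (foldUpto f (e₀.eval N m.view) j) := by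
            simp only [Memory.view, Memory.set, ha, Term.eval]
            congr 1
            funext k
            rw [Function.update_of_ne (show 2 * b + 1 ≠ 2 * i by omega), h₁, hc]
            by_cases hka : k = a
            · subst hka
              simp only [Function.update_self]
              rfl
            rw [Function.update_of_ne (by omega), Function.update_of_ne hka]
            by_cases hki : k = i
            · subst hki
              simp only [Function.update_self]
            · rw [Function.update_of_ne (by omega), Function.update_of_ne hki]
              exact hr _ (.inl ⟨by omega, by omega, by omega⟩)
          rw [hview] at hr₃
          have hreg : ∀ r, r ≠ 2 * i → r ≠ 2 * a → (r % 2 = 0 ∨ r < 2 * (b + 4) + 1) →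
              m₃.reg r = m₂.reg r := by
            intro r hri hra hr'
            rw [hs₃ r hr']
            simp only
            rw [Function.update_of_ne hra, Function.update_of_ne hri]
          refine Ensures.mono (.seq (.assign <| .assign ?_)) (by simp [Term.steps]) (fun _ => id)
          refine ⟨⟨?_, ?_⟩, ha₃.trans ha, ?_, ?_, ?_, ?_⟩
          · simp only [Function.update_self, Term.eval]
            rw [Function.update_of_ne (by omega), hreg _ (by omega) (by omega) (by omega), hc]
          · simp only
            rw [Function.update_of_ne (by omega), Function.update_of_ne (by omega),
              hreg _ (by omega) (by omega) (by omega), hN]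
          · intro r hr'
            simp only
            rw [Function.update_of_ne (by omega), Function.update_of_ne (by omega),
              hreg _ (by omega) (by omega) (by omega), hr r hr']
          · simp only
            rw [Function.update_of_ne (by omega), Function.update_of_ne (by omega),
              hreg _ (by omega) (by omega) (by omega), h₃]
          · simp only
            rw [Function.update_of_ne (by omega), Function.update_of_ne (by omega),
              hreg _ (by omega) (by omega) (by omega), h₅]
          · simp only [Term.eval]
            rw [Function.update_of_ne (by omega), Function.update_self,
              show 2 * b + 9 = 2 * (b + 4) + 1 by ring, hr₃]
            rfl
      · simp only [I, Term.eval]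
        refine ⟨⟨by simp, ?_⟩, ha₁, ?_, ?_, ?_, ?_⟩
        · rw [Function.update_of_ne (by omega), Function.update_of_ne (by omega),
            Function.update_of_ne (by omega), hs₁ _ (by omega), hm]
        · intro r hr
          rw [Function.update_of_ne (by omega), Function.update_of_ne (by omega),
            Function.update_of_ne (by omega), hs₁ _ (by omega)]
        · rw [Function.update_of_ne (by omega), Function.update_of_ne (by omega),
            Function.update_self, hs₁ _ (by omega)]
        · rw [Function.update_of_ne (by omega), Function.update_self,
            Function.update_of_ne (by omega), hs₁ _ (by omega)]
        · rw [Function.update_of_ne (by omega), Function.update_of_ne (by omega),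
            Function.update_of_ne (by omega), hr₁]
          rfl
      · rintro m₂ ⟨-, ha, hr, h₃, h₅, h₁⟩
        refine Ensures.mono (.seq (.assign <| .assign ?_)) (by simp [Term.steps]) (fun _ => id)
        refine ⟨ha, fun r hr' => ?_, ?_⟩
        · simp only [Term.eval]
          rw [Function.update_of_ne (show 2 * b + 3 ≠ 2 * a by omega), h₃, h₅]
          by_cases hri : r = 2 * i
          · rw [hri, Function.update_self]
          rw [Function.update_of_ne hri]
          by_cases hra : r = 2 * a
          · rw [hra, Function.update_self]
          rw [Function.update_of_ne hra]
          exact hr r (by omega)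
        · simp only
          rw [Function.update_of_ne (by omega), Function.update_of_ne (by omega), h₁]
          rfl
    · simp [time]

end LiquidDemocracy

namespace LiquidDemocracy

/-- The odd registers below `2 b + 1` are preserved. -/
def Memory.SameScratch (b : ℕ) (m m' : Memory) : Prop :=
  ∀ r, r % 2 = 1 → r < 2 * b + 1 → m'.reg r = m.reg r

theorem Memory.view_set {m : Memory} {i v : ℕ} :
    Memory.view ⟨Function.update m.reg (2 * i) v, m.arr⟩ = m.view.set i v := by
  simp only [Memory.view, Memory.set]
  congr 1
  funext k
  by_cases hki : k = i
  · subst hki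
    simp only [Function.update_self]
  · rw [Function.update_of_ne (by omega), Function.update_of_ne hki]

theorem Memory.view_setScratch {m : Memory} {r v : ℕ} (hr : r % 2 = 1) :
    Memory.view ⟨Function.update m.reg r v, m.arr⟩ = m.view := by
  simp only [Memory.view]
  congr 1
  funext k
  rw [Function.update_of_ne (by omega)]

/-- The specification of a compiled statement. -/
def Stmt.Correct (N : ℕ) (s : Stmt) : Prop :=
  ∀ b m, 1 ≤ b → m.reg 1 = N → Ensures (s.compile b) m (s.time.eval N) fun m' =>
    m'.view = s.exec N m.view ∧ m.SameScratch b m'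

/-- The expression may read the very array that is being filled. So the values first go to the odd
array `2 * a + 1`, which `view` does not show (invariant `I`), and are copied when all are known
(invariant `J`). -/
theorem Stmt.correct_tab (N a i : ℕ) (e : Expr) : (Stmt.tab a i e).Correct N := by
  intro b m hb hm
  let F : ℕ → ℕ := fun j => e.eval N (m.view.set i j)
  let I : ℕ → Memory → Prop := fun j m' =>
    (m'.reg (2 * b + 3) = j ∧ m'.reg 1 = N) ∧
    (∀ r, r % 2 = 0 ∧ r ≠ 2 * i ∨ r % 2 = 1 ∧ r < 2 * b + 1 → m'.reg r = m.reg r) ∧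
    m'.reg (2 * b + 1) = m.reg (2 * i) ∧
    (∀ c, m'.arr (2 * c) = m.arr (2 * c)) ∧ ∀ k < j, m'.arr (2 * a + 1) k = F k
  let J : ℕ → Memory → Prop := fun j m' =>
    (m'.reg (2 * b + 3) = j ∧ m'.reg 1 = N) ∧
    (∀ r, r % 2 = 0 ∨ r % 2 = 1 ∧ r < 2 * b + 1 → m'.reg r = m.reg r) ∧
    (∀ c ≠ a, m'.arr (2 * c) = m.arr (2 * c)) ∧ (∀ k < N, m'.arr (2 * a + 1) k = F k) ∧
    ∀ k, m'.arr (2 * a) k = if k < j then F k else m.arr (2 * a) k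
  refine Ensures.mono (T := 2 + (2 + ((N * ((2 + (e.time.eval N + (3 + 4))) + 4) + 4) +
    (2 + (2 + (N * ((4 + 4) + 4) + 4))))))
    (.seq (.assign <| .seq <| .assign <| .seq ?_)) (by simp [time]) (fun _ => id)
  refine Ensures.mono (Ensures.count I (fun j m h => h.1) ?_ ?_) le_rfl ?_
  · rintro j m₂ - ⟨⟨hc, hN⟩, hr, h₁, ha, hF⟩
    refine .seq (.assign <| .seq ?_)
    have hview : Memory.view ⟨Function.update m₂.reg (2 * i) j, m₂.arr⟩ = m.view.set i j := by
      rw [Memory.view_set]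
      simp only [Memory.view, Memory.set]
      congr 1
      · funext k
        by_cases hki : k = i
        · subst hki
          simp only [Function.update_self]
        · rw [Function.update_of_ne hki, Function.update_of_ne hki]
          exact hr _ (.inl ⟨by omega, by omega⟩)
      · exact funext ha
    simp only [Term.eval, hc]
    refine (Expr.correct N e (b + 2) _ (by omega) ?_).mono le_rfl ?_
    · dsimp only
      rw [Function.update_of_ne (by omega), hN]
    · rintro m₃ ⟨ha₃, hs₃, hr₃⟩
      rw [hview] at hr₃
      have hreg : ∀ r, r ≠ 2 * i → (r % 2 = 0 ∨ r < 2 * (b + 2) + 1) →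
          m₃.reg r = m₂.reg r := by
        intro r hri hr'
        rw [hs₃ r hr']
        dsimp only
        rw [Function.update_of_ne hri]
      have hc₃ : m₃.reg (2 * b + 3) = j := by rw [hreg _ (by omega) (by omega), hc]
      refine Ensures.mono (.seq (.store <| .assign ?_)) (by simp [Term.steps]) (fun _ => id)
      refine ⟨⟨?_, ?_⟩, ?_, ?_, ?_, ?_⟩
      · simp only [Function.update_self, Term.eval, hc₃]
      · dsimp only
        rw [Function.update_of_ne (by omega), hreg _ (by omega) (by omega), hN]
      · intro r hr'
        dsimp only
        rw [Function.update_of_ne (by omega), hreg _ (by omega) (by omega), hr r hr']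
      · dsimp only
        rw [Function.update_of_ne (by omega), hreg _ (by omega) (by omega), h₁]
      · intro c
        dsimp only
        rw [Function.update_of_ne (by omega), ha₃]
        exact ha c
      · intro k hk
        simp only [Term.eval, hc₃, Function.update_self]
        by_cases hkj : k = j
        · subst hkj
          rw [Function.update_self, show 2 * b + 5 = 2 * (b + 2) + 1 by ring, hr₃]
        · rw [Function.update_of_ne hkj, ha₃]
          exact hF k (by omega)
  · simp only [I, Term.eval]
    refine ⟨⟨by simp, ?_⟩, ?_, ?_, fun _ => trivial, fun k hk => absurd hk (by omega)⟩
    · rw [Function.update_of_ne (by omega), Function.update_of_ne (by omega), hm]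
    · intro r hr
      rw [Function.update_of_ne (by omega), Function.update_of_ne (by omega)]
    · rw [Function.update_of_ne (by omega), Function.update_self]
  · rintro m₂ ⟨⟨-, hN⟩, hr, h₁, ha, hF⟩
    refine .seq (.assign <| .seq <| .assign ?_)
    refine Ensures.mono (Ensures.count J (fun j m h => h.1) ?_ ?_) le_rfl ?_
    · rintro j m₃ hj ⟨⟨hc₃, hN₃⟩, hr₃, ha₃, hF₃, hA₃⟩
      refine Ensures.mono (.seq (.store <| .assign ?_)) (by simp [Term.steps]) (fun _ => id)
      refine ⟨⟨?_, ?_⟩, ?_, ?_, ?_, ?_⟩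
      · simp only [Function.update_self, Term.eval, hc₃]
      · dsimp only
        rw [Function.update_of_ne (by omega), hN₃]
      · intro r hr'
        dsimp only
        rw [Function.update_of_ne (by omega), hr₃ r hr']
      · intro c hca
        dsimp only
        rw [Function.update_of_ne (by omega), ha₃ c hca]
      · intro k hk
        dsimp only
        rw [Function.update_of_ne (by omega), hF₃ k hk]
      · intro k
        simp only [Term.eval, hc₃, Function.update_self]
        by_cases hkj : k = j
        · subst hkj
          rw [Function.update_self, if_pos (by omega), hF₃ k hj]
        · rw [Function.update_of_ne hkj, hA₃ k]
          exact if_congr (by omega) rfl rfl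
    · simp only [J, Term.eval]
      refine ⟨⟨by simp, ?_⟩, ?_, fun c _ => ha c, hF, fun k => ?_⟩
      · rw [Function.update_of_ne (by omega), Function.update_of_ne (by omega), hN]
      · intro r hr'
        rw [Function.update_of_ne (by omega)]
        by_cases hri : r = 2 * i
        · rw [hri, Function.update_self, h₁]
        · rw [Function.update_of_ne hri, hr r (by omega)]
      · rw [if_neg (by omega), ha]
    · rintro m₃ ⟨-, hr₃, ha₃, -, hA₃⟩
      refine ⟨?_, fun r hr hr' => hr₃ r (.inr ⟨hr, hr'⟩)⟩
      simp only [Memory.view, exec, Memory.setArr]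
      congr 1
      · funext k
        exact hr₃ _ (.inl (by omega))
      · funext c
        by_cases hca : c = a
        · subst hca
          rw [Function.update_self]
          exact funext hA₃
        · rw [Function.update_of_ne hca, ha₃ c hca]

theorem Stmt.correct (N : ℕ) : ∀ s : Stmt, s.Correct N
  | .asg k e => by
    intro b m hb hm
    refine Ensures.mono (T := e.time.eval N + 2)
      (.seq ((Expr.correct N e b m hb hm).mono le_rfl ?_)) (by simp [time]) (fun _ => id)
    rintro m₁ ⟨ha₁, hs₁, hr₁⟩
    refine Ensures.mono (.assign ⟨?_, fun r hr hr' => ?_⟩) (by simp [Term.steps]) (fun _ => id)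
    · rw [Memory.view_set, hs₁.view_eq ha₁]
      simp only [Term.eval, hr₁, exec]
    · dsimp only
      rw [Function.update_of_ne (by omega), hs₁ r (by omega)]
  | .tab a i e => correct_tab N a i e
  | .seq s₁ s₂ => by
    intro b m hb hm
    refine Ensures.mono (T := s₁.time.eval N + s₂.time.eval N)
      (.seq ((correct N s₁ b m hb hm).mono le_rfl ?_)) (by simp [time]) (fun _ => id)
    rintro m₁ ⟨hv₁, hs₁⟩
    refine (correct N s₂ b m₁ hb ((hs₁ 1 rfl (by omega)).trans hm)).mono le_rfl ?_
    rintro m₂ ⟨hv₂, hs₂⟩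
    exact ⟨by rw [hv₂, hv₁, exec], fun r hr hr' => (hs₂ r hr hr').trans (hs₁ r hr hr')⟩
  | .loop i s => by
    intro b m hb hm
    let I : ℕ → Memory → Prop := fun j m' =>
      (m'.reg (2 * b + 1) = j ∧ m'.reg 1 = N) ∧ m.SameScratch b m' ∧
      m'.view = foldUpto (fun j m => s.exec N (m.set i j)) m.view j
    refine Ensures.mono (T := 2 + (N * ((2 + (s.time.eval N + 4)) + 4) + 4))
      (.seq (.assign ?_)) (by simp [time]) (fun _ => id)
    refine Ensures.mono (Ensures.count I (fun j m h => h.1) ?_ ?_) le_rfl ?_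
    · rintro j m₂ - ⟨⟨hc, hN⟩, hs, hv⟩
      refine .seq (.assign <| .seq ((correct N s (b + 1) _ (by omega) ?_).mono le_rfl ?_))
      · dsimp only
        rw [Function.update_of_ne (by omega), hN]
      · rintro m₃ ⟨hv₃, hs₃⟩
        rw [Memory.view_set] at hv₃
        simp only [Term.eval, hc, hv] at hv₃
        have hreg : ∀ r, r % 2 = 1 → r < 2 * (b + 1) + 1 → m₃.reg r = m₂.reg r := by
          intro r hr hr'
          rw [hs₃ r hr hr']
          dsimp only
          rw [Function.update_of_ne (by omega)]
        refine Ensures.mono (.assign ⟨⟨?_, ?_⟩, ?_, ?_⟩) (by simp [Term.steps]) (fun _ => id)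
        · simp only [Function.update_self, Term.eval]
          rw [hreg _ (by omega) (by omega), hc]
        · dsimp only
          rw [Function.update_of_ne (by omega), hreg _ (by omega) (by omega), hN]
        · intro r hr hr'
          dsimp only
          rw [Function.update_of_ne (by omega), hreg _ hr (by omega), hs r hr hr']
        · rw [Memory.view_setScratch (by omega), hv₃, foldUpto]
    · refine ⟨⟨by simp [Term.eval], ?_⟩, fun r hr hr' => ?_, ?_⟩
      · dsimp only
        rw [Function.update_of_ne (by omega), hm]
      · dsimp only
        rw [Function.update_of_ne (by omega)]
      · rw [Memory.view_setScratch (by omega), foldUpto]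
    · rintro m₂ ⟨-, hs, hv⟩
      exact ⟨hv, hs⟩

theorem polynomial_eval_mono (P : Polynomial ℕ) {a b : ℕ} (h : a ≤ b) :
    P.eval a ≤ P.eval b := by
  rw [Polynomial.eval_eq_sum, Polynomial.eval_eq_sum]
  exact Finset.sum_le_sum fun i _ => Nat.mul_le_mul_left _ (Nat.pow_le_pow_left h i)

/-- A problem that is decided by a statement, with loop bound one more than the first number of
the input, is solvable in polynomial time. -/
theorem solvableInPolynomialTime_of_stmt {α : Type*} {enc : α → List ℕ} {yes : α → Prop} (s : Stmt)
    (hN : ∀ a, (enc a).getD 0 0 + 1 ≤ bitLength (enc a))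
    (hs : ∀ a, (yes a → (s.exec ((enc a).getD 0 0 + 1) (Memory.init (enc a))).reg 0 = 1) ∧
      (¬ yes a → (s.exec ((enc a).getD 0 0 + 1) (Memory.init (enc a))).reg 0 = 0)) :
    SolvableInPolynomialTime enc yes := by
  -- The first instruction stores the loop bound in register `1`, in `5` steps.
  refine ⟨.seq (.assign 1 (.add (.read 0 (.const 0)) (.const 1))) (s.compile 1),
    5 + s.time, fun a => ?_⟩
  set L := enc a with hL
  -- The input occupies register `0` and array `0`, and the renumbering by doubling fixes `0`.
  have hview : (Memory.init L).view = Memory.init L := by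
    simp only [Memory.view, Memory.init]
    congr 1
    · funext k
      exact if_congr (by omega) rfl rfl
    · funext k i
      exact if_congr (by omega) rfl rfl
  have key : Ensures (.seq (.assign 1 (.add (.read 0 (.const 0)) (.const 1))) (s.compile 1))
      (Memory.init L) (5 + s.time.eval (L.getD 0 0 + 1))
      fun m' => m'.view = s.exec (L.getD 0 0 + 1) (Memory.init L) := by
    refine .seq (.assign ((Stmt.correct (L.getD 0 0 + 1) s 1 _ le_rfl ?_).mono le_rfl ?_))
    · simp [Term.eval, Memory.init]
    · rintro m' ⟨hv, -⟩
      rw [hv, Memory.view_setScratch rfl, hview]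
  obtain ⟨m', t, hr, ht, hv⟩ := key
  refine ⟨m', t, hr, ht.trans ?_, ?_, ?_⟩
  · rw [Polynomial.eval_add]
    have := polynomial_eval_mono s.time (hN a)
    simpa using this
  all_goals
    have h0 : m'.reg 0 = m'.view.reg 0 := rfl
    rw [h0, hv]
  · exact (hs a).1
  · exact (hs a).2

end LiquidDemocracy

/-! ### What a statement leaves unchanged -/

namespace LiquidDemocracy

open Relation

@[simp] theorem Memory.reg_set (m : Memory) (r v k : ℕ) :
    (m.set r v).reg k = if k = r then v else m.reg k := Function.update_apply _ _ _ _

@[simp] theorem Memory.arr_set (m : Memory) (r v : ℕ) : (m.set r v).arr = m.arr := rfl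

@[simp] theorem Memory.reg_setArr (m : Memory) (a : ℕ) (F : ℕ → ℕ) :
    (m.setArr a F).reg = m.reg := rfl

@[simp] theorem Memory.arr_setArr (m : Memory) (a : ℕ) (F : ℕ → ℕ) (c : ℕ) :
    (m.setArr a F).arr c = if c = a then F else m.arr c := Function.update_apply _ _ _ _

/-- The variables that a statement may change. -/
def Stmt.regs : Stmt → List ℕ
  | asg k _ => [k]
  | tab _ _ _ => []
  | seq s₁ s₂ => s₁.regs ++ s₂.regs
  | loop i s => i :: s.regs

/-- The arrays that a statement may change. -/
def Stmt.arrs : Stmt → List ℕ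
  | asg _ _ => []
  | tab a _ _ => [a]
  | seq s₁ s₂ => s₁.arrs ++ s₂.arrs
  | loop _ s => s.arrs

theorem foldUpto_induction {α : Type*} {f : ℕ → α → α} {a : α} (P : ℕ → α → Prop) (h0 : P 0 a)
    (h : ∀ j s, P j s → P (j + 1) (f j s)) (k : ℕ) : P k (foldUpto f a k) := by
  induction k with
  | zero => exact h0
  | succ k ih => exact h k _ ih

/-- The lists `regs` and `arrs` are computable, so `decide` settles such side conditions for
concrete programs. Variables bound in expressions are not listed, because evaluation does not change
the memory. -/
theorem Stmt.exec_reg (N : ℕ) {r : ℕ} : ∀ (s : Stmt) (m : Memory), r ∉ s.regs →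
    (s.exec N m).reg r = m.reg r
  | .asg k e, m, h => by
    simp only [regs, List.mem_singleton] at h
    simp [exec, h]
  | .tab a i e, m, _ => rfl
  | .seq s₁ s₂, m, h => by
    simp only [regs, List.mem_append, not_or] at h
    rw [exec, exec_reg N s₂ _ h.2, exec_reg N s₁ _ h.1]
  | .loop i s, m, h => by
    simp only [regs, List.mem_cons, not_or] at h
    refine foldUpto_induction (fun _ (m' : Memory) => m'.reg r = m.reg r) rfl (fun j m' hm' => ?_) N
    rw [exec_reg N s _ h.2, Memory.reg_set, if_neg h.1, hm']

theorem Stmt.exec_arr (N : ℕ) {a : ℕ} : ∀ (s : Stmt) (m : Memory), a ∉ s.arrs →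
    (s.exec N m).arr a = m.arr a
  | .asg k e, m, _ => rfl
  | .tab c i e, m, h => by
    simp only [arrs, List.mem_singleton] at h
    simp [exec, h]
  | .seq s₁ s₂, m, h => by
    simp only [arrs, List.mem_append, not_or] at h
    rw [exec, exec_arr N s₂ _ h.2, exec_arr N s₁ _ h.1]
  | .loop i s, m, h =>
    foldUpto_induction (fun _ (m' : Memory) => m'.arr a = m.arr a) rfl (fun j m' hm' => by
      rw [exec_arr N s _ h, Memory.arr_set, hm']) N

theorem Stmt.exec_tab_arr {N a i j : ℕ} {e : Expr} {m : Memory} (h : j < N) :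
    ((Stmt.tab a i e).exec N m).arr a j = e.eval N (m.set i j) := by
  simp [exec, h]

theorem Stmt.exec_seq {N : ℕ} {s₁ s₂ : Stmt} {m : Memory} :
    (Stmt.seq s₁ s₂).exec N m = s₂.exec N (s₁.exec N m) := rfl

/-! ### Sums and walks as folds -/

theorem foldUpto_add (F : ℕ → ℕ) (N : ℕ) :
    foldUpto (fun j s => s + F j) 0 N = ∑ j ∈ Finset.range N, F j := by
  induction N with
  | zero => rfl
  | succ N ih => rw [foldUpto, ih, Finset.sum_range_succ]

/-- `∑ i, e` -/
def Expr.sum (i a : ℕ) (e : Expr) : Expr := .fold i a (.const 0) (.add (.var a) e)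

/-- Does the walk along array `A` that starts in `u` visit `v`? -/
def Expr.walk (A : ℕ) (u v : Expr) : Expr :=
  .eq (.fold 30 31 u (.ite (.eq (.var 31) v) (.var 31) (.read A (.var 31)))) v

namespace FunctionalGraph

variable {n : ℕ} {g : ℕ → ℕ}

theorem iterate_ne_of_lt (hg : g n = n) {u : ℕ} :
    ∀ t s, s ≤ t → g^[t] u < n → g^[s] u ≠ n := by
  intro t s hst hlt h
  obtain ⟨k, rfl⟩ := Nat.exists_eq_add_of_le hst
  rw [add_comm, Function.iterate_add_apply, h, Function.iterate_fixed hg] at hlt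
  exact lt_irrefl _ hlt

theorem iterate_le (hg : g n = n) (hle : ∀ i < n, g i ≤ n) {u : ℕ} (hu : u ≤ n) (t : ℕ) :
    g^[t] u ≤ n := by
  induction t with
  | zero => exact hu
  | succ t ih =>
    rw [Function.iterate_succ_apply']
    rcases ih.lt_or_eq with h | h
    · exact hle _ h
    · rw [h, hg]

theorem reflTransGen_iterate (hg : g n = n) (hle : ∀ i < n, g i ≤ n) {u : ℕ} (hu : u < n) :
    ∀ t, g^[t] u < n → ReflTransGen (Step n g) u (g^[t] u)
  | 0, _ => .refl
  | t + 1, h => by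
    have hlt : g^[t] u < n := lt_of_le_of_ne (iterate_le hg hle hu.le t)
      (iterate_ne_of_lt hg (t + 1) t (by omega) h)
    exact (reflTransGen_iterate hg hle hu t hlt).tail
      ⟨hlt, h, (Function.iterate_succ_apply' g t u).symm⟩

/-- In a shortest walk there is no repetition, since it could be cut out. The sentinel `n` is
absorbing, so before `v` only vertices below `n` are visited, and the pigeonhole principle bounds
the length. -/
theorem reflTransGen_step_iff (hg : g n = n) (hle : ∀ i < n, g i ≤ n) {u v : ℕ} (hu : u < n)
    (hv : v < n) : ReflTransGen (Step n g) u v ↔ ∃ t ≤ n, g^[t] u = v := by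
  constructor
  · intro h
    have hex : ∃ t, g^[t] u = v := by
      clear hv
      induction h with
      | refl => exact ⟨0, rfl⟩
      | @tail b c _ hbc ih =>
        obtain ⟨t, ht⟩ := ih
        exact ⟨t + 1, by rw [Function.iterate_succ_apply', ht, hbc.2.2]⟩
    classical
    obtain ⟨ht, hmin⟩ : g^[Nat.find hex] u = v ∧ ∀ s < Nat.find hex, g^[s] u ≠ v :=
      ⟨Nat.find_spec hex, fun s hs => Nat.find_min hex hs⟩
    refine ⟨Nat.find hex, ?_, ht⟩
    generalize Nat.find hex = t at ht hmin
    by_contra hlt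
    have hmaps : ∀ s ∈ Finset.range (n + 1), g^[s] u ∈ Finset.range n := by
      intro s hs
      have hst : s ≤ t := by
        have := Finset.mem_range.1 hs
        omega
      exact Finset.mem_range.2 (lt_of_le_of_ne (iterate_le hg hle hu.le s)
        (iterate_ne_of_lt hg t s hst (ht ▸ hv)))
    obtain ⟨a, ha, b, hb, hab, heq⟩ := Finset.exists_ne_map_eq_of_card_lt_of_maps_to
      (by simp) hmaps
    have key : ∀ a b, a < b → b < n + 1 → g^[a] u = g^[b] u → False := by
      intro a b hab hb heq
      refine hmin (t - b + a) (by omega) ?_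
      rw [Function.iterate_add_apply, heq, ← Function.iterate_add_apply,
        Nat.sub_add_cancel (by omega), ht]
    rcases lt_or_gt_of_ne hab with h | h
    · exact key a b h (Finset.mem_range.1 hb) heq
    · exact key b a h (Finset.mem_range.1 ha) heq.symm
  · rintro ⟨t, -, rfl⟩
    exact reflTransGen_iterate hg hle hu t hv

theorem foldUpto_walk (g : ℕ → ℕ) (u v N : ℕ) :
    foldUpto (fun _ z => if z = v then z else g z) u N = v ↔ ∃ t ≤ N, g^[t] u = v := by
  -- The fold is plain iteration until `v` is met and rests at `v` from then on.
  have key : ∀ N, ((∃ t ≤ N, g^[t] u = v) →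
        foldUpto (fun _ z => if z = v then z else g z) u N = v) ∧
      ((∀ t ≤ N, g^[t] u ≠ v) →
        foldUpto (fun _ z => if z = v then z else g z) u N = g^[N] u) := by
    intro N
    induction N with
    | zero => simp [foldUpto]
    | succ N ih =>
      by_cases h : ∃ t ≤ N, g^[t] u = v
      · refine ⟨fun _ => by simp [foldUpto, ih.1 h], fun hno => ?_⟩
        obtain ⟨t, ht, heq⟩ := h
        exact absurd heq (hno t (by omega))
      · push Not at h
        have hN := ih.2 h
        have hstep : foldUpto (fun _ z => if z = v then z else g z) u (N + 1) = g^[N + 1] u := by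
          rw [foldUpto, hN, if_neg (h N le_rfl), Function.iterate_succ_apply']
        refine ⟨fun ⟨t, ht, heq⟩ => ?_, fun _ => hstep⟩
        rcases ht.lt_or_eq with ht | rfl
        · exact absurd heq (h t (by omega))
        · rw [hstep, heq]
  constructor
  · intro h
    by_contra hno
    push Not at hno
    exact hno N le_rfl (((key N).2 hno).symm.trans h)
  · exact (key N).1

theorem foldUpto_walk_iff (hg : g n = n) (hle : ∀ i < n, g i ≤ n) {u v : ℕ} (hu : u < n)
    (hv : v < n) : foldUpto (fun _ z => if z = v then z else g z) u (n + 1) = v ↔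
      ReflTransGen (Step n g) u v := by
  rw [foldUpto_walk]
  constructor
  · rintro ⟨t, -, rfl⟩
    exact reflTransGen_iterate hg hle hu t hv
  · intro h
    obtain ⟨t, ht, h⟩ := (reflTransGen_step_iff hg hle hu hv).1 h
    exact ⟨t, by omega, h⟩

end FunctionalGraph
end LiquidDemocracy

namespace LiquidDemocracy

open Relation

/-! ## The program for splitting functional graphs

Variable `1` holds the number `n` of vertices, variable `5` the bound `q` on the sizes of the
components, array `5` the characteristic function of `R`, and array `6` the function `g`. -/

namespace FunctionalGraph

/-- Array `7`: the vertices on cycles. -/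
def markCycles : Stmt :=
  .tab 7 10 (.ite (.lt (.var 10) (.var 1)) (.ite (.lt (.read 6 (.var 10)) (.var 1))
    (Expr.walk 6 (.read 6 (.var 10)) (.var 10)) (.const 0)) (.const 0))

/-- Array `9`: the weights for the cut edges in array `8`. -/
def computeWeights : Stmt :=
  .seq (.tab 9 10 (.const 0)) <| .loop 21 <| .tab 9 10 <| .add (.const 1) <|
    Expr.sum 11 12 <| .ite (.eq (.read 6 (.var 11)) (.var 10))
      (.ite (.read 8 (.var 11)) (.const 0)
        (.ite (.lt (.var 5) (.read 9 (.var 11))) (.const 0) (.read 9 (.var 11)))) (.const 0)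

/-- Array `10`: the weights when all cycles are cut completely. -/
def computeBaseWeights : Stmt :=
  .seq (.tab 8 10 (.read 7 (.var 10))) (.seq computeWeights (.tab 10 10 (.read 9 (.var 10))))

/-- Array `11`, at the index in variable `20`: the number of deletions on the cycle. -/
def computeCutCost : Stmt :=
  .seq (.tab 8 10 (.ite (.eq (.var 10) (.var 20)) (.const 1) (.ite (.read 7 (.var 10))
    (.ite (Expr.walk 6 (.var 20) (.var 10)) (.const 0) (.const 1)) (.const 0)))) <|
  .seq computeWeights <|
  .tab 11 10 <| .ite (.eq (.var 10) (.var 20)) (Expr.sum 11 12 <|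
    .ite (.lt (.var 11) (.var 1)) (.ite (Expr.walk 6 (.var 20) (.var 11))
      (.ite (.eq (.var 11) (.var 20)) (.const 1) (.lt (.var 5) (.read 9 (.var 11)))) (.const 0))
      (.const 0)) (.read 11 (.var 10))

/-- Array `12`: the vertices on bad cycles. -/
def markBadCycles : Stmt :=
  .tab 12 10 <| .ite (.read 7 (.var 10)) (.lt (.var 5) <| Expr.sum 11 12 <|
    .ite (.lt (.var 11) (.var 1)) (.ite (Expr.walk 6 (.var 10) (.var 11)) (.read 10 (.var 11)) (.const 0))
      (.const 0)) (.const 0)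

/-- Array `13`: the best vertices to delete first. -/
def markBestCuts : Stmt :=
  .tab 13 10 <| .ite (.read 12 (.var 10)) (.eq (Expr.sum 11 12 <|
    .ite (.lt (.var 11) (.var 1)) (.ite (Expr.walk 6 (.var 10) (.var 11))
      (.ite (.lt (.read 11 (.var 10)) (.read 11 (.var 11))) (.const 0)
        (.ite (.eq (.read 11 (.var 10)) (.read 11 (.var 11))) (.lt (.var 11) (.var 10)) (.const 1)))
      (.const 0)) (.const 0)) (.const 0)) (.const 0)

/-- Variable `6`: the least number of deletions. -/
def computeSplitCost : Stmt :=
  .seq markCycles <| .seq computeBaseWeights <| .seq (.loop 20 computeCutCost) <|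
  .seq markBadCycles <| .seq markBestCuts <| .asg 6 <| .add
    (Expr.sum 11 12 <| .ite (.read 5 (.var 11)) (.ite (.read 7 (.var 11)) (.const 0)
      (.lt (.var 5) (.read 10 (.var 11)))) (.const 0))
    (Expr.sum 11 12 <| .ite (.read 13 (.var 11)) (.read 11 (.var 11)) (.const 0))

variable {n : ℕ} {m : Memory}

-- Variables `30` and `31` are reserved for walks. The target is read again in every round and so
-- must be another variable, while the start is evaluated only once.
open Classical in
theorem eval_walk {A : ℕ} (hg : m.arr A n = n) (hle : ∀ i < n, m.arr A i ≤ n) {u : Expr} {k : ℕ}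
    (hk : k ≠ 30 ∧ k ≠ 31) (hu : u.eval (n + 1) m < n) (hv : m.reg k < n) :
    (Expr.walk A u (.var k)).eval (n + 1) m =
      if ReflTransGen (Step n (m.arr A)) (u.eval (n + 1) m) (m.reg k) then 1 else 0 := by
  rw [← if_congr (foldUpto_walk_iff hg hle hu hv) rfl rfl]
  simp [Expr.walk, Expr.eval, hk.1, hk.2]

/-- Turns a nonempty closed walk into one step and a possibly empty walk, the kind that `Expr.walk`
tests. -/
theorem onCycle_iff {g : ℕ → ℕ} {v : ℕ} :
    OnCycle n g v ↔ v < n ∧ g v < n ∧ ReflTransGen (Step n g) (g v) v := by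
  constructor
  · intro h
    obtain ⟨c, ⟨h₁, h₂, rfl⟩, hp⟩ := TransGen.head'_iff.1 h
    exact ⟨h₁, h₂, hp⟩
  · rintro ⟨h₁, h₂, hp⟩
    exact TransGen.head'_iff.2 ⟨g v, ⟨h₁, h₂, rfl⟩, hp⟩

open Classical in
theorem markCycles_spec (h1 : m.reg 1 = n) (hg : m.arr 6 n = n) (hle : ∀ i < n, m.arr 6 i ≤ n)
    {v : ℕ} (hv : v < n + 1) : (markCycles.exec (n + 1) m).arr 7 v =
      if OnCycle n (m.arr 6) v then 1 else 0 := by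
  rw [markCycles, Stmt.exec_tab_arr hv]
  by_cases h₁ : v < n
  · by_cases h₂ : m.arr 6 v < n
    · have := eval_walk (m := m.set 10 v) (u := .read 6 (.var 10)) (A := 6) (k := 10) hg hle
        (by simp) (by simpa [Expr.eval] using h₂) (by simpa using h₁)
      simp only [Expr.eval, this, onCycle_iff]
      simp [h1, h₁, h₂]
    · simp [Expr.eval, onCycle_iff, h1, h₂]
  · simp [Expr.eval, onCycle_iff, h1, h₁]

theorem eval_sum {N i a : ℕ} {e : Expr} {F : ℕ → ℕ} 
    (h : ∀ j < N, ∀ s, e.eval N ((m.set i j).set a s) = F j) :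
    (Expr.sum i a e).eval N m = ∑ j ∈ Finset.range N, F j := by
  rw [← foldUpto_add, Expr.sum, Expr.eval]
  refine foldUpto_congr fun j hj s => ?_
  simp [Expr.eval, h j hj]

/-- A table is computed entirely from the old contents of array `9`, so one pass of the loop is
exactly one round of `weight`. -/
theorem computeWeights_spec {v : ℕ} (hv : v < n + 1) :
    (computeWeights.exec (n + 1) m).arr 9 v =
      weight n (m.reg 5) (m.arr 6) (fun c => m.arr 8 c ≠ 0) (n + 1) v := by
  let P : ℕ → Memory → Prop := fun k m' =>
    m'.reg 5 = m.reg 5 ∧ m'.arr 6 = m.arr 6 ∧ m'.arr 8 = m.arr 8 ∧ ∀ v < n + 1, m'.arr 9 v =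
      weight n (m.reg 5) (m.arr 6) (fun c => m.arr 8 c ≠ 0) k v
  have key : P (n + 1) (computeWeights.exec (n + 1) m) := by
    refine foldUpto_induction P ?_ ?_ _
    · refine ⟨rfl, rfl, rfl, fun v hv => ?_⟩
      rw [Stmt.exec_tab_arr hv]
      rfl
    · rintro k m' ⟨h5, h6, h8, h9⟩
      refine ⟨by simpa [Stmt.exec] using h5, by simpa [Stmt.exec] using h6,
        by simpa [Stmt.exec] using h8, fun v hv => ?_⟩
      rw [Stmt.exec_tab_arr hv, Expr.eval, weight, eval_sum]
      · rfl
      · intro c hc s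
        simp only [Expr.eval, Memory.reg_set, Memory.arr_set]
        simp only [Nat.reduceEqDiff, if_true, if_false, h5, h6, h8, h9 c hc]
        by_cases h₁ : m.arr 6 c = v <;> by_cases h₂ : m.arr 8 c = 0 <;>
          by_cases h₃ : m.reg 5 < weight n (m.reg 5) (m.arr 6) (fun c => m.arr 8 c ≠ 0) k c <;>
          simp [h₁, h₂, h₃, ← not_lt]
  exact key.2.2.2 v hv

theorem weight_congr' {q : ℕ} {g : ℕ → ℕ} {X Y : ℕ → Prop} (hg : g n = n)
    (h : ∀ v < n, (X v ↔ Y v)) {v : ℕ} (hv : v < n) (t : ℕ) :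
    weight n q g X t v = weight n q g Y t v :=
  weight_congr hg (P := fun _ => True) (fun _ _ _ h => h) (fun v hv _ => h v hv) t v hv trivial

theorem computeBaseWeights_spec (hg : m.arr 6 n = n)
    (hc : ∀ v < n, m.arr 7 v ≠ 0 ↔ OnCycle n (m.arr 6) v) {v : ℕ} (hv : v < n) :
    (computeBaseWeights.exec (n + 1) m).arr 10 v =
      weight n (m.reg 5) (m.arr 6) (OnCycle n (m.arr 6)) (n + 1) v := by
  rw [computeBaseWeights, Stmt.exec_seq, Stmt.exec_seq, Stmt.exec_tab_arr (by omega)]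
  simp only [Expr.eval, Memory.reg_set, Memory.arr_set, if_true]
  rw [computeWeights_spec (by omega)]
  refine weight_congr' hg (fun c hc' => ?_) hv _
  rw [Stmt.exec_tab_arr (by omega)]
  simpa [Expr.eval] using hc c hc'

theorem computeCutCost_spec (h1 : m.reg 1 = n) (hg : m.arr 6 n = n)
    (hle : ∀ i < n, m.arr 6 i ≤ n)
    (hc : ∀ v < n, m.arr 7 v ≠ 0 ↔ OnCycle n (m.arr 6) v) {v : ℕ} (hv : v < n)
    (hr : m.reg 20 < n) :
    (computeCutCost.exec (n + 1) m).arr 11 v = if v = m.reg 20 then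
      cutCost n (m.reg 5) (m.arr 6) (m.reg 20) else m.arr 11 v := by
  classical
  set m₁ := (Stmt.tab 8 10 (.ite (.eq (.var 10) (.var 20)) (.const 1) (.ite (.read 7 (.var 10))
    (.ite (Expr.walk 6 (.var 20) (.var 10)) (.const 0) (.const 1)) (.const 0)))).exec (n + 1) m with hm₁
  have h8 : ∀ i < n, m₁.arr 8 i ≠ 0 ↔ CutAt n (m.arr 6) (m.reg 20) i := by
    intro i hi
    have hw := eval_walk (m := m.set 10 i) (u := .var 20) (A := 6) (k := 10) hg hle
        (by simp) (by simpa [Expr.eval] using hr) (by simpa using hi)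
    rw [hm₁, Stmt.exec_tab_arr (by omega)]
    simp only [Expr.eval] at hw
    simp only [Expr.eval, hw]
    have := hc i hi
    by_cases h₁ : i = m.reg 20 <;> by_cases h₂ : m.arr 7 i = 0 <;>
      by_cases h₃ : ReflTransGen (Step n (m.arr 6)) (m.reg 20) i <;>
      simp_all [CutAt]
  set m₂ := computeWeights.exec (n + 1) m₁ with hm₂
  have h9 : ∀ i < n, m₂.arr 9 i =
      weight n (m.reg 5) (m.arr 6) (CutAt n (m.arr 6) (m.reg 20)) (n + 1) i := by
    intro i hi
    rw [hm₂, computeWeights_spec (by omega)]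
    exact weight_congr' hg h8 hi _
  have hreg : ∀ r, r ≠ 21 → m₂.reg r = m.reg r := by
    intro r hr
    rw [hm₂, Stmt.exec_reg _ _ _ (by simpa [computeWeights, Stmt.regs] using hr)]
    rfl
  have harr : ∀ a, a ≠ 8 → a ≠ 9 → m₂.arr a = m.arr a := by
    intro a h₁ h₂
    rw [hm₂, Stmt.exec_arr _ _ _ (by simpa [computeWeights, Stmt.arrs] using h₂), hm₁,
      Stmt.exec_arr _ _ _ (by simpa [Stmt.arrs] using h₁)]
  have hex : (computeCutCost.exec (n + 1) m).arr 11 v = _ := Stmt.exec_tab_arr (m := m₂)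
    (show v < n + 1 by omega)
  rw [hex, Expr.eval, eval_sum (F := fun i => if ReflTransGen (Step n (m.arr 6)) (m.reg 20) i ∧
    (i = m.reg 20 ∨ m.reg 5 < weight n (m.reg 5) (m.arr 6) (CutAt n (m.arr 6) (m.reg 20)) (n + 1) i)
    then 1 else 0)]
  · simp [Expr.eval, hreg, harr, cutCost]
  · intro j hj s
    by_cases hjn : j < n
    · have hw := eval_walk (m := ((m₂.set 10 v).set 11 j).set 12 s) (u := .var 20) (A := 6)
        (k := 11) (by simpa [harr] using hg) (by simpa [harr] using hle)
        (by simp) (by simpa [Expr.eval, hreg] using hr) (by simpa using hjn)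
      simp only [Expr.eval] at hw
      simp only [Expr.eval, hw]
      by_cases h₁ : ReflTransGen (Step n (m.arr 6)) (m.reg 20) j <;>
      by_cases h₂ : j = m.reg 20 <;> simp [h₁, h₂, hreg, harr, h1, h9, hjn, hr]
    · have : ¬ ReflTransGen (Step n (m.arr 6)) (m.reg 20) j :=
        fun h => hjn (lt_of_reflTransGen hr h)
      simp [Expr.eval, hreg, h1, hjn, this]

end FunctionalGraph
end LiquidDemocracy

/-! ### Correctness of the splitting program -/

namespace LiquidDemocracy

open Relation

namespace FunctionalGraph

variable {n : ℕ} {m : Memory}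

/-- Covers all rounds for other vertices, including the extra round with index `n`, to which
`computeCutCost_spec` does not apply. -/
theorem computeCutCost_of_ne {v : ℕ} (hv : v < n + 1) (hne : v ≠ m.reg 20) :
    (computeCutCost.exec (n + 1) m).arr 11 v = m.arr 11 v := by
  rw [computeCutCost, Stmt.exec_seq, Stmt.exec_seq, Stmt.exec_tab_arr hv, Expr.eval, if_neg]
  · simp only [Expr.eval, Memory.arr_set, Memory.reg_set, if_true]
    rw [Stmt.exec_arr _ _ _ (by decide), Stmt.exec_arr _ _ _ (by decide)]
  · simp only [Expr.eval, Memory.reg_set]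
    rw [Stmt.exec_reg (r := 20) _ _ _ (by decide), Stmt.exec_reg (r := 20) _ _ _ (by decide)]
    simp [hne]

theorem computeCutCost_loop_spec (h1 : m.reg 1 = n) (hg : m.arr 6 n = n)
    (hle : ∀ i < n, m.arr 6 i ≤ n)
    (hc : ∀ v < n, m.arr 7 v ≠ 0 ↔ OnCycle n (m.arr 6) v) {v : ℕ} (hv : v < n) :
    ((Stmt.loop 20 computeCutCost).exec (n + 1) m).arr 11 v =
      cutCost n (m.reg 5) (m.arr 6) v := by
  let P : ℕ → Memory → Prop := fun k m' =>
    m'.reg 1 = n ∧ m'.reg 5 = m.reg 5 ∧ m'.arr 6 = m.arr 6 ∧ m'.arr 7 = m.arr 7 ∧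
      ∀ v < n, v < k → m'.arr 11 v = cutCost n (m.reg 5) (m.arr 6) v
  have key : P (n + 1) ((Stmt.loop 20 computeCutCost).exec (n + 1) m) := by
    refine foldUpto_induction P ⟨h1, rfl, rfl, rfl, fun v _ h => absurd h (by omega)⟩ ?_ _
    rintro k m' ⟨h1', h5, h6, h7, h11⟩
    refine ⟨?_, ?_, ?_, ?_, fun v hv hvk => ?_⟩
    · rw [Stmt.exec_reg _ _ _ (by decide)]; simpa using h1'
    · rw [Stmt.exec_reg _ _ _ (by decide)]; simpa using h5
    · rw [Stmt.exec_arr _ _ _ (by decide)]; simpa using h6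
    · rw [Stmt.exec_arr _ _ _ (by decide)]; simpa using h7
    by_cases hvk' : v = k
    · subst hvk'
      rw [computeCutCost_spec (by simpa using h1') (by simpa [h6] using hg)
        (by simpa [h6] using hle) (by simpa [h6, h7] using hc) hv (by simpa using hv)]
      simp [h5, h6]
    · rw [computeCutCost_of_ne (by omega) (by simpa using hvk')]
      exact h11 v hv (by omega)
  exact key.2.2.2.2 v hv (by omega)

theorem markBadCycles_spec (h1 : m.reg 1 = n) (hg : m.arr 6 n = n)
    (hle : ∀ i < n, m.arr 6 i ≤ n)
    (hc : ∀ v < n + 1, m.arr 7 v ≠ 0 ↔ OnCycle n (m.arr 6) v)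
    (hw : ∀ v < n, m.arr 10 v =
      weight n (m.reg 5) (m.arr 6) (OnCycle n (m.arr 6)) (n + 1) v) {v : ℕ} (hv : v < n + 1) :
    (markBadCycles.exec (n + 1) m).arr 12 v ≠ 0 ↔ BadCycle n (m.reg 5) (m.arr 6) v := by
  classical
  rw [markBadCycles, Stmt.exec_tab_arr hv]
  have hcv := hc v hv
  by_cases hvc : OnCycle n (m.arr 6) v
  · have hvn := hvc.lt
    have hsum : (Expr.sum 11 12 <| .ite (.lt (.var 11) (.var 1))
        (.ite (Expr.walk 6 (.var 10) (.var 11)) (.read 10 (.var 11)) (.const 0))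
        (.const 0)).eval (n + 1) (m.set 10 v) = _ :=
      eval_sum (F := fun u => if ReflTransGen (Step n (m.arr 6)) v u then
        weight n (m.reg 5) (m.arr 6) (OnCycle n (m.arr 6)) (n + 1) u else 0) (by
        intro j hj s
        by_cases hjn : j < n
        · have hwalk := eval_walk (m := ((m.set 10 v).set 11 j).set 12 s) (u := .var 10) (A := 6)
            (k := 11) hg hle (by simp) (by simpa [Expr.eval] using hvn) (by simpa using hjn)
          simp only [Expr.eval] at hwalk
          simp only [Expr.eval, hwalk]
          by_cases h₁ : ReflTransGen (Step n (m.arr 6)) v j <;> simp [h₁, h1, hjn, hw]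
        · have : ¬ ReflTransGen (Step n (m.arr 6)) v j := fun h => hjn (lt_of_reflTransGen hvn h)
          simp [Expr.eval, h1, hjn, this])
    rw [Expr.eval, if_pos (by simpa [Expr.eval] using hcv.2 hvc), Expr.eval, hsum, BadCycle]
    simp [Expr.eval, hvc]
  · rw [Expr.eval, if_neg (by simpa [Expr.eval] using mt hcv.1 hvc)]
    simp [Expr.eval, BadCycle, hvc]

/-- A universal condition is tested by counting its violations and comparing the sum with `0`;
`forced` uses the same device. -/
theorem markBestCuts_spec (h1 : m.reg 1 = n) (hg : m.arr 6 n = n)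
    (hle : ∀ i < n, m.arr 6 i ≤ n)
    (hb : ∀ v < n + 1, m.arr 12 v ≠ 0 ↔ BadCycle n (m.reg 5) (m.arr 6) v)
    (hh : ∀ v < n, m.arr 11 v = cutCost n (m.reg 5) (m.arr 6) v) {v : ℕ} (hv : v < n + 1) :
    (markBestCuts.exec (n + 1) m).arr 13 v ≠ 0 ↔ BestCut n (m.reg 5) (m.arr 6) v := by
  classical
  rw [markBestCuts, Stmt.exec_tab_arr hv]
  have hbv := hb v hv
  by_cases hvb : BadCycle n (m.reg 5) (m.arr 6) v
  · have hvn := hvb.1.lt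
    have hsum : (Expr.sum 11 12 <| .ite (.lt (.var 11) (.var 1))
        (.ite (Expr.walk 6 (.var 10) (.var 11))
      (.ite (.lt (.read 11 (.var 10)) (.read 11 (.var 11))) (.const 0)
        (.ite (.eq (.read 11 (.var 10)) (.read 11 (.var 11))) (.lt (.var 11) (.var 10)) (.const 1)))
      (.const 0)) (.const 0)).eval (n + 1) (m.set 10 v) = _ :=
      eval_sum (F := fun u => if ReflTransGen (Step n (m.arr 6)) v u ∧
        ¬ (cutCost n (m.reg 5) (m.arr 6) v < cutCost n (m.reg 5) (m.arr 6) u ∨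
          cutCost n (m.reg 5) (m.arr 6) v = cutCost n (m.reg 5) (m.arr 6) u ∧ v ≤ u)
        then 1 else 0) (by
        intro j hj s
        by_cases hjn : j < n
        · have hwalk := eval_walk (m := ((m.set 10 v).set 11 j).set 12 s) (u := .var 10) (A := 6)
            (k := 11) hg hle (by simp) (by simpa [Expr.eval] using hvn) (by simpa using hjn)
          simp only [Expr.eval] at hwalk
          simp only [Expr.eval, hwalk]
          by_cases h₁ : ReflTransGen (Step n (m.arr 6)) v j <;>
          by_cases h₂ : cutCost n (m.reg 5) (m.arr 6) v < cutCost n (m.reg 5) (m.arr 6) j <;>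
          by_cases h₃ : cutCost n (m.reg 5) (m.arr 6) v = cutCost n (m.reg 5) (m.arr 6) j <;>
            simp [h₁, h₂, h₃, h1, hjn, hh, hvn]
        · have : ¬ ReflTransGen (Step n (m.arr 6)) v j := fun h => hjn (lt_of_reflTransGen hvn h)
          simp [Expr.eval, h1, hjn, this])
    rw [Expr.eval, if_pos (by simpa [Expr.eval] using hbv.2 hvb), Expr.eval, hsum, BestCut]
    simp only [Expr.eval, ne_eq, ite_eq_right_iff, one_ne_zero, imp_false, not_not, hvb, true_and,
      Finset.sum_eq_zero_iff, Finset.mem_range]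
    constructor
    · intro h r hr
      have := h r (by have := lt_of_reflTransGen hvn hr; omega)
      by_contra hcon
      exact this ⟨hr, hcon⟩
    · exact fun h r _ hr => hr.2 (h r hr.1)
  · rw [Expr.eval, if_neg (by simpa [Expr.eval] using mt hbv.1 hvb)]
    simp [Expr.eval, BestCut, hvb]

theorem computeSplitCost_spec (h1 : m.reg 1 = n) (hg : m.arr 6 n = n)
    (hle : ∀ i < n, m.arr 6 i ≤ n) {R : Finset ℕ} (hR : ∀ v < n + 1, m.arr 5 v ≠ 0 ↔ v ∈ R)
    (hRn : ∀ v ∈ R, v < n) :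
    (computeSplitCost.exec (n + 1) m).reg 6 = splitCost n (m.reg 5) (m.arr 6) R := by
  classical
  set m₁ := markCycles.exec (n + 1) m with hm₁
  set m₂ := computeBaseWeights.exec (n + 1) m₁ with hm₂
  set m₃ := (Stmt.loop 20 computeCutCost).exec (n + 1) m₂ with hm₃
  set m₄ := markBadCycles.exec (n + 1) m₃ with hm₄
  set m₅ := markBestCuts.exec (n + 1) m₄ with hm₅
  have hr₁ : ∀ r ∉ markCycles.regs, m₁.reg r = m.reg r := fun r => Stmt.exec_reg _ _ _
  have ha₁ : ∀ a ∉ markCycles.arrs, m₁.arr a = m.arr a := fun r => Stmt.exec_arr _ _ _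
  have hr₂ : ∀ r ∉ computeBaseWeights.regs, m₂.reg r = m₁.reg r := fun r => Stmt.exec_reg _ _ _
  have ha₂ : ∀ a ∉ computeBaseWeights.arrs, m₂.arr a = m₁.arr a := fun r => Stmt.exec_arr _ _ _
  have hr₃ : ∀ r ∉ (Stmt.loop 20 computeCutCost).regs, m₃.reg r = m₂.reg r :=
    fun r => Stmt.exec_reg _ _ _
  have ha₃ : ∀ a ∉ (Stmt.loop 20 computeCutCost).arrs, m₃.arr a = m₂.arr a :=
    fun r => Stmt.exec_arr _ _ _
  have hr₄ : ∀ r ∉ markBadCycles.regs, m₄.reg r = m₃.reg r := fun r => Stmt.exec_reg _ _ _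
  have ha₄ : ∀ a ∉ markBadCycles.arrs, m₄.arr a = m₃.arr a := fun r => Stmt.exec_arr _ _ _
  have hr₅ : ∀ r ∉ markBestCuts.regs, m₅.reg r = m₄.reg r := fun r => Stmt.exec_reg _ _ _
  have ha₅ : ∀ a ∉ markBestCuts.arrs, m₅.arr a = m₄.arr a := fun r => Stmt.exec_arr _ _ _
  have e₁ : m₁.arr 6 = m.arr 6 := ha₁ 6 (by decide)
  have e₂ : m₂.arr 6 = m.arr 6 := (ha₂ 6 (by decide)).trans e₁
  have e₃ : m₃.arr 6 = m.arr 6 := (ha₃ 6 (by decide)).trans e₂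
  have e₄ : m₄.arr 6 = m.arr 6 := (ha₄ 6 (by decide)).trans e₃
  have f₁ : m₁.reg 1 = n := (hr₁ 1 (by decide)).trans h1
  have f₂ : m₂.reg 1 = n := (hr₂ 1 (by decide)).trans f₁
  have f₃ : m₃.reg 1 = n := (hr₃ 1 (by decide)).trans f₂
  have f₄ : m₄.reg 1 = n := (hr₄ 1 (by decide)).trans f₃
  have q₁ : m₁.reg 5 = m.reg 5 := hr₁ 5 (by decide)
  have q₂ : m₂.reg 5 = m.reg 5 := (hr₂ 5 (by decide)).trans q₁
  have q₃ : m₃.reg 5 = m.reg 5 := (hr₃ 5 (by decide)).trans q₂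
  have q₄ : m₄.reg 5 = m.reg 5 := (hr₄ 5 (by decide)).trans q₃
  have q₅ : m₅.reg 5 = m.reg 5 := (hr₅ 5 (by decide)).trans q₄
  have c₁ : ∀ v < n + 1, m₁.arr 7 v ≠ 0 ↔ OnCycle n (m.arr 6) v := by
    intro v hv
    rw [hm₁, markCycles_spec h1 hg hle hv]
    simp
  have c₂ : ∀ v < n + 1, m₂.arr 7 v ≠ 0 ↔ OnCycle n (m.arr 6) v := by
    rwa [ha₂ 7 (by decide)]
  have c₃ : ∀ v < n + 1, m₃.arr 7 v ≠ 0 ↔ OnCycle n (m.arr 6) v := by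
    rwa [ha₃ 7 (by decide)]
  have c₅ : ∀ v < n + 1, m₅.arr 7 v ≠ 0 ↔ OnCycle n (m.arr 6) v := by
    rwa [ha₅ 7 (by decide), ha₄ 7 (by decide)]
  have w₂ : ∀ v < n, m₂.arr 10 v =
      weight n (m.reg 5) (m.arr 6) (OnCycle n (m.arr 6)) (n + 1) v := by
    intro v hv
    have := computeBaseWeights_spec (m := m₁) (by rw [e₁, hg])
      (fun v hv => by rw [e₁]; exact c₁ v (by omega)) hv
    rwa [q₁, e₁] at this
  have w₃ : ∀ v < n, m₃.arr 10 v =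
      weight n (m.reg 5) (m.arr 6) (OnCycle n (m.arr 6)) (n + 1) v := by
    rwa [ha₃ 10 (by decide)]
  have w₅ : ∀ v < n, m₅.arr 10 v =
      weight n (m.reg 5) (m.arr 6) (OnCycle n (m.arr 6)) (n + 1) v := by
    rwa [ha₅ 10 (by decide), ha₄ 10 (by decide)]
  have k₃ : ∀ v < n, m₃.arr 11 v = cutCost n (m.reg 5) (m.arr 6) v := by
    intro v hv
    have := computeCutCost_loop_spec (m := m₂) f₂ (by rw [e₂, hg]) (by rwa [e₂])
      (fun v hv => by rw [e₂]; exact c₂ v (by omega)) hv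
    rwa [q₂, e₂] at this
  have k₄ : ∀ v < n, m₄.arr 11 v = cutCost n (m.reg 5) (m.arr 6) v := by
    rwa [ha₄ 11 (by decide)]
  have k₅ : ∀ v < n, m₅.arr 11 v = cutCost n (m.reg 5) (m.arr 6) v := by
    rwa [ha₅ 11 (by decide)]
  have b₄ : ∀ v < n + 1, m₄.arr 12 v ≠ 0 ↔ BadCycle n (m.reg 5) (m.arr 6) v := by
    intro v hv
    have := markBadCycles_spec (m := m₃) f₃ (by rw [e₃, hg]) (by rwa [e₃])
      (by rwa [e₃]) (by rwa [e₃, q₃]) hv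
    rwa [q₃, e₃] at this
  have s₅ : ∀ v < n + 1, m₅.arr 13 v ≠ 0 ↔ BestCut n (m.reg 5) (m.arr 6) v := by
    intro v hv
    have := markBestCuts_spec (m := m₄) f₄ (by rw [e₄, hg]) (by rwa [e₄])
      (by rwa [e₄, q₄]) (by rwa [e₄, q₄]) hv
    rwa [q₄, e₄] at this
  have r₅ : ∀ v < n + 1, m₅.arr 5 v ≠ 0 ↔ v ∈ R := by
    rwa [ha₅ 5 (by decide), ha₄ 5 (by decide), ha₃ 5 (by decide), ha₂ 5 (by decide),
      ha₁ 5 (by decide)]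
  have hfin : (computeSplitCost.exec (n + 1) m).reg 6 = Expr.eval (n + 1) (.add
    (Expr.sum 11 12 <| .ite (.read 5 (.var 11)) (.ite (.read 7 (.var 11)) (.const 0)
      (.lt (.var 5) (.read 10 (.var 11)))) (.const 0))
    (Expr.sum 11 12 <| .ite (.read 13 (.var 11)) (.read 11 (.var 11)) (.const 0))) m₅ := by
    simp only [computeSplitCost, Stmt.exec_seq, ← hm₁, ← hm₂, ← hm₃, ← hm₄, ← hm₅]
    rw [Stmt.exec, Memory.reg_set, if_pos rfl]
  rw [hfin, Expr.eval, splitCost, eval_sum, eval_sum]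
  · intro j hj s
    have := s₅ j hj
    by_cases hbest : BestCut n (m.reg 5) (m.arr 6) j
    · simp [Expr.eval, this.2 hbest, hbest, k₅ j hbest.1.1.lt]
    · simp [Expr.eval, not_not.1 (mt this.1 hbest), hbest]
  · intro j hj s
    have h₁ := r₅ j hj
    have h₂ := c₅ j hj
    by_cases hjR : j ∈ R
    · have hjn := hRn j hjR
      by_cases hjc : OnCycle n (m.arr 6) j
      · simp [Expr.eval, h₁.2 hjR, h₂.2 hjc, hjc]
      · simp [Expr.eval, h₁.2 hjR, not_not.1 (mt h₂.1 hjc), hjc, hjR, w₅ j hjn, q₅]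
    · simp [Expr.eval, not_not.1 (mt h₁.1 hjR), hjR]

end FunctionalGraph
end LiquidDemocracy

namespace LiquidDemocracy

open Relation FunctionalGraph

/-! ## The program for control by deleting voters -/

namespace CDVInstance

theorem getD_flatMap_range (F : ℕ → ℕ → ℕ) (k n : ℕ) :
    ∀ {i j : ℕ}, i < k → j < n →
      ((List.range k).flatMap fun i => (List.range n).map (F i)).getD (i * n + j) 0 = F i j := by
  have hlen : ∀ k, ((List.range k).flatMap fun i => (List.range n).map (F i)).length = k * n := by
    intro k
    simp [List.length_flatMap]
  induction k with
  | zero => intro i j hi; omega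
  | succ k ih =>
    intro i j hi hj
    rw [List.range_succ, List.flatMap_append]
    rcases Nat.lt_succ_iff_lt_or_eq.1 hi with hi | rfl
    · rw [List.getD_append _ _ _ _ (by
        rw [hlen]
        calc i * n + j < (i + 1) * n := by rw [Nat.succ_mul]; omega
          _ ≤ k * n := Nat.mul_le_mul_right _ hi)]
      exact ih hi hj
    · rw [List.getD_append_right _ _ _ _ (by rw [hlen]; omega), hlen]
      simp [List.getD_eq_getElem?_getD, hj]

variable (I : CDVInstance)

theorem encode_votingCost {i : ℕ} (hi : i < I.n) :
    I.encode.getD (4 + i) 0 = I.G.votingCost i := by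
  rw [encode, List.append_assoc, List.append_assoc, List.getD_append_right _ _ _ _ (by simp),
    List.getD_append _ _ _ _ (by simpa using hi)]
  simp [List.getD_eq_getElem?_getD, hi]

theorem encode_delegatingCost {i : ℕ} (hi : i < I.n) :
    I.encode.getD (4 + (I.n + i)) 0 = I.G.delegatingCost i := by
  rw [encode, List.append_assoc, List.append_assoc, List.getD_append_right _ _ _ _ (by simp),
    List.getD_append_right _ _ _ _ (by simp), List.getD_append _ _ _ _ (by simpa using hi)]
  simp [List.getD_eq_getElem?_getD, hi]

theorem encode_edges {i j : ℕ} (hi : i < I.n) (hj : j < I.n) :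
    I.encode.getD (4 + (I.n + (I.n + (i * I.n + j)))) 0 = if (i, j) ∈ I.G.edges then 1 else 0 := by
  rw [encode, List.append_assoc, List.append_assoc, List.getD_append_right _ _ _ _ (by simp),
    List.getD_append_right _ _ _ _ (by simp), List.getD_append_right _ _ _ _ (by simp)]
  have := getD_flatMap_range (fun i j => if (i, j) ∈ I.G.edges then 1 else 0) I.n I.n hi hj
  simpa using this

/-- Each entry of the list contributes at least its separator, and there are `n` voting costs
besides the parameters. So loops of length `n + 1` are affordable although `n` is written in binary.
-/
theorem lt_bitLength_encode : I.n + 1 ≤ bitLength I.encode := by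
  have h : ∀ L : List ℕ, L.length ≤ bitLength L := by
    intro L
    induction L with
    | nil => simp
    | cons a L ih =>
      simp only [bitLength, List.map_cons, List.sum_cons, List.length_cons] at ih ⊢
      omega
  refine le_trans ?_ (h _)
  simp only [encode, List.length_append, List.length_map, List.length_range, List.length_cons]
  omega

/-- The numbers of the input are in the variables `1`, `2`, `3` and the array `0`, and the array
`2` holds the voter approved by each voter. -/
structure Ready (m : Memory) : Prop where
  n : m.reg 1 = I.n
  x : m.reg 2 = I.x
  k : m.reg 3 = I.k
  votingCost : ∀ i < I.n, m.arr 0 (4 + i) = I.G.votingCost i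
  delegatingCost : ∀ i < I.n, m.arr 0 (4 + (I.n + i)) = I.G.delegatingCost i
  approves : ∀ i < I.n, ∀ j < I.n, m.arr 2 i = j ↔ (i, j) ∈ I.G.edges
  sentinel : m.arr 2 I.n = I.n
  le : ∀ i < I.n, m.arr 2 i ≤ I.n

variable {I} {m : Memory}

theorem lt_of_mem_edges {i j : ℕ} (h : (i, j) ∈ I.G.edges) : i < I.n ∧ j < I.n := by
  simpa [I.voters_eq] using I.G.edges_mem _ h

theorem x_lt : I.x < I.n := by
  simpa [I.voters_eq] using I.x_mem

theorem Ready.exec (h : I.Ready m) {N : ℕ} {s : Stmt}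
    (hr : 1 ∉ s.regs ∧ 2 ∉ s.regs ∧ 3 ∉ s.regs) (ha : 0 ∉ s.arrs ∧ 2 ∉ s.arrs) :
    I.Ready (s.exec N m) where
  n := (s.exec_reg N m hr.1).trans h.n
  x := (s.exec_reg N m hr.2.1).trans h.x
  k := (s.exec_reg N m hr.2.2).trans h.k
  votingCost := s.exec_arr N m ha.1 ▸ h.votingCost
  delegatingCost := s.exec_arr N m ha.1 ▸ h.delegatingCost
  approves := s.exec_arr N m ha.2 ▸ h.approves
  sentinel := s.exec_arr N m ha.2 ▸ h.sentinel
  le := s.exec_arr N m ha.2 ▸ h.le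

theorem Ready.step_eq (h : I.Ready m) : Step I.n (m.arr 2) = I.G.Approves := by
  funext a c
  refine propext ⟨fun ⟨ha, hc, hac⟩ => (h.approves a ha c hc).1 hac, fun hac => ?_⟩
  obtain ⟨ha, hc⟩ := lt_of_mem_edges hac
  exact ⟨ha, hc, (h.approves a ha c hc).2 hac⟩

/-- The voting cost of a voter. -/
def votingCostOf (i : Expr) : Expr := .read 0 (.add (.const 4) i)

/-- The delegating cost of a voter. -/
def delegatingCostOf (i : Expr) : Expr := .read 0 (.add (.const 4) (.add (.var 1) i))

/-- Variables `1`, `2`, `3`: the numbers `n`, `x`, `k`; array `2`: the approved voters. -/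
def setup : Stmt :=
  .seq (.asg 1 (.read 0 (.const 0))) <| .seq (.asg 2 (.read 0 (.const 1))) <|
  .seq (.asg 3 (.read 0 (.const 2))) <|
  .seq (.tab 1 10 (.sub (Expr.sum 11 12 (.var 10)) (.var 10))) <|
  .tab 2 10 <| .fold 11 12 (.var 1) <| .ite (.lt (.var 10) (.var 1)) (.ite (.lt (.var 11) (.var 1))
    (.ite (.read 0 (.add (.const 4) (.add (.var 1) (.add (.var 1)
      (.add (.read 1 (.var 10)) (.var 11)))))) (.var 11) (.var 12)) (.var 12)) (.var 12)

/-- Array `3`: the steps of loyal voters; array `4`: the loyal voters; variable `5`: their number;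
array `5`: the rest; array `6`: the steps in the rest. Variable `4` holds the deleted voter. -/
def prepare : Stmt :=
  .seq (.tab 3 10 (.ite (.eq (.var 10) (.var 2)) (.var 1) (.ite (.eq (.var 10) (.var 4)) (.var 1)
    (.ite (.lt (delegatingCostOf (.var 10)) (votingCostOf (.var 10))) (.read 2 (.var 10))
      (.var 1))))) <|
  .seq (.tab 4 10 (.ite (.lt (.var 10) (.var 1)) (.ite (.eq (.var 10) (.var 2)) (.const 0)
    (Expr.walk 3 (.var 10) (.var 2))) (.const 0))) <|
  .seq (.asg 5 (Expr.sum 11 12 (.read 4 (.var 11)))) <|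
  .seq (.tab 5 10 (.ite (.lt (.var 10) (.var 1)) (.ite (.eq (.var 10) (.var 2)) (.const 0)
    (.ite (.eq (.var 10) (.var 4)) (.const 0) (.ite (.read 4 (.var 10)) (.const 0) (.const 1))))
      (.const 0))) <|
  .tab 6 10 (.ite (.read 5 (.var 10)) (.ite (.lt (votingCostOf (.var 10))
    (delegatingCostOf (.var 10))) (.var 1) (.ite (.read 5 (.read 2 (.var 10)))
      (.read 2 (.var 10)) (.var 1))) (.var 1))

/-- Is the voter in variable `2` forced to cast? -/
def forced : Expr :=
  .ite (.lt (.read 2 (.var 2)) (.var 1))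
    (.ite (.lt (votingCostOf (.var 2)) (delegatingCostOf (.var 2))) (.const 1)
      (.ite (Expr.walk 2 (.read 2 (.var 2)) (.var 2)) (.eq (Expr.sum 11 12 <|
        .ite (.lt (.var 11) (.var 1)) (.ite (Expr.walk 2 (.var 2) (.var 11))
          (.ite (.eq (.var 11) (.var 2)) (.const 0)
            (.ite (.lt (.add (votingCostOf (.var 2)) (delegatingCostOf (.var 11)))
              (.add (votingCostOf (.var 11)) (delegatingCostOf (.var 2)))) (.const 0) (.const 1)))
          (.const 0)) (.const 0)) (.const 0)) (.const 0))) (.const 1)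

/-- The complete program. -/
def decideControl : Stmt :=
  .seq setup <| .seq (.asg 4 (.var 1)) <| .seq prepare <| .seq computeSplitCost <|
  .seq (.asg 7 (.ite forced (.eq (.lt (.var 3) (.var 6)) (.const 0)) (.const 0))) <|
  .seq (.asg 4 (.read 2 (.var 2))) <| .seq prepare <| .seq computeSplitCost <|
  .asg 0 (.ite (.var 7) (.const 1) (.ite (.lt (.var 4) (.var 1)) (.ite (.eq (.var 4) (.var 2))
    (.const 0) (.lt (.var 6) (.var 3))) (.const 0)))

/-- The fold keeps the last hit; the start value `n` stands for "none". -/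
theorem foldUpto_search (P : ℕ → Prop) [DecidablePred P] (n k : ℕ) :
    (foldUpto (fun j s => if P j then j else s) n k = n ∧ ∀ j < k, ¬ P j) ∨
      P (foldUpto (fun j s => if P j then j else s) n k) := by
  induction k with
  | zero => exact .inl ⟨rfl, fun j hj => absurd hj (by omega)⟩
  | succ k ih =>
    rw [foldUpto]
    by_cases hk : P k
    · rw [if_pos hk]
      exact .inr hk
    · rw [if_neg hk]
      refine ih.imp_left fun ⟨h, hno⟩ => ⟨h, fun j hj => ?_⟩
      rcases Nat.lt_succ_iff_lt_or_eq.1 hj with hj | rfl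
      · exact hno j hj
      · exact hk

theorem ready_setup (hG : I.G.Functional) :
    I.Ready (setup.exec (I.n + 1) (Memory.init I.encode)) := by
  set m₀ := Memory.init I.encode with hm₀
  set m₁ := (Stmt.seq (.asg 1 (.read 0 (.const 0))) <| .seq (.asg 2 (.read 0 (.const 1))) <|
    .seq (.asg 3 (.read 0 (.const 2))) <|
    (.tab 1 10 (.sub (Expr.sum 11 12 (.var 10)) (.var 10)))).exec (I.n + 1) m₀ with hm₁
  set m₂ := setup.exec (I.n + 1) m₀ with hm₂
  have hreg : ∀ r, m₂.reg r = m₁.reg r := fun r => rfl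
  have harr : ∀ a, a ≠ 2 → m₂.arr a = m₁.arr a := fun a ha =>
    Stmt.exec_arr _ (.tab 2 10 _) m₁ (by simpa [Stmt.arrs] using ha)
  have hinput : m₁.arr 0 = fun i => I.encode.getD i 0 := by
    rw [hm₁, Stmt.exec_arr _ _ _ (by decide)]
    simp [hm₀, Memory.init]
  have h1 : m₁.reg 1 = I.n := by
    simp [hm₁, Stmt.exec, Expr.eval, hm₀, Memory.init, encode]
  have h2 : m₁.reg 2 = I.x := by
    simp [hm₁, Stmt.exec, Expr.eval, hm₀, Memory.init, encode]
  have h3 : m₁.reg 3 = I.k := by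
    simp [hm₁, Stmt.exec, Expr.eval, hm₀, Memory.init, encode]
  -- The machine cannot multiply: the row offset `i * n` arises as a sum of `n + 1` copies of `i`,
  -- less one copy.
  have hoff : ∀ i < I.n + 1, m₁.arr 1 i = i * I.n := by
    intro i hi
    rw [hm₁, Stmt.exec_seq, Stmt.exec_seq, Stmt.exec_seq, Stmt.exec_tab_arr hi, Expr.eval,
      eval_sum (F := fun _ => i) (fun j _ s => by simp [Expr.eval])]
    simp only [Expr.eval, Memory.reg_set, if_true, Finset.sum_const, Finset.card_range,
      smul_eq_mul]
    rw [Nat.succ_mul, Nat.add_sub_cancel, mul_comm]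
  have hfold : ∀ i < I.n, m₂.arr 2 i = foldUpto (fun j s => if j < I.n ∧ (i, j) ∈ I.G.edges then j
      else s) I.n (I.n + 1) := by
    intro i hi
    have hex : m₂.arr 2 i = _ := Stmt.exec_tab_arr (m := m₁) (show i < I.n + 1 by omega)
    rw [hex, Expr.eval]
    simp only [Expr.eval, Memory.reg_set, Memory.arr_set, Nat.reduceEqDiff, if_true, if_false, h1]
    refine foldUpto_congr fun j _ s => ?_
    rw [hoff i (by omega), hinput]
    by_cases hj : j < I.n
    · have he := I.encode_edges hi hj
      rw [List.getD_eq_getElem?_getD] at he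
      simp [hi, hj, he]
    · simp [hj]
  have hsearch : ∀ i < I.n, (m₂.arr 2 i = I.n ∧ ∀ j < I.n, (i, j) ∉ I.G.edges) ∨
      (i, m₂.arr 2 i) ∈ I.G.edges := by
    intro i hi
    rw [hfold i hi]
    rcases foldUpto_search (fun j => j < I.n ∧ (i, j) ∈ I.G.edges) I.n (I.n + 1) with h | h
    · exact .inl ⟨h.1, fun j hj hij => h.2 j (by omega) ⟨hj, hij⟩⟩
    · exact .inr h.2
  refine ⟨h1, h2, h3, ?_, ?_, ?_, ?_, ?_⟩
  · intro i hi
    rw [harr 0 (by decide), hinput]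
    exact I.encode_votingCost hi
  · intro i hi
    rw [harr 0 (by decide), hinput]
    exact I.encode_delegatingCost hi
  · intro i hi j hj
    rcases hsearch i hi with h | h
    · rw [h.1]
      exact ⟨fun h' => absurd h' (by omega), fun h' => absurd h' (h.2 j hj)⟩
    · exact ⟨fun h' => h' ▸ h, fun h' => hG _ _ _ h h'⟩
  · have hex : m₂.arr 2 I.n = _ := Stmt.exec_tab_arr (m := m₁) (show I.n < I.n + 1 by omega)
    rw [hex, Expr.eval]
    simp only [Expr.eval, Memory.reg_set, Memory.arr_set, Nat.reduceEqDiff, if_true, if_false, h1]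
    refine foldUpto_induction (fun _ s => s = I.n) rfl (fun j s hs => ?_) _
    simp [hs]
  · intro i hi
    rcases hsearch i hi with h | h
    · exact h.1.le
    · exact (lt_of_mem_edges h).2.le

open Classical in
theorem forced_spec (h : I.Ready m) : forced.eval (I.n + 1) m ≠ 0 ↔ I.G.Forced I.x := by
  have hx : I.x < I.n := x_lt
  unfold Election.Forced
  rw [forced]
  by_cases h₁ : m.arr 2 I.x < I.n
  · have hE := (h.approves _ hx _ h₁).1 rfl
    have hno : ¬ ∀ j, (I.x, j) ∉ I.G.edges := fun hno => hno _ hE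
    simp only [hno, false_or]
    by_cases h₂ : I.G.votingCost I.x < I.G.delegatingCost I.x
    · simp [Expr.eval, votingCostOf, delegatingCostOf, h.x, h.n, h₁, h₂, h.votingCost _ hx,
        h.delegatingCost _ hx]
    have hw := eval_walk (m := m) (u := .read 2 (.var 2)) (A := 2) (k := 2) h.sentinel h.le
      (by simp) (by simpa [Expr.eval, h.x] using h₁) (by simpa [h.x] using hx)
    simp only [Expr.eval, h.x, h.step_eq] at hw
    have hcyc : TransGen I.G.Approves I.x I.x ↔
        ReflTransGen I.G.Approves (m.arr 2 I.x) I.x := by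
      rw [← h.step_eq]
      exact onCycle_iff.trans ⟨fun h => h.2.2, fun h => ⟨hx, h₁, h⟩⟩
    by_cases h₃ : ReflTransGen I.G.Approves (m.arr 2 I.x) I.x
    · have hsum : (Expr.sum 11 12 <|
        .ite (.lt (.var 11) (.var 1)) (.ite (Expr.walk 2 (.var 2) (.var 11))
          (.ite (.eq (.var 11) (.var 2)) (.const 0)
            (.ite (.lt (.add (votingCostOf (.var 2)) (delegatingCostOf (.var 11)))
              (.add (votingCostOf (.var 11)) (delegatingCostOf (.var 2)))) (.const 0) (.const 1)))
          (.const 0)) (.const 0)).eval (I.n + 1) m = _ :=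
        eval_sum (F := fun j => if j < I.n ∧ ReflTransGen I.G.Approves I.x j ∧ j ≠ I.x ∧
          ¬ I.G.votingCost I.x + I.G.delegatingCost j < I.G.votingCost j + I.G.delegatingCost I.x
          then 1 else 0) (by
          intro j hj s
          by_cases hjn : j < I.n
          · have hwalk := eval_walk (m := (m.set 11 j).set 12 s) (u := .var 2) (A := 2)
              (k := 11) h.sentinel h.le (by simp) (by simpa [Expr.eval, h.x] using hx)
              (by simpa using hjn)
            simp only [Expr.eval, Memory.arr_set, h.step_eq] at hwalk
            simp only [Expr.eval, hwalk]
            by_cases h₄ : ReflTransGen I.G.Approves I.x j <;>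
            by_cases h₅ : j = I.x <;>
            by_cases h₆ : I.G.votingCost I.x + I.G.delegatingCost j <
              I.G.votingCost j + I.G.delegatingCost I.x <;>
            simp [votingCostOf, delegatingCostOf, Expr.eval, h₄, h₅, h₆, h.n, h.x, hjn,
              h.votingCost _ hx, h.delegatingCost _ hx, h.votingCost _ hjn,
              h.delegatingCost _ hjn]
          · simp [Expr.eval, h.n, hjn])
      rw [Expr.eval, if_pos (by simp [Expr.eval, h.x, h.n, h₁]), Expr.eval,
        if_neg (by simp [Expr.eval, votingCostOf, delegatingCostOf, h.x, h.n, h₂,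
          h.votingCost _ hx, h.delegatingCost _ hx]), Expr.eval, if_pos (by
          simp only [hw, h₃, if_true]; simp), Expr.eval, hsum]
      simp only [Expr.eval, ne_eq, ite_eq_right_iff, one_ne_zero, imp_false, not_not,
        Finset.sum_eq_zero_iff, Finset.mem_range, h₂, false_or, hcyc, h₃, true_and]
      constructor
      · intro hall j hjx hj
        have hjn : j < I.n := lt_of_reflTransGen hx (h.step_eq ▸ hj)
        by_contra hcon
        exact hall j (by omega) ⟨hjn, hj, hjx, hcon⟩
      · exact fun hall j _ hj => hj.2.2.2 (hall j hj.2.2.1 hj.2.1)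
    · rw [Expr.eval, if_pos (by simp [Expr.eval, h.x, h.n, h₁]), Expr.eval,
        if_neg (by simp [Expr.eval, votingCostOf, delegatingCostOf, h.x, h.n, h₂,
          h.votingCost _ hx, h.delegatingCost _ hx]), Expr.eval, if_neg (by
          simp only [hw, h₃, if_false]; simp)]
      simp [Expr.eval, h₂, hcyc, h₃]
  · have hno : ∀ j, (I.x, j) ∉ I.G.edges := by
      intro j hj
      have hlt := lt_of_mem_edges hj
      have := (h.approves _ hx j hlt.2).2 hj
      omega
    simp [Expr.eval, h.x, h.n, h₁, hno]

end CDVInstance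
end LiquidDemocracy

/-! ### Correctness of the decision program -/

namespace LiquidDemocracy

open Relation FunctionalGraph

namespace CDVInstance

variable {I : CDVInstance} {m : Memory}

/-- The link between both theories: with the number of loyal voters as `q`, the sets counted by
`Splits` are the sets `upstream`. -/
theorem splits_iff_dominated {G : Election ℕ} {x n : ℕ} {B T : Finset ℕ} {g : ℕ → ℕ}
    (hstep : Step n g = G.RestStep x B) :
    Splits n (G.loyal x B).card g (G.rest x B) T ↔ G.Dominated x B T := by
  unfold Splits Election.Dominated
  rw [hstep]
  rfl

-- Through `hB` one program serves both cases: variable `4` holds `b` for `B = {b}`, and `n`, which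
-- names no voter, for `B = ∅`.
open Classical in
theorem prepare_spec (h : I.Ready m) {B : Finset ℕ} (hB : ∀ i < I.n, i ∈ B ↔ i = m.reg 4) :
    let m' := prepare.exec (I.n + 1) m
    m'.reg 5 = (I.G.loyal I.x B).card ∧ (∀ v < I.n + 1, m'.arr 5 v ≠ 0 ↔ v ∈ I.G.rest I.x B) ∧
      m'.arr 6 I.n = I.n ∧ (∀ i < I.n, m'.arr 6 i ≤ I.n) ∧
      Step I.n (m'.arr 6) = I.G.RestStep I.x B := by
  have hx : I.x < I.n := x_lt
  set s₁ := Stmt.tab 3 10 (.ite (.eq (.var 10) (.var 2)) (.var 1) (.ite (.eq (.var 10) (.var 4))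
    (.var 1) (.ite (.lt (delegatingCostOf (.var 10)) (votingCostOf (.var 10))) (.read 2 (.var 10))
      (.var 1)))) with hs₁
  set s₂ := Stmt.tab 4 10 (.ite (.lt (.var 10) (.var 1)) (.ite (.eq (.var 10) (.var 2)) (.const 0)
    (Expr.walk 3 (.var 10) (.var 2))) (.const 0)) with hs₂
  set s₃ := Stmt.asg 5 (Expr.sum 11 12 (.read 4 (.var 11))) with hs₃
  set s₄ := Stmt.tab 5 10 (.ite (.lt (.var 10) (.var 1)) (.ite (.eq (.var 10) (.var 2)) (.const 0)
    (.ite (.eq (.var 10) (.var 4)) (.const 0) (.ite (.read 4 (.var 10)) (.const 0) (.const 1))))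
      (.const 0)) with hs₄
  set s₅ := Stmt.tab 6 10 (.ite (.read 5 (.var 10)) (.ite (.lt (votingCostOf (.var 10))
    (delegatingCostOf (.var 10))) (.var 1) (.ite (.read 5 (.read 2 (.var 10)))
      (.read 2 (.var 10)) (.var 1))) (.var 1)) with hs₅
  set m₁ := s₁.exec (I.n + 1) m with hm₁
  set m₂ := s₂.exec (I.n + 1) m₁ with hm₂
  set m₃ := s₃.exec (I.n + 1) m₂ with hm₃
  set m₄ := s₄.exec (I.n + 1) m₃ with hm₄
  set m₅ := s₅.exec (I.n + 1) m₄ with hm₅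
  have hexec : prepare.exec (I.n + 1) m = m₅ := rfl
  have R₁ : I.Ready m₁ := h.exec (s := s₁) (by simp [hs₁, Stmt.regs]) (by simp [hs₁, Stmt.arrs])
  have R₂ : I.Ready m₂ := R₁.exec (s := s₂) (by simp [hs₂, Stmt.regs]) (by simp [hs₂, Stmt.arrs])
  have R₃ : I.Ready m₃ := R₂.exec (s := s₃) (by simp [hs₃, Stmt.regs]) (by simp [hs₃, Stmt.arrs])
  have R₄ : I.Ready m₄ := R₃.exec (s := s₄) (by simp [hs₄, Stmt.regs]) (by simp [hs₄, Stmt.arrs])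
  have hnd : ∀ i < I.n, m₁.arr 3 i = if i ≠ I.x ∧ i ∉ B ∧
      I.G.delegatingCost i < I.G.votingCost i then m.arr 2 i else I.n := by
    intro i hi
    rw [hm₁, hs₁, Stmt.exec_tab_arr (by omega)]
    by_cases c₁ : i = I.x <;> by_cases c₂ : i = m.reg 4 <;>
      by_cases c₃ : I.G.delegatingCost i < I.G.votingCost i <;>
      simp [Expr.eval, votingCostOf, delegatingCostOf, h.n, h.x, h.votingCost _ hi,
        h.delegatingCost _ hi, hB i hi, c₁, c₂, c₃] <;> simp_all
  have hndn : m₁.arr 3 I.n = I.n := by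
    rw [hm₁, hs₁, Stmt.exec_tab_arr (by omega)]
    simp [Expr.eval, h.n, h.sentinel]
  have hndle : ∀ i < I.n, m₁.arr 3 i ≤ I.n := by
    intro i hi
    rw [hnd i hi]
    split
    · exact h.le i hi
    · exact le_rfl
  have hloyal : Step I.n (m₁.arr 3) = I.G.LoyalStep I.x B := by
    funext a c
    refine propext ⟨fun ⟨ha, hc, hac⟩ => ?_, fun ⟨h₁, h₂, h₃, hE⟩ => ?_⟩
    · rw [hnd a ha] at hac
      split at hac
      · next hcond => exact ⟨hcond.1, hcond.2.1, hcond.2.2, (h.approves a ha c hc).1 hac⟩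
      · omega
    · obtain ⟨ha, hc⟩ := lt_of_mem_edges hE
      refine ⟨ha, hc, ?_⟩
      rw [hnd a ha, if_pos ⟨h₁, h₂, h₃⟩]
      exact (h.approves a ha c hc).2 hE
  have hlt : ∀ i, i ∈ I.G.loyal I.x B → i < I.n := by
    intro i hi
    simpa [I.voters_eq] using (Election.mem_loyal.1 hi).1
  have h4 : ∀ i < I.n + 1, m₂.arr 4 i = if i ∈ I.G.loyal I.x B then 1 else 0 := by
    intro i hi
    rw [hm₂, hs₂, Stmt.exec_tab_arr hi]
    by_cases hin : i < I.n
    · have hw := eval_walk (m := m₁.set 10 i) (u := .var 10) (A := 3) (k := 2) hndn hndle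
        (by simp) (by simpa [Expr.eval] using hin) (by simpa [R₁.x] using hx)
      simp only [Expr.eval, Memory.arr_set, hloyal] at hw
      simp only [Expr.eval, hw]
      have hiV : i ∈ I.G.voters := by simpa [I.voters_eq] using hin
      by_cases hix : i = I.x
      · simp [hix, R₁.x, R₁.n, Election.mem_loyal]
      · simp [hix, R₁.x, R₁.n, Election.mem_loyal, hin, hiV]
    · have : i ∉ I.G.loyal I.x B := fun hi' => hin (hlt i hi')
      simp [Expr.eval, R₁.n, hin, this]
  have h5 : m₃.reg 5 = (I.G.loyal I.x B).card := by
    rw [hm₃, hs₃, Stmt.exec, Memory.reg_set, if_pos rfl,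
      eval_sum (F := fun i => if i ∈ I.G.loyal I.x B then 1 else 0)
        (fun j hj s => by simp [Expr.eval, h4 j hj]), Finset.sum_boole, Nat.cast_id]
    congr 1
    ext i
    simp only [Finset.mem_filter, Finset.mem_range, and_iff_right_iff_imp]
    intro hi
    have := hlt i hi
    omega
  have h4' : m₃.arr 4 = m₂.arr 4 := rfl
  have hr4 : m₃.reg 4 = m.reg 4 := by
    simp [hm₃, hm₂, hm₁, hs₃, hs₂, hs₁, Stmt.exec]
  have hrest : ∀ v < I.n + 1, m₄.arr 5 v ≠ 0 ↔ v ∈ I.G.rest I.x B := by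
    intro v hv
    rw [hm₄, hs₄, Stmt.exec_tab_arr hv]
    by_cases hvn : v < I.n
    · have hvV : v ∈ I.G.voters := by simpa [I.voters_eq] using hvn
      simp only [Expr.eval, Memory.reg_set, Memory.arr_set, Nat.reduceEqDiff, if_true, if_false,
        R₃.n, R₃.x, hr4, h4', h4 v hv, Election.mem_rest, hvV, hB v hvn, hvn]
      by_cases c₁ : v = I.x <;> by_cases c₂ : v = m.reg 4 <;>
        by_cases c₃ : v ∈ I.G.loyal I.x B <;> simp [c₁, c₂, c₃]
    · have : v ∉ I.G.rest I.x B := fun h' => hvn (by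
        simpa [I.voters_eq] using (Election.mem_rest.1 h').1)
      simp [Expr.eval, R₃.n, hvn, this]
  have hg : ∀ i < I.n, m₅.arr 6 i = if i ∈ I.G.rest I.x B ∧
      I.G.delegatingCost i ≤ I.G.votingCost i ∧ m.arr 2 i ∈ I.G.rest I.x B then m.arr 2 i
      else I.n := by
    intro i hi
    have harr2 : m₄.arr 2 = m.arr 2 := by
      simp [hm₄, hm₃, hm₂, hm₁, hs₄, hs₃, hs₂, hs₁, Stmt.exec]
    have c₁ := hrest i (by omega)
    -- The successor may be the sentinel `n`, which is why `hrest` includes that index.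
    have c₂ := hrest (m.arr 2 i) (by have := h.le i hi; omega)
    rw [hm₅, hs₅, Stmt.exec_tab_arr (by omega)]
    by_cases d₁ : m₄.arr 5 i = 0 <;> by_cases d₂ : m₄.arr 5 (m.arr 2 i) = 0 <;>
      by_cases d₃ : I.G.votingCost i < I.G.delegatingCost i <;>
      simp [Expr.eval, votingCostOf, delegatingCostOf, R₄.n, R₄.votingCost _ hi,
        R₄.delegatingCost _ hi, harr2, ← c₁, ← c₂, d₁, d₂, d₃, ← not_lt]
  rw [hexec]
  refine ⟨h5, hrest, ?_, ?_, ?_⟩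
  · rw [hm₅, hs₅, Stmt.exec_tab_arr (by omega), Expr.eval, if_neg]
    · simp [Expr.eval, R₄.n]
    · have : I.n ∉ I.G.rest I.x B := fun h' => by
        simpa [I.voters_eq] using (Election.mem_rest.1 h').1
      simpa [Expr.eval] using mt (hrest I.n (by omega)).1 this
  · intro i hi
    rw [hg i hi]
    split
    · exact h.le i hi
    · exact le_rfl
  · funext a c
    refine propext ⟨fun ⟨ha, hc, hac⟩ => ?_, fun ⟨h₁, h₂, hE, h₃⟩ => ?_⟩
    · rw [hg a ha] at hac
      split at hac
      · next hcond =>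
        subst hac
        exact ⟨hcond.1, hcond.2.2, (h.approves a ha _ hc).1 rfl, hcond.2.1⟩
      · omega
    · obtain ⟨ha, hc⟩ := lt_of_mem_edges hE
      have hac := (h.approves a ha c hc).2 hE
      refine ⟨ha, hc, ?_⟩
      rw [hg a ha, hac, if_pos ⟨h₁, h₃, h₂⟩]

theorem computeSplitCost_prepare_spec (h : I.Ready m) {B : Finset ℕ}
    (hB : ∀ i < I.n, i ∈ B ↔ i = m.reg 4) (t : ℕ) :
    (computeSplitCost.exec (I.n + 1) (prepare.exec (I.n + 1) m)).reg 6 ≤ t ↔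
      ∃ T, I.G.Dominated I.x B T ∧ T.card ≤ t := by
  obtain ⟨h5, hrest, hg, hle, hstep⟩ := prepare_spec h hB
  have hR : I.Ready (prepare.exec (I.n + 1) m) := h.exec (by decide) (by decide)
  have hlt : ∀ v ∈ I.G.rest I.x B, v < I.n := fun v hv => by
    simpa [I.voters_eq] using (Election.mem_rest.1 hv).1
  rw [computeSplitCost_spec hR.n hg hle hrest hlt, ← exists_splits_iff ⟨hlt, hg, fun a b hab => by
    rw [hstep] at hab
    exact ⟨hab.1, hab.2.1⟩⟩, h5]
  simp only [splits_iff_dominated hstep]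

theorem decideControl_spec (hG : I.G.Functional) :
    (I.IsYes → (decideControl.exec (I.n + 1) (Memory.init I.encode)).reg 0 = 1) ∧
      (¬ I.IsYes → (decideControl.exec (I.n + 1) (Memory.init I.encode)).reg 0 = 0) := by
  classical
  have hx : I.x < I.n := x_lt
  set m₀ := setup.exec (I.n + 1) (Memory.init I.encode) with hm₀
  have R₀ : I.Ready m₀ := ready_setup hG
  set m₁ := (Stmt.asg 4 (.var 1)).exec (I.n + 1) m₀ with hm₁
  have R₁ : I.Ready m₁ := R₀.exec (by simp [Stmt.regs]) (by simp [Stmt.arrs])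
  set m₂ := computeSplitCost.exec (I.n + 1) (prepare.exec (I.n + 1) m₁) with hm₂
  have R₂ : I.Ready m₂ := (R₁.exec (by decide) (by decide)).exec (by decide) (by decide)
  set m₃ := (Stmt.asg 7 (.ite forced (.eq (.lt (.var 3) (.var 6)) (.const 0)) (.const 0))).exec
    (I.n + 1) m₂ with hm₃
  have R₃ : I.Ready m₃ := R₂.exec (by simp [Stmt.regs]) (by simp [Stmt.arrs])
  set m₄ := (Stmt.asg 4 (.read 2 (.var 2))).exec (I.n + 1) m₃ with hm₄
  have R₄ : I.Ready m₄ := R₃.exec (by simp [Stmt.regs]) (by simp [Stmt.arrs])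
  set m₅ := computeSplitCost.exec (I.n + 1) (prepare.exec (I.n + 1) m₄) with hm₅
  have R₅ : I.Ready m₅ := (R₄.exec (by decide) (by decide)).exec (by decide) (by decide)
  have hb₁ : m₁.reg 4 = I.n := by simp [hm₁, Stmt.exec, Expr.eval, R₀.n]
  have hcost₁ : m₂.reg 6 ≤ I.k ↔ ∃ T, I.G.Dominated I.x ∅ T ∧ T.card ≤ I.k :=
    computeSplitCost_prepare_spec R₁ (fun i hi => by simp [hb₁]; omega) _
  have h7 : m₃.reg 7 = if I.G.Forced I.x ∧ m₂.reg 6 ≤ I.k then 1 else 0 := by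
    have hf := forced_spec R₂
    rw [hm₃, Stmt.exec, Memory.reg_set, if_pos rfl, Expr.eval]
    by_cases c₁ : I.G.Forced I.x
    · rw [if_pos (hf.2 c₁)]
      by_cases c₂ : m₂.reg 6 ≤ I.k
      · simp [Expr.eval, R₂.k, c₁, c₂, not_lt.2 c₂]
      · simp [Expr.eval, R₂.k, c₂, not_le.1 c₂]
    · rw [if_neg (mt hf.1 c₁)]
      simp [Expr.eval, c₁]
  have h7' : m₅.reg 7 = m₃.reg 7 := by
    rw [hm₅, Stmt.exec_reg _ _ _ (by decide), Stmt.exec_reg _ _ _ (by decide), hm₄,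
      Stmt.exec_reg _ _ _ (by simp [Stmt.regs])]
  have h4 : m₅.reg 4 = m₃.arr 2 I.x := by
    rw [hm₅, Stmt.exec_reg _ _ _ (by decide), Stmt.exec_reg _ _ _ (by decide), hm₄]
    simp [Stmt.exec, Expr.eval, R₃.x]
  have h4' : m₄.reg 4 = m₃.arr 2 I.x := by
    simp [hm₄, Stmt.exec, Expr.eval, R₃.x]
  -- Deleting the approved voter uses up one of the `k` deletions, hence the strict comparison;
  -- `k_pos` allows the bound to be written as `k - 1`.
  have hcost₂ : m₅.reg 6 < I.k ↔ ∃ T, I.G.Dominated I.x {m₃.arr 2 I.x} T ∧ T.card + 1 ≤ I.k := by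
    have hk := I.k_pos
    have := computeSplitCost_prepare_spec R₄ (B := {m₃.arr 2 I.x})
      (fun i _ => by simp [h4']) (I.k - 1)
    rw [show m₅.reg 6 < I.k ↔ m₅.reg 6 ≤ I.k - 1 by omega, hm₅, this]
    exact exists_congr fun T => and_congr_right fun _ => by omega
  -- The second pass also runs if `x` approves nobody or itself; the output test then ignores its
  -- result.
  have hyes : I.IsYes ↔ (I.G.Forced I.x ∧ m₂.reg 6 ≤ I.k) ∨
      (m₃.arr 2 I.x < I.n ∧ m₃.arr 2 I.x ≠ I.x ∧ m₅.reg 6 < I.k) := by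
    rw [IsYes, Election.controlByDeletingVoters_iff hG I.x_mem, hcost₁, hcost₂]
    refine or_congr Iff.rfl ⟨?_, ?_⟩
    · rintro ⟨b, hbx, hxb, h⟩
      have hb := (lt_of_mem_edges hxb).2
      rw [(R₃.approves _ hx b hb).2 hxb]
      exact ⟨hb, hbx, h⟩
    · rintro ⟨hb, hbx, h⟩
      exact ⟨_, hbx, (R₃.approves _ hx _ hb).1 rfl, h⟩
  have hout : (decideControl.exec (I.n + 1) (Memory.init I.encode)).reg 0 =
      if I.IsYes then 1 else 0 := by
    have hex : (decideControl.exec (I.n + 1) (Memory.init I.encode)).reg 0 =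
        (Expr.ite (.var 7) (.const 1) (.ite (.lt (.var 4) (.var 1)) (.ite (.eq (.var 4) (.var 2))
          (.const 0) (.lt (.var 6) (.var 3))) (.const 0))).eval (I.n + 1) m₅ := rfl
    rw [hex, if_congr hyes rfl rfl]
    simp only [Expr.eval, h7', h7, h4, R₅.n, R₅.x, R₅.k]
    by_cases c₁ : I.G.Forced I.x ∧ m₂.reg 6 ≤ I.k
    · simp [c₁]
    · by_cases c₂ : m₃.arr 2 I.x < I.n <;> by_cases c₃ : m₃.arr 2 I.x = I.x <;>
        simp [c₁, c₂, c₃]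
  exact ⟨fun h => hout.trans (if_pos h), fun h => hout.trans (if_neg h)⟩

end CDVInstance
end LiquidDemocracy

theorem mainTheorem9 :
    LiquidDemocracy.SolvableInPolynomialTime
      (fun I : LiquidDemocracy.CDVInstanceDegreeLeOne => I.1.encode)
      (fun I : LiquidDemocracy.CDVInstanceDegreeLeOne => I.1.IsYes) :=
  LiquidDemocracy.solvableInPolynomialTime_of_stmt LiquidDemocracy.CDVInstance.decideControl
    (fun I => I.1.lt_bitLength_encode)
    (fun I => LiquidDemocracy.CDVInstance.decideControl_spec
      (LiquidDemocracy.Election.functional_of_maxOutDegree_le_one I.2))
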